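/- Let $\Omega\subseteq\mathbb R^n$ be open, and let $\varepsilon$ range over $(0,1]$. Write $\langle\xi\rangle=(1+|\xi|^2)^{1/2}$, $\hat f(\xi)=\int e^{-iy\xi}f(y)\,dy$, and $K\Subset O$ for "$K$ is a compact subset of $O$". **Generalized functions.** For an open set $O\subseteq\mathbb R^d$, a net $(u_\varepsilon)$ in $C^\infty(O)$ is *moderate* if for all $K\Subset O$ and all $\alpha$ there is $p\in\mathbb R$ with $\sup_K|\partial^\alpha u_\varepsilon|=O(\varepsilon^{-p})$ as $\varepsilon\to0$. A moderate net is *negligible* if $\sup_K|u_\varepsilon|=O(\varepsilon^{q})$ for all $K\Subset O$ and all $q\in\mathbb R$. $\mathcal G(O)$ is the quotient of the moderate nets by the negligible ones. $\mathcal G^\infty(O)$ is the set of elements having a representative such that for every $K\Subset O$ there is $N$ with $\sup_K|\partial^\alpha u_\varepsilon|=O(\varepsilon^{-N})$ for all $\alpha$. $\mathcal G_c(O)$ is the set of elements having a representative whose members all vanish outside one common compact subset of $O$. **Symbols.** $\Pi_{sc}$ is the set of nets $(\omega_\varepsilon)$ of real numbers that are bounded below by a positive constant and such that for every $p\ge0$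 there is $c_p>0$ with $\omega_\varepsilon^p\le c_p\varepsilon^{-1}$ for all $\varepsilon$. For $a\in C^\infty(\Omega\times\mathbb R^n)$ put $|a|^{(m)}_{K,\alpha,\beta}=\sup_{x\in K,\,\xi\in\mathbb R^n}\langle\xi\rangle^{-m+|\alpha|}|\partial_\xi^\alpha\partial_x^\beta a(x,\xi)|$. A *slow scale net of symbols of order $m$* is a net $(a_\varepsilon)$ in $C^\infty(\Omega\times\mathbb R^n)$ such that for every $K\Subset\Omega$ there is $(\omega_\varepsilon)\in\Pi_{sc}$ such that for all $\alpha,\beta$ there is $c>0$ with $|a_\varepsilon|^{(m)}_{K,\alpha,\beta}\le c\,\omega_\varepsilon$ for all $\varepsilon$. It is *negligible* if for all $K,\alpha,\beta$ and $q\in\mathbb N$ there is $c>0$ with $|a_\varepsilon|^{(m)}_{K,\alpha,\beta}\le c\,\varepsilon^q$ for all $\varepsilon$. The quotient space consists of the *slow scale generalized symbols of order $m$*. **Micro-ellipticity.** A *conic neighborhood* of $\xi_0\neq0$ is an open set $\Gamma\ni\xi_0$ in $\mathbb R^n\setminus\{0\}$ that is invariant under multiplication by positive numbers. For a slow scale generalized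 symbol $a$ of order $m$, $\mathrm{Ell}_{sc}(a)$ is the set of all $(x_0,\xi_0)\in\Omega\times(\mathbb R^n\setminus\{0\})$ for which there are a representative $(a_\varepsilon)$ of $a$, an open neighborhood $U$ of $x_0$ with compact closure in $\Omega$, a conic neighborhood $\Gamma$ of $\xi_0$, and $(r_\varepsilon),(s_\varepsilon)\in\Pi_{sc}$ with $$|a_\varepsilon(x,\xi)|\ge s_\varepsilon^{-1}\langle\xi\rangle^m\qquad\text{for all } x\in U,\ \xi\in\Gamma,\ |\xi|\ge r_\varepsilon,\ \varepsilon\in(0,1].$$ **Operators.** For $u\in\mathcal G_c(\Omega)$, $a(x,D)u\in\mathcal G(\Omega)$ is the class of $(a_\varepsilon(x,D)u_\varepsilon)$, where $a_\varepsilon(x,D)f(x)=(2\pi)^{-n}\int e^{ix\xi}a_\varepsilon(x,\xi)\hat f(\xi)\,d\xi$. The kernel of $a(x,D)$ is the functional $k(v)=\int_\Omega a(x,D)(v(x,\cdot))\,dx$ on $\mathcal G_c(\Omega\times\Omega)$, with values in the generalized complex numbers. Its support is the complement in $\Omega\times\Omega$ of the union of all open $W\subseteq\Omega\times\Omega$ such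 that $k$ vanishes on $\mathcal G_c(W)$. A relatively closed subset of $\Omega\times\Omega$ is *proper* if both projections from it to $\Omega$ are proper maps, and $a(x,D)$ is *properly supported* if the support of $k$ is proper. A properly supported $a(x,D)$ extends to $\mathcal G(\Omega)$: $a(x,D)u$ is the class of $x\mapsto\big(a_\varepsilon(x,D)(\chi(x,\cdot)u_\varepsilon)\big)(x)$, where $\chi\in C^\infty(\Omega\times\Omega)$ has proper support and equals $1$ in a neighborhood of the support of $k$. (This class does not depend on $\chi$ or on the representatives.) **Wave front sets.** For $u\in\mathcal G(\Omega)$, the generalized wave front set $WF_g(u)$ is the set of all $(x_0,\xi_0)\in\Omega\times(\mathbb R^n\setminus\{0\})$ at which $u$ is not $\mathcal G^\infty$-microlocally regular. Here $u$ is *$\mathcal G^\infty$-microlocally regular* at $(x_0,\xi_0)$ if there are a representative $(u_\varepsilon)$ of $u$, a function $\phi\in C_c^\infty(\Omega)$ with $\phi(x_0)=1$, a conic neighborhood $\Gamma$ of $\xi_0$ and a number $N$ such that $\sup_{\xi\in\Gamma}\langle\xi\rangle^l|\widehat{\phi u_\varepsilon}(\xi)|=O(\varepsilon^{-N})$ as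 $\varepsilon\to0$ for every $l\in\mathbb R$. Moreover $$W_{sc}(u)=\bigcap_a\Big(\big(\Omega\times(\mathbb R^n\setminus\{0\})\big)\setminus\mathrm{Ell}_{sc}(a)\Big),$$ the intersection being over all slow scale generalized symbols $a$ of order $0$ such that $a(x,D)$ is properly supported and $a(x,D)u\in\mathcal G^\infty(\Omega)$. **Theorem.** For every open $\Omega\subseteq\mathbb R^n$ and every $u\in\mathcal G(\Omega)$, $$W_{sc}(u)=WF_g(u).$$ -/

import Mathlib

open Set TopologicalSpace MeasureTheory Topology
open scoped ContDiff

namespace Colombeau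

noncomputable section

/-! ### Asymptotics of nets -/

/-- The parameter set `(0,1]`. -/
abbrev Eps : Type := Ioc (0 : ℝ) 1

/-- `sup_{x ∈ S} |f_ε(x)| = O(ε ^ p)` as `ε → 0`. -/
def BigOOn {X : Type*} (S : Set X) (f : Eps → X → ℂ) (p : ℝ) : Prop :=
  ∃ C ε₀ : ℝ, 0 < ε₀ ∧ ∀ ε : Eps, (ε : ℝ) ≤ ε₀ → ∀ x ∈ S, ‖f ε x‖ ≤ C * (ε : ℝ) ^ p

/-- The net of complex numbers `z` is negligible (it represents `0` in the ring of generalized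
complex numbers): `|z_ε| = O(ε ^ q)` for every `q`. -/
def NegligibleNumber (z : Eps → ℂ) : Prop :=
  ∀ q : ℝ, ∃ C ε₀ : ℝ, 0 < ε₀ ∧ ∀ ε : Eps, (ε : ℝ) ≤ ε₀ → ‖z ε‖ ≤ C * (ε : ℝ) ^ q

theorem BigOOn.mono {X : Type*} {S : Set X} {f : Eps → X → ℂ} {p q : ℝ} (h : BigOOn S f p)
    (hqp : q ≤ p) : BigOOn S f q := by
  obtain ⟨C, ε₀, h0, h⟩ := h
  refine ⟨|C|, ε₀, h0, fun ε hε x hx => (h ε hε x hx).trans ?_⟩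
  have h1 : (ε : ℝ) ^ p ≤ (ε : ℝ) ^ q := Real.rpow_le_rpow_of_exponent_ge ε.2.1 ε.2.2 hqp
  have h2 : 0 ≤ (ε : ℝ) ^ p := Real.rpow_nonneg ε.2.1.le p
  nlinarith [le_abs_self C, abs_nonneg C]

theorem BigOOn.congr {X : Type*} {S : Set X} {f g : Eps → X → ℂ} {p : ℝ} (h : BigOOn S f p)
    (hfg : ∀ ε, EqOn (g ε) (f ε) S) : BigOOn S g p := by
  obtain ⟨C, ε₀, h0, h⟩ := h
  exact ⟨C, ε₀, h0, fun ε hε x hx => by rw [hfg ε hx]; exact h ε hε x hx⟩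

theorem BigOOn.add {X : Type*} {S : Set X} {f g : Eps → X → ℂ} {p : ℝ} (hf : BigOOn S f p)
    (hg : BigOOn S g p) : BigOOn S (f + g) p := by
  obtain ⟨C, ε₀, h0, h⟩ := hf
  obtain ⟨C', ε₀', h0', h'⟩ := hg
  refine ⟨C + C', min ε₀ ε₀', lt_min h0 h0', fun ε hε x hx => ?_⟩
  have h1 := h ε (hε.trans (min_le_left _ _)) x hx
  have h2 := h' ε (hε.trans (min_le_right _ _)) x hx
  calc ‖(f + g) ε x‖ ≤ ‖f ε x‖ + ‖g ε x‖ := norm_add_le _ _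
    _ ≤ (C + C') * (ε : ℝ) ^ p := by linarith

theorem BigOOn.smul {X : Type*} {S : Set X} {f : Eps → X → ℂ} {p : ℝ} (c : ℂ)
    (hf : BigOOn S f p) : BigOOn S (c • f) p := by
  obtain ⟨C, ε₀, h0, h⟩ := hf
  refine ⟨‖c‖ * C, ε₀, h0, fun ε hε x hx => ?_⟩
  have h1 := h ε hε x hx
  calc ‖(c • f) ε x‖ = ‖c‖ * ‖f ε x‖ := norm_smul c (f ε x)
    _ ≤ ‖c‖ * (C * (ε : ℝ) ^ p) := by gcongr
    _ = ‖c‖ * C * (ε : ℝ) ^ p := by ring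

theorem BigOOn.zero {X : Type*} (S : Set X) (p : ℝ) : BigOOn S 0 p :=
  ⟨0, 1, one_pos, fun ε _ x _ => by simp⟩

/-! ### Iterated partial derivatives -/

section Derivatives

variable {V : Type*} [NormedAddCommGroup V] [NormedSpace ℝ V]

/-- The iterated directional derivative `∂_{v₁} ⋯ ∂_{v_k} f` for the list `[v₁, …, v_k]`.
The partial derivatives `∂^α f` with `|α| = k` are those in which all `v_i` are coordinate vectors,
and every `∂_{v₁} ⋯ ∂_{v_k} f` of a smooth `f` is a linear combination of these. -/
def dirD : List V → (V → ℂ) → V → ℂ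
  | [], f => f
  | v :: l, f => fun x => fderiv ℝ (dirD l f) x v

theorem contDiffOn_dirD {O : Set V} (hO : IsOpen O) {f : V → ℂ} (hf : ContDiffOn ℝ ∞ f O) :
    ∀ l : List V, ContDiffOn ℝ ∞ (dirD l f) O
  | [] => hf
  | v :: l => by
    have h := (contDiffOn_dirD hO hf l).fderiv_of_isOpen (m := ∞) hO (by simp)
    exact h.clm_apply contDiffOn_const

theorem dirD_add {O : Set V} (hO : IsOpen O) {f g : V → ℂ} (hf : ContDiffOn ℝ ∞ f O)
    (hg : ContDiffOn ℝ ∞ g O) : ∀ l : List V, EqOn (dirD l (f + g)) (dirD l f + dirD l g) O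
  | [] => fun _ _ => rfl
  | v :: l => by
    intro x hx
    have h1 : dirD l (f + g) =ᶠ[𝓝 x] dirD l f + dirD l g :=
      (dirD_add hO hf hg l).eventuallyEq_of_mem (hO.mem_nhds hx)
    have hdf := ((contDiffOn_dirD hO hf l).differentiableOn (by simp)).differentiableAt
      (hO.mem_nhds hx)
    have hdg := ((contDiffOn_dirD hO hg l).differentiableOn (by simp)).differentiableAt
      (hO.mem_nhds hx)
    simp only [dirD, Pi.add_apply]
    rw [h1.fderiv_eq, fderiv_add hdf hdg]
    rfl

theorem dirD_smul {O : Set V} (hO : IsOpen O) {f : V → ℂ} (hf : ContDiffOn ℝ ∞ f O) (c : ℂ) :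
    ∀ l : List V, EqOn (dirD l (c • f)) (c • dirD l f) O
  | [] => fun _ _ => rfl
  | v :: l => by
    intro x hx
    have h1 : dirD l (c • f) =ᶠ[𝓝 x] c • dirD l f :=
      (dirD_smul hO hf c l).eventuallyEq_of_mem (hO.mem_nhds hx)
    have hdf := ((contDiffOn_dirD hO hf l).differentiableOn (by simp)).differentiableAt
      (hO.mem_nhds hx)
    simp only [dirD, Pi.smul_apply]
    rw [h1.fderiv_eq, fderiv_const_smul hdf]
    rfl

theorem dirD_zero : ∀ l : List V, dirD l (0 : V → ℂ) = 0
  | [] => rfl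
  | v :: l => by
    funext x
    simp [dirD, dirD_zero l]

end Derivatives

/-! ### Colombeau generalized functions -/

section Functions

variable {V : Type*} [NormedAddCommGroup V] [NormedSpace ℝ V]

/-- Moderate nets of smooth functions on the open set `O`. Smooth functions on `O` are given by
functions on the whole space that are smooth on `O`; their values off `O` play no role, and
`negligible` below identifies functions that agree on `O`. -/
def moderate (O : Opens V) : Submodule ℂ (Eps → V → ℂ) where
  carrier := {u | (∀ ε, ContDiffOn ℝ ∞ (u ε) O) ∧
    ∀ K : Set V, IsCompact K → K ⊆ O → ∀ l : List V, ∃ p : ℝ,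
      BigOOn K (fun ε => dirD l (u ε)) (-p)}
  zero_mem' := ⟨fun _ => contDiffOn_const, fun K _ _ l => ⟨0, by
    refine (BigOOn.zero K _).congr fun ε x _ => ?_
    simp [dirD_zero]⟩⟩
  add_mem' := by
    rintro u v ⟨hu, hu'⟩ ⟨hv, hv'⟩
    refine ⟨fun ε => (hu ε).add (hv ε), fun K hK hKO l => ?_⟩
    obtain ⟨p, hp⟩ := hu' K hK hKO l
    obtain ⟨q, hq⟩ := hv' K hK hKO l
    refine ⟨max p q, ?_⟩
    refine ((hp.mono (neg_le_neg (le_max_left p q))).add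
      (hq.mono (neg_le_neg (le_max_right p q)))).congr fun ε x hx => ?_
    exact dirD_add O.isOpen (hu ε) (hv ε) l (hKO hx)
  smul_mem' := by
    rintro c u ⟨hu, hu'⟩
    refine ⟨fun ε => (hu ε).const_smul c, fun K hK hKO l => ?_⟩
    obtain ⟨p, hp⟩ := hu' K hK hKO l
    exact ⟨p, (hp.smul c).congr fun ε x hx => dirD_smul O.isOpen (hu ε) c l (hKO hx)⟩

/-- Negligible nets. -/
def negligible (O : Opens V) : Submodule ℂ (moderate O) where
  carrier := {u | ∀ K : Set V, IsCompact K → K ⊆ O → ∀ q : ℝ, BigOOn K u.1 q}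
  zero_mem' := fun K _ _ q => BigOOn.zero K q
  add_mem' := fun hu hv K hK hKO q => (hu K hK hKO q).add (hv K hK hKO q)
  smul_mem' := fun c _ hu K hK hKO q => (hu K hK hKO q).smul c

/-- The Colombeau space `𝒢(O)`. -/
abbrev G (O : Opens V) : Type _ := moderate O ⧸ negligible O

/-- The net `u` is a representative of the generalized function `U`. -/
def IsRep {O : Opens V} (u : Eps → V → ℂ) (U : G O) : Prop :=
  ∃ h : u ∈ moderate O, (negligible O).mkQ ⟨u, h⟩ = U

/-- The regular generalized functions `𝒢^∞(O)`: on every compact set one power of `ε` serves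
for the derivatives of all orders. -/
def Ginf (O : Opens V) : Set (G O) :=
  {U | ∃ u : Eps → V → ℂ, IsRep u U ∧
    ∀ K : Set V, IsCompact K → K ⊆ O → ∃ N : ℝ, ∀ l : List V,
      BigOOn K (fun ε => dirD l (u ε)) (-N)}

end Functions

/-! ### Slow scale symbols -/

/-- Strongly positive slow scale nets. -/
def slowScale : Set (Eps → ℝ) :=
  {w | (∃ c > 0, ∀ ε, c ≤ w ε) ∧
    ∀ p : ℝ, 0 ≤ p → ∃ c > 0, ∀ ε : Eps, w ε ^ p ≤ c * (ε : ℝ)⁻¹}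

theorem one_mem_slowScale : (fun _ => 1 : Eps → ℝ) ∈ slowScale :=
  ⟨⟨1, one_pos, fun _ => le_rfl⟩, fun p _ => ⟨1, one_pos, fun ε => by
    simpa using (one_le_inv₀ ε.2.1).2 ε.2.2⟩⟩

theorem max_mem_slowScale {w w' : Eps → ℝ} (h : w ∈ slowScale) (h' : w' ∈ slowScale) :
    (fun ε => max (w ε) (w' ε)) ∈ slowScale := by
  obtain ⟨⟨c, hc, h1⟩, h2⟩ := h
  obtain ⟨-, h2'⟩ := h'
  refine ⟨⟨c, hc, fun ε => (h1 ε).trans (le_max_left _ _)⟩, fun p hp => ?_⟩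
  obtain ⟨d, hd, h3⟩ := h2 p hp
  obtain ⟨d', hd', h3'⟩ := h2' p hp
  refine ⟨max d d', lt_max_of_lt_left hd, fun ε => ?_⟩
  have hε : 0 ≤ (ε : ℝ)⁻¹ := inv_nonneg.2 ε.2.1.le
  rcases max_choice (w ε) (w' ε) with h | h <;> simp only [h]
  · exact (h3 ε).trans (mul_le_mul_of_nonneg_right (le_max_left _ _) hε)
  · exact (h3' ε).trans (mul_le_mul_of_nonneg_right (le_max_right _ _) hε)

variable {n : ℕ}

/-- The Euclidean space `ℝⁿ`. -/
abbrev Rn (n : ℕ) : Type := EuclideanSpace ℝ (Fin n)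

/-- `⟨ξ⟩ = (1 + |ξ|²)^{1/2}`. -/
def jap (ξ : Rn n) : ℝ := Real.sqrt (1 + ‖ξ‖ ^ 2)

/-- The mixed derivative `∂_ξ^α ∂_x^β a`, with `α` and `β` given by lists of directions. -/
def symD (α β : List (Rn n)) (a : Rn n × Rn n → ℂ) : Rn n × Rn n → ℂ :=
  dirD (α.map (fun v => ((0 : Rn n), v)) ++ β.map (fun v => (v, (0 : Rn n)))) a

/-- `|a|^{(m)}_{K,α,β} ≤ C`, where
`|a|^{(m)}_{K,α,β} = sup_{x ∈ K, ξ ∈ ℝⁿ} ⟨ξ⟩^{-m+|α|} |∂_ξ^α ∂_x^β a(x,ξ)|`. -/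
def SeminormLE (m : ℝ) (K : Set (Rn n)) (α β : List (Rn n)) (a : Rn n × Rn n → ℂ) (C : ℝ) :
    Prop :=
  ∀ x ∈ K, ∀ ξ : Rn n, jap ξ ^ (-m + α.length) * ‖symD α β a (x, ξ)‖ ≤ C

/-- The product of two open sets. -/
def opensProd (Ω Ω' : Opens (Rn n)) : Opens (Rn n × Rn n) :=
  ⟨(Ω : Set (Rn n)) ×ˢ (Ω' : Set (Rn n)), Ω.isOpen.prod Ω'.isOpen⟩

/-- The open set `Ω × ℝⁿ`. -/
def phaseSpace (Ω : Opens (Rn n)) : Opens (Rn n × Rn n) := opensProd Ω ⊤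

theorem jap_rpow_nonneg (ξ : Rn n) (p : ℝ) : 0 ≤ jap ξ ^ p :=
  Real.rpow_nonneg (Real.sqrt_nonneg _) p

theorem SeminormLE.add {Ω : Opens (Rn n)} {m : ℝ} {K : Set (Rn n)} (hK : K ⊆ Ω)
    {α β : List (Rn n)} {a b : Rn n × Rn n → ℂ} {C D : ℝ}
    (hsa : ContDiffOn ℝ ∞ a (phaseSpace Ω)) (hsb : ContDiffOn ℝ ∞ b (phaseSpace Ω))
    (ha : SeminormLE m K α β a C) (hb : SeminormLE m K α β b D) :
    SeminormLE m K α β (a + b) (C + D) := by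
  intro x hx ξ
  have h := dirD_add (phaseSpace Ω).isOpen hsa hsb
    (α.map (fun v => ((0 : Rn n), v)) ++ β.map (fun v => (v, (0 : Rn n))))
    (show (x, ξ) ∈ (phaseSpace Ω : Set (Rn n × Rn n)) from Set.mk_mem_prod (hK hx) trivial)
  have h1 := ha x hx ξ
  have h2 := hb x hx ξ
  unfold symD at h1 h2 ⊢
  rw [h, Pi.add_apply]
  refine (mul_le_mul_of_nonneg_left (norm_add_le _ _) (jap_rpow_nonneg ξ _)).trans ?_
  linarith

theorem SeminormLE.smul {Ω : Opens (Rn n)} {m : ℝ} {K : Set (Rn n)} (hK : K ⊆ Ω)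
    {α β : List (Rn n)} {a : Rn n × Rn n → ℂ} {C : ℝ}
    (hsa : ContDiffOn ℝ ∞ a (phaseSpace Ω)) (c : ℂ) (ha : SeminormLE m K α β a C) :
    SeminormLE m K α β (c • a) (‖c‖ * C) := by
  intro x hx ξ
  have h := dirD_smul (phaseSpace Ω).isOpen hsa c
    (α.map (fun v => ((0 : Rn n), v)) ++ β.map (fun v => (v, (0 : Rn n))))
    (show (x, ξ) ∈ (phaseSpace Ω : Set (Rn n × Rn n)) from Set.mk_mem_prod (hK hx) trivial)
  have h1 := ha x hx ξ
  unfold symD at h1 ⊢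
  rw [h, Pi.smul_apply, norm_smul, mul_left_comm]
  exact mul_le_mul_of_nonneg_left h1 (norm_nonneg c)

theorem SeminormLE.zero {m : ℝ} {K : Set (Rn n)} {α β : List (Rn n)} {C : ℝ} (hC : 0 ≤ C) :
    SeminormLE m K α β 0 C := by
  intro x _ ξ
  simp [symD, dirD_zero, hC]

theorem SeminormLE.mono {m : ℝ} {K : Set (Rn n)} {α β : List (Rn n)} {a : Rn n × Rn n → ℂ}
    {C D : ℝ} (h : SeminormLE m K α β a C) (hCD : C ≤ D) : SeminormLE m K α β a D :=
  fun x hx ξ => (h x hx ξ).trans hCD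

/-- Slow scale nets of symbols of order `m` on `Ω × ℝⁿ`. -/
def slowScaleSymbols (Ω : Opens (Rn n)) (m : ℝ) : Submodule ℂ (Eps → Rn n × Rn n → ℂ) where
  carrier := {a | (∀ ε, ContDiffOn ℝ ∞ (a ε) (phaseSpace Ω)) ∧
    ∀ K : Set (Rn n), IsCompact K → K ⊆ Ω → ∃ w ∈ slowScale, ∀ α β : List (Rn n),
      ∃ c > 0, ∀ ε, SeminormLE m K α β (a ε) (c * w ε)}
  zero_mem' := ⟨fun _ => contDiffOn_const, fun K _ _ =>
    ⟨_, one_mem_slowScale, fun _ _ => ⟨1, one_pos, fun _ => SeminormLE.zero (by simp)⟩⟩⟩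
  add_mem' := by
    rintro a b ⟨ha, ha'⟩ ⟨hb, hb'⟩
    refine ⟨fun ε => (ha ε).add (hb ε), fun K hK hKΩ => ?_⟩
    obtain ⟨w, hw, h⟩ := ha' K hK hKΩ
    obtain ⟨w', hw', h'⟩ := hb' K hK hKΩ
    refine ⟨_, max_mem_slowScale hw hw', fun α β => ?_⟩
    obtain ⟨c, hc, h⟩ := h α β
    obtain ⟨c', hc', h'⟩ := h' α β
    refine ⟨c + c', add_pos hc hc', fun ε => ?_⟩
    refine ((h ε).add hKΩ (ha ε) (hb ε) (h' ε)).mono ?_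
    rw [add_mul]
    gcongr
    · exact le_max_left _ _
    · exact le_max_right _ _
  smul_mem' := by
    rintro z a ⟨ha, ha'⟩
    refine ⟨fun ε => (ha ε).const_smul z, fun K hK hKΩ => ?_⟩
    obtain ⟨w, hw, h⟩ := ha' K hK hKΩ
    refine ⟨w, hw, fun α β => ?_⟩
    obtain ⟨c, hc, h⟩ := h α β
    have hpos : ∀ ε, 0 ≤ w ε := by
      obtain ⟨⟨d, hd, h1⟩, -⟩ := hw
      exact fun ε => hd.le.trans (h1 ε)
    refine ⟨(‖z‖ + 1) * c, by positivity, fun ε => ((h ε).smul hKΩ (ha ε) z).mono ?_⟩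
    have := mul_nonneg hc.le (hpos ε)
    nlinarith

/-- Negligible nets of symbols of order `m`; each of them is a slow scale net (take `q = 0`). -/
def negligibleSymbols (Ω : Opens (Rn n)) (m : ℝ) : Submodule ℂ (slowScaleSymbols Ω m) where
  carrier := {a | ∀ K : Set (Rn n), IsCompact K → K ⊆ Ω → ∀ α β : List (Rn n), ∀ q : ℕ,
    ∃ c > 0, ∀ ε : Eps, SeminormLE m K α β (a.1 ε) (c * (ε : ℝ) ^ q)}
  zero_mem' := fun K _ _ α β q => ⟨1, one_pos, fun ε =>
    SeminormLE.zero (mul_nonneg zero_le_one (pow_nonneg ε.2.1.le q))⟩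
  add_mem' := by
    intro a b ha hb K hK hKΩ α β q
    obtain ⟨c, hc, h⟩ := ha K hK hKΩ α β q
    obtain ⟨c', hc', h'⟩ := hb K hK hKΩ α β q
    refine ⟨c + c', add_pos hc hc', fun ε => ?_⟩
    rw [add_mul]
    exact (h ε).add hKΩ (a.2.left ε) (b.2.left ε) (h' ε)
  smul_mem' := by
    intro z a ha K hK hKΩ α β q
    obtain ⟨c, hc, h⟩ := ha K hK hKΩ α β q
    refine ⟨(‖z‖ + 1) * c, by positivity, fun ε =>
      ((h ε).smul hKΩ (a.2.left ε) z).mono ?_⟩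
    have := mul_nonneg hc.le (pow_nonneg ε.2.1.le q)
    nlinarith

/-- Slow scale generalized symbols of order `m`. -/
abbrev Symbol (Ω : Opens (Rn n)) (m : ℝ) : Type := slowScaleSymbols Ω m ⧸ negligibleSymbols Ω m

/-- The net `a` is a representative of the generalized symbol `A`. -/
def IsSymRep {Ω : Opens (Rn n)} {m : ℝ} (a : Eps → Rn n × Rn n → ℂ) (A : Symbol Ω m) : Prop :=
  ∃ h : a ∈ slowScaleSymbols Ω m, (negligibleSymbols Ω m).mkQ ⟨a, h⟩ = A

/-! ### Micro-ellipticity -/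

/-- The cotangent bundle of `Ω` with the zero section removed. -/
def cotangent (Ω : Opens (Rn n)) : Set (Rn n × Rn n) := {p | p.1 ∈ Ω ∧ p.2 ≠ 0}

/-- `Γ` is a conic (open) neighborhood of `ξ₀` in `ℝⁿ ∖ {0}`. -/
def IsConicNhd (Γ : Set (Rn n)) (ξ₀ : Rn n) : Prop :=
  IsOpen Γ ∧ ξ₀ ∈ Γ ∧ (0 : Rn n) ∉ Γ ∧ ∀ t : ℝ, 0 < t → ∀ ξ ∈ Γ, t • ξ ∈ Γ

/-- The set `Ell_sc(A)` of points at which `A` is slow scale micro-elliptic. -/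
def Ell {Ω : Opens (Rn n)} {m : ℝ} (A : Symbol Ω m) : Set (Rn n × Rn n) :=
  {p | p ∈ cotangent Ω ∧ ∃ a, IsSymRep a A ∧ ∃ U Γ : Set (Rn n),
    IsOpen U ∧ p.1 ∈ U ∧ IsCompact (closure U) ∧ closure U ⊆ Ω ∧ IsConicNhd Γ p.2 ∧
    ∃ r ∈ slowScale, ∃ s ∈ slowScale, ∀ x ∈ U, ∀ ξ ∈ Γ, ∀ ε, r ε ≤ ‖ξ‖ →
      (1 / s ε) * jap ξ ^ m ≤ ‖a ε (x, ξ)‖}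

/-! ### Pseudodifferential operators -/

/-- The Fourier transform `f^(ξ) = ∫ e^{-iyξ} f(y) dy`. -/
def fourierHat (f : Rn n → ℂ) (ξ : Rn n) : ℂ :=
  ∫ y, Complex.exp (-(Complex.I * (inner ℝ y ξ : ℝ))) * f y

/-- `(a(x,D)f)(x) = (2π)^{-n} ∫ e^{ixξ} a(x,ξ) f^(ξ) dξ`, for a symbol `a` and a test
function `f`. -/
def pseudo (a : Rn n × Rn n → ℂ) (f : Rn n → ℂ) (x : Rn n) : ℂ :=
  ((2 * Real.pi : ℝ) : ℂ)⁻¹ ^ n *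
    ∫ ξ, Complex.exp (Complex.I * (inner ℝ x ξ : ℝ)) * a (x, ξ) * fourierHat f ξ

/-- The kernel of `a(x,D)` on a net `v` of functions of two variables:
`k(v) = ∫_Ω a(x,D)(v(x,·)) dx`. -/
def kernel (Ω : Opens (Rn n)) (a v : Eps → Rn n × Rn n → ℂ) (ε : Eps) : ℂ :=
  ∫ x in (Ω : Set (Rn n)), pseudo (a ε) (fun y => v ε (x, y)) x

/-- The net `v` represents an element of `𝒢_c(W)`: it is moderate on `W`, and all the `v_ε` vanish
outside one compact subset of `W`. -/
def CompactNet {V : Type*} [NormedAddCommGroup V] [NormedSpace ℝ V] (W : Opens V)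
    (v : Eps → V → ℂ) : Prop :=
  v ∈ moderate W ∧ ∃ K : Set V, IsCompact K ∧ K ⊆ W ∧ ∀ ε, ∀ x, x ∉ K → v ε x = 0

/-- The support in `Ω × Ω` of the kernel of `A(x,D)`, a functional on `𝒢_c(Ω × Ω)`: a point is
outside the support if and only if it has an open neighborhood `W` such that the kernel vanishes
on `𝒢_c(W)`. -/
def kernelSupport {Ω : Opens (Rn n)} {m : ℝ} (A : Symbol Ω m) : Set (Rn n × Rn n) :=
  {p | p ∈ opensProd Ω Ω ∧ ∀ W : Opens (Rn n × Rn n), p ∈ W → W ≤ opensProd Ω Ω →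
    ∃ a v, IsSymRep a A ∧ CompactNet W v ∧ ¬ NegligibleNumber (kernel Ω a v)}

/-- `C` (a relatively closed subset of `Ω × Ω`) is proper: both projections from `C` to `Ω` are
proper maps. -/
def IsProperSubset (Ω : Opens (Rn n)) (C : Set (Rn n × Rn n)) : Prop :=
  C ⊆ opensProd Ω Ω ∧ ∀ K : Set (Rn n), IsCompact K → K ⊆ Ω →
    IsCompact (C ∩ Prod.fst ⁻¹' K) ∧ IsCompact (C ∩ Prod.snd ⁻¹' K)

/-- The operator `A(x,D)` is properly supported. -/
def ProperlySupported {Ω : Opens (Rn n)} {m : ℝ} (A : Symbol Ω m) : Prop :=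
  IsProperSubset Ω (kernelSupport A)

/-- `χ ∈ C^∞(Ω × Ω)` (extended by `0`) has proper support and is `1` in a neighborhood of `C`. -/
def IsProperCutoff (Ω : Opens (Rn n)) (C : Set (Rn n × Rn n)) (χ : Rn n × Rn n → ℂ) : Prop :=
  ContDiffOn ℝ ∞ χ (opensProd Ω Ω : Opens (Rn n × Rn n)) ∧ (∀ p, p ∉ opensProd Ω Ω → χ p = 0) ∧
    IsProperSubset Ω (closure (Function.support χ) ∩ (opensProd Ω Ω : Opens (Rn n × Rn n))) ∧ ∀ᶠ p in 𝓝ˢ C, χ p = 1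

/-- `W = A(x,D)U` for a properly supported operator `A(x,D)` and `U ∈ 𝒢(Ω)`, where `A(x,D)` stands
for its unique extension from `𝒢_c(Ω)` to `𝒢(Ω)`. With a proper cut-off `χ` that is `1` near
the support of the kernel, the extension is given on representatives by
`x ↦ (a_ε(x,D)(χ(x,·) u_ε))(x)`; the resulting class depends neither on `χ` nor on the
representatives. -/
def IsOpValue {Ω : Opens (Rn n)} {m : ℝ} (A : Symbol Ω m) (U W : G Ω) : Prop :=
  ∃ a u w χ, IsSymRep a A ∧ IsRep u U ∧ IsRep w W ∧ IsProperCutoff Ω (kernelSupport A) χ ∧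
    ∀ ε, ∀ x ∈ Ω, w ε x = pseudo (a ε) (fun y => χ (x, y) * u ε y) x

/-! ### The two wave front sets -/

/-- `W_sc(U)`: the intersection of the complements of `Ell_sc(A)`, over all properly supported
operators `A(x,D)` with slow scale symbol of order `0` such that `A(x,D)U` is in `𝒢^∞(Ω)`. -/
def Wsc {Ω : Opens (Rn n)} (U : G Ω) : Set (Rn n × Rn n) :=
  ⋂ A ∈ {A : Symbol Ω 0 | ProperlySupported A ∧ ∃ W ∈ Ginf Ω, IsOpValue A U W},
    cotangent Ω \ Ell A

/-- `U` is `𝒢^∞`-microlocally regular at `(x₀, ξ₀)`. -/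
def MicrolocallyRegular {Ω : Opens (Rn n)} (U : G Ω) (x₀ ξ₀ : Rn n) : Prop :=
  ∃ u, IsRep u U ∧ ∃ φ : Rn n → ℂ, ContDiff ℝ ∞ φ ∧ HasCompactSupport φ ∧ tsupport φ ⊆ Ω ∧
    φ x₀ = 1 ∧ ∃ Γ, IsConicNhd Γ ξ₀ ∧ ∃ N : ℝ, ∀ l : ℝ,
      BigOOn Γ (fun ε ξ => ((jap ξ ^ l : ℝ) : ℂ) * fourierHat (fun y => φ y * u ε y) ξ) (-N)

/-- The generalized wave front set `WF_g(U)`. -/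
def WFg {Ω : Opens (Rn n)} (U : G Ω) : Set (Rn n × Rn n) :=
  {p | p ∈ cotangent Ω ∧ ¬ MicrolocallyRegular U p.1 p.2}

end

end Colombeau

namespace Colombeau

noncomputable section

/-! ### Calculus of iterated directional derivatives -/

section DirD

variable {V V' : Type*} [NormedAddCommGroup V] [NormedSpace ℝ V]
  [NormedAddCommGroup V'] [NormedSpace ℝ V']

/-! Both inclusions compare u with a pseudodifferential operator that is elliptic at the given point
(x₀, ξ₀).

Ellipticity implies regularity. Let w = a(x,D)u lie in 𝒢^∞ with a elliptic at (x₀, ξ₀). Operators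
are not composed and no asymptotic sum is formed; the Fourier transform of φu is computed by
duality, one frequency at a time. Let T_ξ c be the transpose of a(x,D) applied to c e^{-ixξ},
multiplied by e^{iyξ} (`transOp`). The Fourier transform of wb at ξ equals ∫ e^{-iyξ} u T_ξ b dy, so
it suffices to find b, depending on ε and ξ, with T_ξ b close to φ. Taylor's formula for the symbol
in ξ gives T_ξ b = ab + lower order terms + O(⟨ξ⟩^{-m-1}) (`GlobalSymbols.transOp_sub_expand_le`),
and repeated division by a yields T_ξ b = φ + O(⟨ξ⟩^{-m-1}) (`GlobalSymbols.exists_parametrix`). For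
each weight ⟨ξ⟩^l a parametrix of finite order is enough.

The exponent of ε must not depend on l. All constants are powers W_ε^p of one slow scale net, and
W_ε^p ≤ c_p ε⁻¹ for every p, so a loss costs one factor ε⁻¹ whatever p is. The same bound disposes
of the frequencies |ξ| < W_ε, where ⟨ξ⟩^l is itself O(ε⁻¹).

Two points need care. The extension of a(x,D) to 𝒢(Ω) inserts a cut-off χ that is known to be 1 only
near the support of the kernel. `EllipticAt.mem_kernelSupport` shows that (x₀, x₀) lies in this
support, and elsewhere χ does little harm because the expansion is local
(`GlobalSymbols.transOp_cutoff_le`). Moreover the value net differs from the regular representative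
by a negligible net; this difference is treated by interpolation
(`eventually_fourierHat_le_of_negligible`).

Regularity implies ellipticity of a suitable operator. If u is regular at (x₀, ξ₀) with cut-off φ
and cone Γ, take φ ψ(D) φ with ψ of order 0, supported in Γ and equal to 1 at large frequencies near
the direction ξ₀. Its symbol is φ(x)²ψ(ξ) + O(⟨ξ⟩⁻¹), hence elliptic at (x₀, ξ₀)
(`exists_norm_coneSymbol_sub_le`), its kernel lives on supp φ × supp φ, and it maps u to φ times the
inverse Fourier transform of ψ times that of φu, which is in 𝒢^∞ since ψ vanishes off Γ
(`exists_coneOperator`). -/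

theorem dirD_append (l l' : List V) (f : V → ℂ) : dirD (l ++ l') f = dirD l (dirD l' f) := by
  induction l with
  | nil => rfl
  | cons v l ih => simp only [List.cons_append, dirD, ih]

theorem dirD_congr {O : Set V} (hO : IsOpen O) {f g : V → ℂ} (h : EqOn f g O) :
    ∀ l : List V, EqOn (dirD l f) (dirD l g) O
  | [] => h
  | v :: l => fun x hx => by
    have := ((dirD_congr hO h l).eventuallyEq_of_mem (hO.mem_nhds hx)).fderiv_eq (𝕜 := ℝ)
    simp only [dirD, this]

theorem contDiff_dirD {f : V → ℂ} (hf : ContDiff ℝ ∞ f) (l : List V) : ContDiff ℝ ∞ (dirD l f) := by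
  rw [← contDiffOn_univ] at hf ⊢
  exact contDiffOn_dirD isOpen_univ hf l

theorem dirD_differentiableAt {O : Set V} (hO : IsOpen O) {f : V → ℂ} (hf : ContDiffOn ℝ ∞ f O)
    (l : List V) {x : V} (hx : x ∈ O) : DifferentiableAt ℝ (dirD l f) x :=
  ((contDiffOn_dirD hO hf l).differentiableOn (by simp)).differentiableAt (hO.mem_nhds hx)

theorem dirD_eq_zero_of_notMem {f : V → ℂ} {K : Set V} (hK : IsClosed K)
    (hf : ∀ x, x ∉ K → f x = 0) (l : List V) {x : V} (hx : x ∉ K) : dirD l f x = 0 := by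
  have := dirD_congr (f := f) (g := 0) hK.isOpen_compl (fun x hx => hf x hx) l hx
  rw [this, dirD_zero]
  rfl

theorem dirD_swap {f : V → ℂ} (hf : ContDiff ℝ ∞ f) (v w : V) :
    dirD [v, w] f = dirD [w, v] f := by
  funext x
  have h : IsSymmSndFDerivAt ℝ f x := hf.contDiffAt.isSymmSndFDerivAt (by
    rw [minSmoothness_of_isRCLikeNormedField]; exact WithTop.coe_le_coe.2 (le_top : (2 : ℕ∞) ≤ ⊤))
  have hd : DifferentiableAt ℝ (fderiv ℝ f) x :=
    ((hf.fderiv_right (m := ∞) (by simp)).differentiable (by simp)) x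
  have key : ∀ a b : V, dirD [a, b] f x = fderiv ℝ (fderiv ℝ f) x a b := by
    intro a b
    simp only [dirD]
    rw [fderiv_clm_apply hd (by fun_prop)]
    simp
  rw [key, key]
  exact h.eq v w

/-- Symmetry of second derivatives, propagated along a permutation. It allows ξ- and x-derivatives
of symbols to be interchanged. -/
theorem dirD_perm {l l' : List V} (hl : l.Perm l') {f : V → ℂ} (hf : ContDiff ℝ ∞ f) :
    dirD l f = dirD l' f := by
  induction hl with
  | nil => rfl
  | cons v _ ih => simp only [dirD, ih]
  | swap v w l =>
    have := dirD_swap (contDiff_dirD hf l) w v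
    rw [← dirD_append, ← dirD_append] at this
    simpa using this
  | trans _ _ h1 h2 => exact h1.trans h2

theorem dirD_comp_affine {g : V' → ℂ} (hg : ContDiff ℝ ∞ g) (L : V →L[ℝ] V') (c : V') (l : List V) :
    dirD l (fun x => g (c + L x)) = fun x => dirD (l.map L) g (c + L x) := by
  induction l with
  | nil => rfl
  | cons v l ih =>
    funext x
    simp only [dirD, ih, List.map_cons]
    have h1 : HasFDerivAt (fun x => c + L x) L x := L.hasFDerivAt.const_add c
    have h2 := (((contDiff_dirD hg (l.map L)).differentiable (by simp)) (c + L x)).hasFDerivAt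
    have h3 := (h2.comp x h1).fderiv
    simp only [Function.comp_def] at h3
    rw [h3]
    rfl

theorem dirD_sum {ι : Type*} (s : Finset ι) {O : Set V} (hO : IsOpen O) {f : ι → V → ℂ}
    (hf : ∀ i ∈ s, ContDiffOn ℝ ∞ (f i) O) (l : List V) :
    EqOn (dirD l (fun x => ∑ i ∈ s, f i x)) (fun x => ∑ i ∈ s, dirD l (f i) x) O := by
  classical
  induction s using Finset.induction_on with
  | empty =>
    intro x hx
    simp only [Finset.sum_empty]
    exact congrFun (dirD_zero l) x
  | insert i s hi ih =>
    intro x hx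
    have h1 : ContDiffOn ℝ ∞ (f i) O := hf i (by simp)
    have h2 : ∀ j ∈ s, ContDiffOn ℝ ∞ (f j) O := fun j hj => hf j (by simp [hj])
    have h3 := dirD_add hO h1 (ContDiffOn.sum h2) l hx
    simp only [Pi.add_apply] at h3
    simp only [Finset.sum_insert hi]
    have h4 := ih h2 hx
    simp only at h4
    rw [← h4]
    exact h3

theorem dirD_const_mul {O : Set V} (hO : IsOpen O) {f : V → ℂ} (hf : ContDiffOn ℝ ∞ f O) (c : ℂ)
    (l : List V) : EqOn (dirD l (fun x => c * f x)) (fun x => c * dirD l f x) O :=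
  dirD_smul hO hf c l

/-- All the ways to distribute a list of derivatives over two factors. -/
def splits {X : Type*} : List X → List (List X × List X)
  | [] => [([], [])]
  | v :: l => (splits l).map (fun p => (v :: p.1, p.2)) ++ (splits l).map (fun p => (p.1, v :: p.2))

theorem length_of_mem_splits {X : Type*} : ∀ {l : List X} {p : List X × List X}, p ∈ splits l →
    p.1.length + p.2.length = l.length
  | [], p, h => by
    simp only [splits, List.mem_singleton] at h
    simp [h]
  | v :: l, p, h => by
    simp only [splits, List.mem_append, List.mem_map] at h
    rcases h with ⟨q, hq, rfl⟩ | ⟨q, hq, rfl⟩ <;>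
    · have := length_of_mem_splits hq
      simp only [List.length_cons]
      omega

theorem fderiv_list_sum_mul {L : List (List V × List V)} {f g : V → ℂ} {x : V}
    (hf : ∀ l, DifferentiableAt ℝ (dirD l f) x) (hg : ∀ l, DifferentiableAt ℝ (dirD l g) x) (v : V) :
    DifferentiableAt ℝ (fun x => (L.map fun p => dirD p.1 f x * dirD p.2 g x).sum) x ∧
    fderiv ℝ (fun x => (L.map fun p => dirD p.1 f x * dirD p.2 g x).sum) x v =
      (L.map fun p => dirD (v :: p.1) f x * dirD p.2 g x).sum +
      (L.map fun p => dirD p.1 f x * dirD (v :: p.2) g x).sum := by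
  induction L with
  | nil => simp
  | cons p L ih =>
    simp only [List.map_cons, List.sum_cons]
    have h1 := (hf p.1).hasFDerivAt.mul (hg p.2).hasFDerivAt
    have h2 := h1.add ih.1.hasFDerivAt
    refine ⟨h2.differentiableAt, ?_⟩
    have h3 := h2.fderiv
    simp only [Pi.add_def, Pi.mul_def] at h3
    rw [h3]
    simp only [add_apply, ih.2, dirD, smul_apply, smul_eq_mul]
    ring

/-- The Leibniz rule. -/
theorem dirD_mul {O : Set V} (hO : IsOpen O) {f g : V → ℂ} (hf : ContDiffOn ℝ ∞ f O)
    (hg : ContDiffOn ℝ ∞ g O) : ∀ l : List V, EqOn (dirD l (fun x => f x * g x))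
      (fun x => ((splits l).map fun p => dirD p.1 f x * dirD p.2 g x).sum) O
  | [] => fun x _ => by simp [splits, dirD]
  | v :: l => fun x hx => by
    have ih := ((dirD_mul hO hf hg l).eventuallyEq_of_mem (hO.mem_nhds hx)).fderiv_eq (𝕜 := ℝ)
    have := (fderiv_list_sum_mul (L := splits l) (fun l => dirD_differentiableAt hO hf l hx)
      (fun l => dirD_differentiableAt hO hg l hx) v).2
    simp only [dirD, ih, splits, List.map_append, List.sum_append, List.map_map, Function.comp_def] at this ⊢
    exact this

/-- The link to Mathlib's multilinear derivative: multilinearity then gives the multinomial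
expansion of a repeated derivative. -/
theorem dirD_ofFn {f : V → ℂ} (hf : ContDiff ℝ ∞ f) : ∀ (k : ℕ) (v : Fin k → V) (x : V),
    dirD (List.ofFn v) f x = iteratedFDeriv ℝ k f x v
  | 0, v, x => by simp [dirD]
  | k + 1, v, x => by
    have hd : DifferentiableAt ℝ (iteratedFDeriv ℝ k f) x :=
      (hf.differentiable_iteratedFDeriv (by exact_mod_cast WithTop.coe_lt_top (k : ℕ))) x
    rw [List.ofFn_succ, iteratedFDeriv_succ_apply_left, ← fderiv_continuousMultilinear_apply_const_apply hd]
    have : dirD (List.ofFn fun i : Fin k => v i.succ) f =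
        fun y => iteratedFDeriv ℝ k f y (Fin.tail v) := by
      funext y
      exact dirD_ofFn hf k _ y
    simp only [dirD, this]

/-- Expansion of a repeated derivative in one direction in partial derivatives. -/
theorem dirD_replicate_sum {ι : Type*} [Fintype ι] {f : V → ℂ} (hf : ContDiff ℝ ∞ f) (k : ℕ)
    (e : ι → V) (c : ι → ℝ) (x : V) :
    dirD (List.replicate k (∑ i, c i • e i)) f x =
      ∑ s : Fin k → ι, ((∏ j, c (s j) : ℝ) : ℂ) * dirD (List.ofFn fun j => e (s j)) f x := by
  classical
  have h1 : List.replicate k (∑ i, c i • e i) = List.ofFn (fun _ : Fin k => ∑ i, c i • e i) := by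
    simp
  rw [h1, dirD_ofFn hf]
  have h2 := (iteratedFDeriv ℝ k f x).toMultilinearMap.map_sum (fun (_ : Fin k) i => c i • e i)
  simp only [ContinuousMultilinearMap.coe_coe] at h2
  rw [h2]
  refine Finset.sum_congr rfl fun s _ => ?_
  have h3 := (iteratedFDeriv ℝ k f x).toMultilinearMap.map_smul_univ (fun j => c (s j)) (fun j => e (s j))
  simp only [ContinuousMultilinearMap.coe_coe] at h3
  rw [h3, dirD_ofFn hf, Complex.real_smul]

theorem dirD_fst_snd_mul {f : V → ℂ} {g : V' → ℂ} (hf : ContDiff ℝ ∞ f) (hg : ContDiff ℝ ∞ g)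
    (α : List V') (β : List V) :
    dirD (α.map (fun v => ((0 : V), v)) ++ β.map (fun v => (v, (0 : V'))))
      (fun p : V × V' => f p.1 * g p.2) = fun p => dirD β f p.1 * dirD α g p.2 := by
  induction α with
  | nil =>
    simp only [List.map_nil, List.nil_append]
    induction β with
    | nil => rfl
    | cons v β ih =>
      funext p
      simp only [List.map_cons, dirD, ih]
      have h1 : HasFDerivAt (fun p : V × V' => dirD β f p.1) _ p :=
        (((contDiff_dirD hf β).differentiable (by simp)) p.1).hasFDerivAt.comp p
          (hasFDerivAt_fst (𝕜 := ℝ) (E := V) (F := V'))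
      have h2 : HasFDerivAt (fun p : V × V' => g p.2) _ p :=
        ((hg.differentiable (by simp)) p.2).hasFDerivAt.comp p
          (hasFDerivAt_snd (𝕜 := ℝ) (E := V) (F := V'))
      have h3 := (h1.mul h2).fderiv
      simp only [Pi.mul_def] at h3
      rw [h3]
      simp [mul_comm]
  | cons v α ih =>
    funext p
    simp only [List.map_cons, List.cons_append, dirD, ih]
    have h1 : HasFDerivAt (fun p : V × V' => dirD β f p.1) _ p :=
      (((contDiff_dirD hf β).differentiable (by simp)) p.1).hasFDerivAt.comp p
        (hasFDerivAt_fst (𝕜 := ℝ) (E := V) (F := V'))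
    have h2 : HasFDerivAt (fun p : V × V' => dirD α g p.2) _ p :=
      (((contDiff_dirD hg α).differentiable (by simp)) p.2).hasFDerivAt.comp p
        (hasFDerivAt_snd (𝕜 := ℝ) (E := V) (F := V'))
    have h3 := (h1.mul h2).fderiv
    simp only [Pi.mul_def] at h3
    rw [h3]
    simp

/-- Extension by zero. Products of functions smooth on Ω with cut-offs become smooth on the whole
space in this way. -/
theorem contDiff_of_contDiffOn_of_compact {f : V → ℂ} {O K : Set V} (hO : IsOpen O) (hK : IsClosed K)
    (hKO : K ⊆ O) (hf : ContDiffOn ℝ ∞ f O) (h0 : ∀ x, x ∉ K → f x = 0) : ContDiff ℝ ∞ f := by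
  rw [contDiff_iff_contDiffAt]
  intro x
  by_cases hx : x ∈ O
  · exact hf.contDiffAt (hO.mem_nhds hx)
  · have h1 : f =ᶠ[𝓝 x] fun _ => 0 := by
      filter_upwards [hK.isOpen_compl.mem_nhds (fun h => hx (hKO h))] with y hy using h0 y hy
    exact contDiffAt_const.congr_of_eventuallyEq h1

end DirD

/-! ### Graded classes of families of smooth functions -/

/-- A scale of weights for a family of functions on `V` with parameters in `Λ`. -/
structure Scale (Λ V : Type*) where
  W : Λ → ℝ
  J : Λ → V → ℝ
  δ : ℝ
  one_le_W : ∀ i, 1 ≤ W i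
  one_le_J : ∀ i x, 1 ≤ J i x

/-- The functions `f i` are smooth on `O`, and on `S` their derivatives up to the order `N` are
dominated by powers of the weight `W` times `J ^ (m - δ |α|)`. -/
def Cls {Λ V : Type*} [NormedAddCommGroup V] [NormedSpace ℝ V] (𝒮 : Scale Λ V) (O S : Set V)
    (N : ℕ) (m : ℝ) (f : Λ → V → ℂ) : Prop :=
  (∀ i, ContDiffOn ℝ ∞ (f i) O) ∧ ∀ l : List V, l.length ≤ N → ∃ C : ℝ, ∃ p : ℕ, 0 ≤ C ∧
    ∀ i, ∀ x ∈ S, ‖dirD l (f i) x‖ ≤ C * 𝒮.W i ^ p * 𝒮.J i x ^ (m - 𝒮.δ * l.length)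

namespace Cls

variable {Λ V : Type*} [NormedAddCommGroup V] [NormedSpace ℝ V] {𝒮 : Scale Λ V} {O S : Set V}
  {N : ℕ} {m m' : ℝ} {f g : Λ → V → ℂ}

theorem mono_order (h : Cls 𝒮 O S N m f) {N' : ℕ} (hN : N' ≤ N) : Cls 𝒮 O S N' m f :=
  ⟨h.1, fun l hl => h.2 l (hl.trans hN)⟩

theorem mono (h : Cls 𝒮 O S N m f) (hm : m ≤ m') : Cls 𝒮 O S N m' f := by
  refine ⟨h.1, fun l hl => ?_⟩
  obtain ⟨C, p, hC, H⟩ := h.2 l hl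
  refine ⟨C, p, hC, fun i x hx => (H i x hx).trans ?_⟩
  have := 𝒮.one_le_W i
  gcongr
  exact 𝒮.one_le_J i x

theorem congr (hO : IsOpen O) (hS : S ⊆ O) (h : Cls 𝒮 O S N m f) (hfg : ∀ i, EqOn (g i) (f i) O) :
    Cls 𝒮 O S N m g := by
  refine ⟨fun i => (h.1 i).congr (hfg i), fun l hl => ?_⟩
  obtain ⟨C, p, hC, H⟩ := h.2 l hl
  refine ⟨C, p, hC, fun i x hx => ?_⟩
  rw [dirD_congr hO (hfg i) l (hS hx)]
  exact H i x hx

theorem restrict {O' S' : Set V} (h : Cls 𝒮 O S N m f) (hO : O' ⊆ O) (hS : S' ⊆ S) :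
    Cls 𝒮 O' S' N m f :=
  ⟨fun i => (h.1 i).mono hO, fun l hl => by
    obtain ⟨C, p, hC, H⟩ := h.2 l hl
    exact ⟨C, p, hC, fun i x hx => H i x (hS hx)⟩⟩

/-- The exponents are added rather than maximised: only polynomial dependence on the weight matters
later. -/
theorem pow_le_aux {w : ℝ} (hw : 1 ≤ w) {C D j : ℝ} (hC : 0 ≤ C) (hD : 0 ≤ D) (hj : 0 ≤ j) (p q : ℕ) :
    C * w ^ p * j + D * w ^ q * j ≤ (C + D) * w ^ (p + q) * j := by
  have h1 : w ^ p ≤ w ^ (p + q) := pow_le_pow_right₀ hw (by omega)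
  have h2 : w ^ q ≤ w ^ (p + q) := pow_le_pow_right₀ hw (by omega)
  have h3 := mul_le_mul_of_nonneg_left h1 (mul_nonneg hC hj)
  have h4 := mul_le_mul_of_nonneg_left h2 (mul_nonneg hD hj)
  nlinarith

theorem add (hO : IsOpen O) (hS : S ⊆ O) (hf : Cls 𝒮 O S N m f) (hg : Cls 𝒮 O S N m g) :
    Cls 𝒮 O S N m (fun i x => f i x + g i x) := by
  refine ⟨fun i => (hf.1 i).add (hg.1 i), fun l hl => ?_⟩
  obtain ⟨C, p, hC, H⟩ := hf.2 l hl
  obtain ⟨D, q, hD, H'⟩ := hg.2 l hl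
  refine ⟨C + D, p + q, add_nonneg hC hD, fun i x hx => ?_⟩
  have h1 : dirD l (fun x => f i x + g i x) x = dirD l (f i) x + dirD l (g i) x :=
    dirD_add hO (hf.1 i) (hg.1 i) l (hS hx)
  have hj : 0 ≤ 𝒮.J i x ^ (m - 𝒮.δ * l.length) :=
    Real.rpow_nonneg (zero_le_one.trans (𝒮.one_le_J i x)) _
  rw [h1]
  exact (norm_add_le _ _).trans ((add_le_add (H i x hx) (H' i x hx)).trans
    (pow_le_aux (𝒮.one_le_W i) hC hD hj p q))

theorem zero : Cls 𝒮 O S N m (fun _ _ => 0) :=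
  ⟨fun _ => contDiffOn_const, fun l _ => ⟨0, 0, le_rfl, fun i x _ => by
    have : dirD l (fun _ : V => (0 : ℂ)) x = 0 := congrFun (dirD_zero l) x
    simp [this]⟩⟩

theorem sum (hO : IsOpen O) (hS : S ⊆ O) {ι : Type*} (s : Finset ι) {F : ι → Λ → V → ℂ}
    (hF : ∀ j ∈ s, Cls 𝒮 O S N m (F j)) : Cls 𝒮 O S N m (fun i x => ∑ j ∈ s, F j i x) := by
  classical
  induction s using Finset.induction_on with
  | empty => simpa using zero
  | insert j s hj ih =>
    simp only [Finset.sum_insert hj]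
    exact add hO hS (hF j (by simp)) (ih fun j hj => hF j (by simp [hj]))

theorem mul (hO : IsOpen O) (hS : S ⊆ O) (hf : Cls 𝒮 O S N m f) (hg : Cls 𝒮 O S N m' g) :
    Cls 𝒮 O S N (m + m') (fun i x => f i x * g i x) := by
  refine ⟨fun i => (hf.1 i).mul (hg.1 i), fun l hl => ?_⟩
  -- Arbitrary lists of splittings are allowed, since a tail of `splits l` is not of the form
  -- `splits l'`.
  have key : ∀ L : List (List V × List V), (∀ p ∈ L, p.1.length + p.2.length = l.length) →
      ∃ C : ℝ, ∃ p : ℕ, 0 ≤ C ∧ ∀ i, ∀ x ∈ S,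
        ‖(L.map fun p => dirD p.1 (f i) x * dirD p.2 (g i) x).sum‖ ≤
          C * 𝒮.W i ^ p * 𝒮.J i x ^ (m + m' - 𝒮.δ * l.length) := by
    intro L hL
    induction L with
    | nil => exact ⟨0, 0, le_rfl, fun i x _ => by simp⟩
    | cons a L ih =>
      obtain ⟨C, p, hC, H⟩ := ih fun p hp => hL p (by simp [hp])
      have ha := hL a (by simp)
      obtain ⟨D, q, hD, H1⟩ := hf.2 a.1 (by omega)
      obtain ⟨D', q', hD', H2⟩ := hg.2 a.2 (by omega)
      refine ⟨D * D' + C, (q + q') + p, by positivity, fun i x hx => ?_⟩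
      have hJ : 0 < 𝒮.J i x := zero_lt_one.trans_le (𝒮.one_le_J i x)
      have hW := 𝒮.one_le_W i
      simp only [List.map_cons, List.sum_cons]
      refine (norm_add_le _ _).trans (le_trans (add_le_add ?_ (H i x hx))
        (pow_le_aux (𝒮.one_le_W i) (mul_nonneg hD hD') hC (Real.rpow_nonneg hJ.le _) (q + q') p))
      rw [norm_mul]
      refine (mul_le_mul (H1 i x hx) (H2 i x hx) (norm_nonneg _) (by positivity)).trans (le_of_eq ?_)
      have h5 : m + m' - 𝒮.δ * l.length =
          (m - 𝒮.δ * a.1.length) + (m' - 𝒮.δ * a.2.length) := by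
        rw [← ha]; push_cast; ring
      rw [h5, Real.rpow_add hJ, pow_add]
      ring
  obtain ⟨C, p, hC, H⟩ := key (splits l) fun p hp => length_of_mem_splits hp
  refine ⟨C, p, hC, fun i x hx => ?_⟩
  rw [dirD_mul hO (hf.1 i) (hg.1 i) l (hS hx)]
  exact H i x hx

theorem const_mul (hO : IsOpen O) (hS : S ⊆ O) (hf : Cls 𝒮 O S N m f) (c : ℂ) :
    Cls 𝒮 O S N m (fun i x => c * f i x) := by
  refine ⟨fun i => contDiffOn_const.mul (hf.1 i), fun l hl => ?_⟩
  obtain ⟨C, p, hC, H⟩ := hf.2 l hl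
  refine ⟨‖c‖ * C, p, by positivity, fun i x hx => ?_⟩
  rw [dirD_const_mul hO (hf.1 i) c l (hS hx), norm_mul, mul_assoc, mul_assoc]
  have := H i x hx
  gcongr
  linarith

theorem dirD (hO : IsOpen O) (hf : ∀ N, Cls 𝒮 O S N m f) (l : List V) (N : ℕ) :
    Cls 𝒮 O S N (m - 𝒮.δ * l.length) (fun i => Colombeau.dirD l (f i)) := by
  refine ⟨fun i => contDiffOn_dirD hO ((hf 0).1 i) l, fun l' _ => ?_⟩
  obtain ⟨C, p, hC, H⟩ := (hf (l' ++ l).length).2 (l' ++ l) le_rfl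
  refine ⟨C, p, hC, fun i x hx => ?_⟩
  rw [← dirD_append]
  refine (H i x hx).trans (le_of_eq ?_)
  congr 2
  rw [List.length_append]
  push_cast
  ring

/-- The last entry of the list is the derivative applied first. Peeling it off reduces all orders to
a formula for the first derivative, which may involve the function itself, as for 1/f, ⟨ξ⟩⁻¹ or g ∘
`dir`. -/
theorem succ (h : Cls 𝒮 O S 0 m f)
    (hd : ∀ v : V, Cls 𝒮 O S N (m - 𝒮.δ) (fun i => Colombeau.dirD [v] (f i))) :
    Cls 𝒮 O S (N + 1) m f := by
  refine ⟨h.1, fun l hl => ?_⟩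
  rcases List.eq_nil_or_concat l with rfl | ⟨l', v, rfl⟩
  · exact h.2 [] le_rfl
  · simp only [List.concat_eq_append, List.length_append, List.length_singleton] at hl ⊢
    obtain ⟨C, p, hC, H⟩ := (hd v).2 l' (by omega)
    refine ⟨C, p, hC, fun i x hx => ?_⟩
    rw [dirD_append]
    refine (H i x hx).trans (le_of_eq ?_)
    congr 2
    push_cast
    ring

theorem comp_param {Λ' : Type*} {𝒮' : Scale Λ' V} (φ : Λ' → Λ) (hW : ∀ i, 𝒮'.W i = 𝒮.W (φ i))
    (hJ : ∀ i x, 𝒮'.J i x = 𝒮.J (φ i) x) (hδ : 𝒮'.δ = 𝒮.δ) (h : Cls 𝒮 O S N m f) :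
    Cls 𝒮' O S N m (fun i => f (φ i)) := by
  refine ⟨fun i => h.1 _, fun l hl => ?_⟩
  obtain ⟨C, p, hC, H⟩ := h.2 l hl
  refine ⟨C, p, hC, fun i x hx => ?_⟩
  rw [hW, hJ, hδ]
  exact H _ x hx

/-- The reciprocal of a family that is bounded below by a power of the weight. -/
theorem inv (hO : IsOpen O) (hS : S ⊆ O) (hδ : 𝒮.δ = 0) (hf : ∀ N, Cls 𝒮 O S N 0 f)
    (h0 : ∀ i, ∀ x ∈ O, f i x ≠ 0) {c : ℝ} {q : ℕ} (hc : 0 ≤ c)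
    (hlow : ∀ i, ∀ x ∈ S, ‖f i x‖⁻¹ ≤ c * 𝒮.W i ^ q) (N : ℕ) :
    Cls 𝒮 O S N 0 (fun i x => (f i x)⁻¹) := by
  have hsm : ∀ i, ContDiffOn ℝ ∞ (fun x => (f i x)⁻¹) O := fun i => ((hf 0).1 i).inv (h0 i)
  have hb : Cls 𝒮 O S 0 0 (fun i x => (f i x)⁻¹) := by
    refine ⟨hsm, fun l hl => ⟨c, q, hc, fun i x hx => ?_⟩⟩
    obtain rfl : l = [] := List.length_eq_zero_iff.1 (by omega)
    simpa [Colombeau.dirD, hδ] using hlow i x hx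
  induction N with
  | zero => exact hb
  | succ N ih =>
    refine succ hb fun v => ?_
    -- ∂_v(1/f) = -(∂_v f)(1/f)², and the induction hypothesis controls both factors 1/f up to order
    -- N.
    have h1 := ((dirD hO hf [v] N).mul hO hS (ih.mul hO hS ih)).const_mul hO hS (-1)
    have h2 : (0 : ℝ) - 𝒮.δ * ([v] : List V).length + (0 + 0) = 0 - 𝒮.δ := by simp [hδ]
    rw [h2] at h1
    refine h1.congr hO hS fun i x hx => ?_
    have h3 := ((dirD_differentiableAt hO ((hf 0).1 i) [] hx).hasFDerivAt)
    have h4 := (hasDerivAt_inv (h0 i x hx)).hasFDerivAt.restrictScalars ℝ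
    have h5 := (h4.comp x h3).fderiv
    simp only [Function.comp_def, Colombeau.dirD] at h5
    simp only [Colombeau.dirD, h5]
    simp
    field_simp
    simp

end Cls

theorem Cls.of_bounds {Λ V : Type*} [NormedAddCommGroup V] [NormedSpace ℝ V] {𝒮 : Scale Λ V}
    {O S : Set V} {m : ℝ} {f : Λ → V → ℂ} (h1 : ∀ i, ContDiffOn ℝ ∞ (f i) O)
    (h : ∀ l : List V, ∃ C : ℝ, ∃ p : ℕ, ∀ i, ∀ x ∈ S,
      ‖Colombeau.dirD l (f i) x‖ ≤ C * 𝒮.W i ^ p * 𝒮.J i x ^ (m - 𝒮.δ * l.length)) (N : ℕ) :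
    Cls 𝒮 O S N m f := by
  refine ⟨h1, fun l _ => ?_⟩
  obtain ⟨C, p, H⟩ := h l
  refine ⟨|C|, p, abs_nonneg _, fun i x hx => (H i x hx).trans ?_⟩
  have := 𝒮.one_le_W i
  have := 𝒮.one_le_J i x
  gcongr
  exact le_abs_self C

/-- A single compactly supported smooth function lies in every class with `δ = 0`. -/
theorem Cls.of_hasCompactSupport {Λ V : Type*} [NormedAddCommGroup V] [NormedSpace ℝ V]
    {𝒮 : Scale Λ V} (hδ : 𝒮.δ = 0) {φ : V → ℂ} (hφ : ContDiff ℝ ∞ φ) {K : Set V} (hK : IsCompact K)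
    (h0 : ∀ x, x ∉ K → φ x = 0) (N : ℕ) : Cls 𝒮 univ univ N 0 (fun _ => φ) := by
  refine Cls.of_bounds (fun _ => hφ.contDiffOn) (fun l => ?_) N
  obtain ⟨C, hC⟩ := hK.exists_bound_of_continuousOn (f := Colombeau.dirD l φ)
    (contDiff_dirD hφ l).continuous.continuousOn
  refine ⟨|C|, 0, fun i x _ => ?_⟩
  simp only [pow_zero, hδ, zero_mul, sub_zero, Real.rpow_zero, mul_one]
  by_cases hx : x ∈ K
  · exact (hC x hx).trans (le_abs_self C)
  · rw [dirD_eq_zero_of_notMem hK.isClosed h0 l hx]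
    simp

/-! ### The Japanese bracket -/

section Jap

variable {n : ℕ}

theorem jap_sq (ξ : Rn n) : jap ξ ^ 2 = 1 + ‖ξ‖ ^ 2 := Real.sq_sqrt (by positivity)

theorem one_le_jap (ξ : Rn n) : 1 ≤ jap ξ := Real.one_le_sqrt.2 (by nlinarith [sq_nonneg ‖ξ‖])

theorem jap_pos (ξ : Rn n) : 0 < jap ξ := zero_lt_one.trans_le (one_le_jap ξ)

theorem norm_le_jap (ξ : Rn n) : ‖ξ‖ ≤ jap ξ := Real.le_sqrt_of_sq_le (by linarith)

theorem jap_le_one_add_norm (ξ : Rn n) : jap ξ ≤ 1 + ‖ξ‖ :=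
  Real.sqrt_le_iff.2 ⟨by positivity, by nlinarith [norm_nonneg ξ]⟩

theorem jap_neg (ξ : Rn n) : jap (-ξ) = jap ξ := by simp [jap]

theorem contDiff_jap : ContDiff ℝ ∞ (jap : Rn n → ℝ) :=
  (contDiff_const.add (contDiff_norm_sq ℝ)).sqrt fun ξ => by positivity

/-- Peetre's inequality. -/
theorem jap_add_le (ξ η : Rn n) : jap (ξ + η) ≤ 2 * jap ξ * jap η := by
  have h1 : 0 ≤ 2 * jap ξ * jap η := by have := jap_pos ξ; have := jap_pos η; positivity
  refine abs_le_of_sq_le_sq' ?_ h1 |>.2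
  rw [mul_pow, mul_pow, jap_sq, jap_sq, jap_sq]
  have h2 := norm_add_le ξ η
  have h3 : ‖ξ + η‖ ^ 2 ≤ (‖ξ‖ + ‖η‖) ^ 2 := by gcongr
  nlinarith [sq_nonneg (‖ξ‖ - ‖η‖), mul_nonneg (sq_nonneg ‖ξ‖) (sq_nonneg ‖η‖)]

theorem jap_smul_le {t : ℝ} (ht : |t| ≤ 1) (ξ : Rn n) : jap (t • ξ) ≤ jap ξ := by
  refine Real.sqrt_le_sqrt ?_
  rw [norm_smul, Real.norm_eq_abs]
  have : |t| * ‖ξ‖ ≤ 1 * ‖ξ‖ := by gcongr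
  rw [one_mul] at this
  gcongr

/-- Peetre's inequality for negative powers. -/
theorem inv_jap_add_le (ξ η : Rn n) : (jap (ξ + η))⁻¹ ≤ 2 * (jap ξ)⁻¹ * jap η := by
  have h := jap_add_le (ξ + η) (-η)
  rw [add_neg_cancel_right, jap_neg] at h
  have h1 := jap_pos ξ
  have h2 := jap_pos (ξ + η)
  rw [inv_le_iff_one_le_mul₀ h2]
  calc 1 = jap ξ * (jap ξ)⁻¹ := (mul_inv_cancel₀ h1.ne').symm
    _ ≤ (2 * jap (ξ + η) * jap η) * (jap ξ)⁻¹ := by gcongr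
    _ = _ := by ring

theorem integrable_inv_jap_pow : Integrable (fun ξ : Rn n => (jap ξ ^ (n + 1))⁻¹) := by
  have h := integrable_rpow_neg_one_add_norm_sq (E := Rn n) (μ := volume) (r := n + 1) (by simp)
  refine h.congr (Filter.Eventually.of_forall fun ξ => ?_)
  have h1 : (0 : ℝ) ≤ 1 + ‖ξ‖ ^ 2 := by positivity
  simp only [jap]
  rw [Real.sqrt_eq_rpow, ← Real.rpow_natCast _ (n + 1), ← Real.rpow_mul h1, ← Real.rpow_neg h1]
  congr 1
  push_cast
  ring

/-- The coordinate vectors. -/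
abbrev unitVec (i : Fin n) : Rn n := EuclideanSpace.single i 1

theorem inner_unitVec (i : Fin n) (ξ : Rn n) : inner ℝ (unitVec i) ξ = ξ i := by
  simp [unitVec, EuclideanSpace.inner_single_left]

theorem sum_coord_smul_unitVec (ξ : Rn n) : ∑ i, ξ i • unitVec i = ξ := by
  have := (EuclideanSpace.basisFun (Fin n) ℝ).sum_repr ξ
  simpa using this

theorem abs_coord_le_jap (ξ : Rn n) (i : Fin n) : |ξ i| ≤ jap ξ :=
  (PiLp.norm_apply_le ξ i).trans (norm_le_jap ξ)

/-- The largest coordinate controls ⟨ξ⟩ up to a factor depending on n, unless all coordinates are at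
most 1. Hence decay of a Fourier transform follows from the pure derivatives ∂_i^L alone. -/
theorem jap_pow_le (ξ : Rn n) (L : ℕ) : jap ξ ^ L ≤ (n + 1 : ℝ) ^ L * (1 + ∑ i, |ξ i| ^ L) := by
  have h0 : 0 ≤ ∑ i, |ξ i| ^ L := Finset.sum_nonneg fun i _ => by positivity
  have key : ∀ M : ℝ, 1 ≤ M → (∀ i, |ξ i| ≤ M) → jap ξ ≤ (n + 1) * M := by
    intro M hM h
    refine Real.sqrt_le_iff.2 ⟨by positivity, ?_⟩
    rw [EuclideanSpace.real_norm_sq_eq]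
    have h1 : ∑ i, ξ i ^ 2 ≤ ∑ _i : Fin n, M ^ 2 :=
      Finset.sum_le_sum fun i _ => sq_le_sq' (neg_le_of_abs_le (h i)) (le_of_abs_le (h i))
    simp only [Finset.sum_const, Finset.card_univ, Fintype.card_fin, nsmul_eq_mul] at h1
    nlinarith [sq_nonneg ((n : ℝ) * M), mul_nonneg (Nat.cast_nonneg (α := ℝ) n) (sq_nonneg M)]
  by_cases h : ∀ i, |ξ i| ≤ 1
  · calc jap ξ ^ L ≤ ((n + 1) * 1) ^ L := pow_le_pow_left₀ (jap_pos ξ).le (key 1 le_rfl h) L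
      _ = (n + 1 : ℝ) ^ L * 1 := by simp
      _ ≤ _ := by gcongr; linarith
  · push Not at h
    obtain ⟨j, hj⟩ := h
    have : Nonempty (Fin n) := ⟨j⟩
    obtain ⟨i, hi⟩ := Finite.exists_max (fun i => |ξ i|)
    calc jap ξ ^ L ≤ ((n + 1) * |ξ i|) ^ L :=
          pow_le_pow_left₀ (jap_pos ξ).le (key _ (hj.le.trans (hi j)) hi) L
      _ = (n + 1 : ℝ) ^ L * |ξ i| ^ L := by rw [mul_pow]
      _ ≤ _ := by
        gcongr
        have := Finset.single_le_sum (f := fun i => |ξ i| ^ L) (fun i _ => by positivity)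
          (Finset.mem_univ i)
        simp only at this
        linarith

end Jap

/-! ### The Fourier transform -/

section Fourier

variable {n : ℕ}

/-- The plane wave `e^{ixξ}`. -/
def wave (x ξ : Rn n) : ℂ := Complex.exp (Complex.I * (inner ℝ x ξ : ℝ))

theorem norm_wave (x ξ : Rn n) : ‖wave x ξ‖ = 1 := by
  rw [wave, mul_comm, Complex.norm_exp_ofReal_mul_I]

theorem wave_add_left (x y ξ : Rn n) : wave (x + y) ξ = wave x ξ * wave y ξ := by
  rw [wave, wave, wave, ← Complex.exp_add, inner_add_left]
  push_cast; ring_nf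

theorem wave_add_right (x ξ η : Rn n) : wave x (ξ + η) = wave x ξ * wave x η := by
  rw [wave, wave, wave, ← Complex.exp_add, inner_add_right]
  push_cast; ring_nf

theorem wave_neg_right (x ξ : Rn n) : wave x (-ξ) = wave (-x) ξ := by
  rw [wave, wave, inner_neg_right, inner_neg_left]

theorem wave_neg_mul_wave (x ξ : Rn n) : wave (-x) ξ * wave x ξ = 1 := by
  rw [← wave_add_left]; simp [wave]

theorem contDiff_wave : ContDiff ℝ ∞ (fun p : Rn n × Rn n => wave p.1 p.2) := by
  unfold wave
  have : ContDiff ℝ ∞ (fun p : Rn n × Rn n => ((inner ℝ p.1 p.2 : ℝ) : ℂ)) :=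
    Complex.ofRealCLM.contDiff.comp (contDiff_fst.inner ℝ contDiff_snd)
  exact (contDiff_const.mul this).cexp

theorem continuous_wave : Continuous (fun p : Rn n × Rn n => wave p.1 p.2) :=
  contDiff_wave.continuous

@[fun_prop]
theorem continuous_wave_comp {X : Type*} [TopologicalSpace X] {f g : X → Rn n} (hf : Continuous f)
    (hg : Continuous g) : Continuous fun x => wave (f x) (g x) :=
  continuous_wave.comp (hf.prodMk hg)

@[fun_prop]
theorem contDiff_wave_comp {X : Type*} [NormedAddCommGroup X] [NormedSpace ℝ X] {f g : X → Rn n}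
    (hf : ContDiff ℝ ∞ f) (hg : ContDiff ℝ ∞ g) : ContDiff ℝ ∞ fun x => wave (f x) (g x) :=
  contDiff_wave.comp (hf.prodMk hg)

theorem fourierHat_eq (f : Rn n → ℂ) (ξ : Rn n) : fourierHat f ξ = ∫ y, wave (-y) ξ * f y := by
  unfold fourierHat wave
  congr 1
  ext y
  rw [inner_neg_left]
  push_cast; ring_nf

theorem pseudo_eq (a : Rn n × Rn n → ℂ) (f : Rn n → ℂ) (x : Rn n) :
    pseudo a f x = ((2 * Real.pi : ℝ) : ℂ)⁻¹ ^ n * ∫ ξ, wave x ξ * a (x, ξ) * fourierHat f ξ := rfl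

theorem integral_eq_setIntegral {K : Set (Rn n)} {f : Rn n → ℂ} (h0 : ∀ x, x ∉ K → f x = 0) :
    ∫ x, f x = ∫ x in K, f x := (setIntegral_eq_integral_of_forall_compl_eq_zero h0).symm

theorem continuous_integral_of_compact {X : Type*} [TopologicalSpace X] [FirstCountableTopology X]
    [LocallyCompactSpace X] {f : X → Rn n → ℂ} (hf : Continuous f.uncurry) {K : Set (Rn n)}
    (hK : IsCompact K) (h0 : ∀ p, ∀ x, x ∉ K → f p x = 0) : Continuous fun p => ∫ x, f p x := by
  have := continuous_parametric_integral_of_continuous (μ := volume) hf hK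
  refine this.congr fun p => ?_
  exact (integral_eq_setIntegral (h0 p)).symm

theorem integrable_of_compact {f : Rn n → ℂ} (hf : Continuous f) {K : Set (Rn n)}
    (hK : IsCompact K) (h0 : ∀ x, x ∉ K → f x = 0) : Integrable f :=
  hf.integrable_of_hasCompactSupport (HasCompactSupport.intro hK h0)

theorem norm_integral_le_of_compact {f : Rn n → ℂ} {K : Set (Rn n)} (hK : IsCompact K)
    (h0 : ∀ x, x ∉ K → f x = 0) {D : ℝ} (hD : ∀ x ∈ K, ‖f x‖ ≤ D) :
    ‖∫ x, f x‖ ≤ D * volume.real K := by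
  rw [integral_eq_setIntegral h0]
  exact norm_setIntegral_le_of_norm_le_const hK.measure_lt_top hD

theorem continuous_fourierHat {f : Rn n → ℂ} (hf : Continuous f) {K : Set (Rn n)}
    (hK : IsCompact K) (h0 : ∀ x, x ∉ K → f x = 0) : Continuous (fourierHat f) := by
  have h : Continuous fun ξ => ∫ y, wave (-y) ξ * f y := by
    refine continuous_integral_of_compact ?_ hK fun ξ x hx => by simp [h0 x hx]
    simp only [Function.uncurry_def]
    fun_prop
  exact h.congr fun ξ => (fourierHat_eq f ξ).symm

theorem norm_fourierHat_le {f : Rn n → ℂ} {K : Set (Rn n)} (hK : IsCompact K)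
    (h0 : ∀ x, x ∉ K → f x = 0) {D : ℝ} (hD : ∀ x ∈ K, ‖f x‖ ≤ D) (ξ : Rn n) :
    ‖fourierHat f ξ‖ ≤ D * volume.real K := by
  rw [fourierHat_eq]
  refine norm_integral_le_of_compact hK (fun x hx => by simp [h0 x hx]) fun x hx => ?_
  rw [norm_mul, norm_wave, one_mul]
  exact hD x hx

theorem hasFDerivAt_wave_left (ξ x : Rn n) :
    HasFDerivAt (fun x => wave x ξ) ((wave x ξ * Complex.I) •
      (Complex.ofRealCLM.comp (innerSL ℝ ξ))) x := by
  have h1 : HasFDerivAt (fun x : Rn n => ((inner ℝ x ξ : ℝ) : ℂ)) (Complex.ofRealCLM.comp (innerSL ℝ ξ)) x := by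
    have := (Complex.ofRealCLM.comp (innerSL ℝ ξ)).hasFDerivAt (x := x)
    refine this.congr_of_eventuallyEq (Filter.Eventually.of_forall fun y => ?_)
    simp [real_inner_comm]
  have h2 := (h1.const_mul Complex.I).cexp
  simpa [wave, smul_smul] using h2

theorem dirD_wave_left (ξ : Rn n) (l : List (Rn n)) :
    dirD l (fun x => wave x ξ) =
      fun x => (l.map fun v => Complex.I * (inner ℝ v ξ : ℝ)).prod * wave x ξ := by
  induction l with
  | nil => simp [dirD]
  | cons v l ih =>
    funext x
    simp only [dirD, ih, List.map_cons, List.prod_cons]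
    have h := ((hasFDerivAt_wave_left ξ x).const_mul
      (l.map fun v => Complex.I * (inner ℝ v ξ : ℝ)).prod).fderiv
    rw [h]
    simp [real_inner_comm]
    ring

/-- Integration by parts against e^{-ixξ}; compact support supplies the integrability. -/
theorem fourierHat_dirD_single {f : Rn n → ℂ} (hf : ContDiff ℝ ∞ f) {K : Set (Rn n)}
    (hK : IsCompact K) (h0 : ∀ x, x ∉ K → f x = 0) (v ξ : Rn n) :
    fourierHat (dirD [v] f) ξ = Complex.I * (inner ℝ v ξ : ℝ) * fourierHat f ξ := by
  have hw : ContDiff ℝ ∞ (fun x : Rn n => wave x (-ξ)) := contDiff_wave_comp contDiff_id contDiff_const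
  have hd0 : ∀ x, x ∉ K → fderiv ℝ f x v = 0 := fun x hx =>
    dirD_eq_zero_of_notMem hK.isClosed h0 [v] hx
  have hcd : Continuous (fun x => fderiv ℝ f x v) := (contDiff_dirD hf [v]).continuous
  have hcw : Continuous (fun x => fderiv ℝ (fun x : Rn n => wave x (-ξ)) x v) :=
    (contDiff_dirD hw [v]).continuous
  have h := integral_mul_fderiv_eq_neg_fderiv_mul_of_integrable (μ := volume) (𝕜 := ℂ)
    (f := fun x : Rn n => wave x (-ξ)) (g := f) (v := v)
    (integrable_of_compact (hcw.mul hf.continuous) hK (fun x hx => by simp [h0 x hx]))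
    (integrable_of_compact (hw.continuous.mul hcd) hK (fun x hx => by simp [hd0 x hx]))
    (integrable_of_compact (hw.continuous.mul hf.continuous) hK (fun x hx => by simp [h0 x hx]))
    (fun x _ => (hw.differentiable (by simp)) x)
    (fun x _ => (hf.differentiable (by simp)) x)
  rw [fourierHat_eq, fourierHat_eq]
  simp only [dirD]
  simp only [← wave_neg_right]
  rw [h, ← integral_neg, ← integral_const_mul]
  congr 1
  funext x
  rw [(hasFDerivAt_wave_left (-ξ) x).fderiv]
  simp [real_inner_comm]
  ring

theorem fourierHat_dirD {f : Rn n → ℂ} (hf : ContDiff ℝ ∞ f) {K : Set (Rn n)}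
    (hK : IsCompact K) (h0 : ∀ x, x ∉ K → f x = 0) (l : List (Rn n)) (ξ : Rn n) :
    fourierHat (dirD l f) ξ =
      (l.map fun v => Complex.I * (inner ℝ v ξ : ℝ)).prod * fourierHat f ξ := by
  induction l with
  | nil => simp [dirD]
  | cons v l ih =>
    have := fourierHat_dirD_single (contDiff_dirD hf l) hK
      (fun x hx => dirD_eq_zero_of_notMem hK.isClosed h0 l hx) v ξ
    rw [List.map_cons, List.prod_cons, mul_assoc, ← ih, ← this]
    rfl

/-- Decay of the Fourier transform of a test function. -/
theorem jap_pow_mul_fourierHat_le {f : Rn n → ℂ} (hf : ContDiff ℝ ∞ f) {K : Set (Rn n)}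
    (hK : IsCompact K) (h0 : ∀ x, x ∉ K → f x = 0) (L : ℕ) {D : ℝ} (hD : ∀ x, ‖f x‖ ≤ D)
    (hD' : ∀ i x, ‖dirD (List.replicate L (unitVec i)) f x‖ ≤ D) (ξ : Rn n) :
    jap ξ ^ L * ‖fourierHat f ξ‖ ≤ ((n + 1 : ℝ) ^ L * (n + 1) * volume.real K) * D := by
  have h1 : ‖fourierHat f ξ‖ ≤ D * volume.real K := norm_fourierHat_le hK h0 (fun x _ => hD x) ξ
  have h2 : ∀ i, |ξ i| ^ L * ‖fourierHat f ξ‖ ≤ D * volume.real K := by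
    intro i
    have h3 := norm_fourierHat_le hK
      (fun x hx => dirD_eq_zero_of_notMem hK.isClosed h0 (List.replicate L (unitVec i)) hx)
      (fun x _ => hD' i x) ξ
    rw [fourierHat_dirD hf hK h0, norm_mul] at h3
    simpa [inner_unitVec] using h3
  calc jap ξ ^ L * ‖fourierHat f ξ‖
      ≤ ((n + 1 : ℝ) ^ L * (1 + ∑ i, |ξ i| ^ L)) * ‖fourierHat f ξ‖ := by
        gcongr; exact jap_pow_le ξ L
    _ = (n + 1 : ℝ) ^ L * (‖fourierHat f ξ‖ + ∑ i, |ξ i| ^ L * ‖fourierHat f ξ‖) := by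
        rw [mul_assoc, add_mul, one_mul, Finset.sum_mul]
    _ ≤ (n + 1 : ℝ) ^ L * (D * volume.real K + ∑ _i : Fin n, D * volume.real K) := by
        exact mul_le_mul_of_nonneg_left (add_le_add h1 (Finset.sum_le_sum fun i _ => h2 i))
          (by positivity)
    _ = _ := by
        simp only [Finset.sum_const, Finset.card_univ, Fintype.card_fin, nsmul_eq_mul]
        ring

theorem exists_fourierHat_le {f : Rn n → ℂ} (hf : ContDiff ℝ ∞ f) {K : Set (Rn n)}
    (hK : IsCompact K) (h0 : ∀ x, x ∉ K → f x = 0) (L : ℕ) :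
    ∃ C : ℝ, 0 ≤ C ∧ ∀ ξ, ‖fourierHat f ξ‖ ≤ C * (jap ξ ^ L)⁻¹ := by
  have hb : ∀ l : List (Rn n), ∃ C : ℝ, 0 ≤ C ∧ ∀ x, ‖dirD l f x‖ ≤ C := by
    intro l
    obtain ⟨C, hC⟩ := hK.exists_bound_of_continuousOn (contDiff_dirD hf l).continuous.continuousOn
    refine ⟨|C|, abs_nonneg _, fun x => ?_⟩
    by_cases hx : x ∈ K
    · exact (hC x hx).trans (le_abs_self C)
    · rw [dirD_eq_zero_of_notMem hK.isClosed h0 l hx]; simp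
  choose C hC0 hC using hb
  have hs : ∀ i, C (List.replicate L (unitVec i)) ≤ ∑ j, C (List.replicate L (unitVec (n := n) j)) :=
    fun i => Finset.single_le_sum (f := fun j => C (List.replicate L (unitVec (n := n) j)))
      (fun j _ => hC0 _) (Finset.mem_univ i)
  have hs0 : 0 ≤ ∑ j, C (List.replicate L (unitVec (n := n) j)) := Finset.sum_nonneg fun j _ => hC0 _
  have := jap_pow_mul_fourierHat_le hf hK h0 L (D := C [] + ∑ j, C (List.replicate L (unitVec j)))
    (fun x => (hC [] x).trans (by linarith))
    (fun i x => (hC _ x).trans (by have := hs i; have := hC0 []; linarith))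
  have hC1 := hC0 []
  refine ⟨((n + 1 : ℝ) ^ L * (n + 1) * volume.real K) *
    (C [] + ∑ j, C (List.replicate L (unitVec j))), by positivity, fun ξ => ?_⟩
  rw [← div_eq_mul_inv, le_div_iff₀ (pow_pos (jap_pos ξ) L), mul_comm]
  exact this ξ

theorem integrable_of_le_inv_jap {f : Rn n → ℂ} (hf : Continuous f) {C : ℝ}
    (h : ∀ ξ, ‖f ξ‖ ≤ C * (jap ξ ^ (n + 1))⁻¹) : Integrable f :=
  (integrable_inv_jap_pow.const_mul C).mono' hf.aestronglyMeasurable (Filter.Eventually.of_forall h)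

theorem integrable_fourierHat {f : Rn n → ℂ} (hf : ContDiff ℝ ∞ f) {K : Set (Rn n)}
    (hK : IsCompact K) (h0 : ∀ x, x ∉ K → f x = 0) : Integrable (fourierHat f) := by
  obtain ⟨C, -, hC⟩ := exists_fourierHat_le hf hK h0 (n + 1)
  exact integrable_of_le_inv_jap (continuous_fourierHat hf.continuous hK h0) hC

/-- The phase of `FourierTransform.fourier` contains the factor 2π; the dilation transfers the
inversion theorem to the normalisation used here. -/
theorem fourier_eq_fourierHat (f : Rn n → ℂ) (w : Rn n) :
    FourierTransform.fourier f w = fourierHat f ((2 * Real.pi) • w) := by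
  rw [Real.fourier_eq', fourierHat]
  congr 1
  funext v
  rw [smul_eq_mul, inner_smul_right]
  congr 2
  push_cast; ring

/-- Fourier inversion. -/
theorem fourier_inversion {f : Rn n → ℂ} (hf : ContDiff ℝ ∞ f) {K : Set (Rn n)}
    (hK : IsCompact K) (h0 : ∀ x, x ∉ K → f x = 0) (y : Rn n) :
    ((2 * Real.pi : ℝ) : ℂ)⁻¹ ^ n * ∫ ζ, wave y ζ * fourierHat f ζ = f y := by
  have hpi : (2 * Real.pi : ℝ) ≠ 0 := by positivity
  have h1 : FourierTransform.fourier f = fun w => fourierHat f ((2 * Real.pi) • w) :=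
    funext (fourier_eq_fourierHat f)
  have h2 : Integrable (FourierTransform.fourier f) := by
    rw [h1]
    exact (integrable_fourierHat hf hK h0).comp_smul hpi
  have h3 := congrFun (hf.continuous.fourierInv_fourier_eq
    (integrable_of_compact hf.continuous hK h0) h2) y
  rw [Real.fourierInv_eq', h1] at h3
  rw [← h3]
  have h4 := Measure.integral_comp_smul volume (fun ζ => wave y ζ * fourierHat f ζ) (2 * Real.pi)
  rw [abs_of_pos (by positivity), finrank_euclideanSpace_fin] at h4
  have h5 : ∀ v : Rn n, Complex.exp ((2 * Real.pi * inner ℝ v y : ℝ) * Complex.I) •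
      fourierHat f ((2 * Real.pi) • v) = wave y ((2 * Real.pi) • v) * fourierHat f ((2 * Real.pi) • v) := by
    intro v
    rw [wave, smul_eq_mul, inner_smul_right, real_inner_comm, mul_comm Complex.I]
  simp only [h5, h4]
  rw [Complex.real_smul]
  push_cast
  rw [inv_pow]

theorem fourierHat_sub {f g : Rn n → ℂ} (hf : Integrable f) (hg : Integrable g) (ξ : Rn n) :
    fourierHat (fun x => f x - g x) ξ = fourierHat f ξ - fourierHat g ξ := by
  have key : ∀ {f : Rn n → ℂ}, Integrable f → Integrable fun y => wave (-y) ξ * f y := by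
    intro f hf
    refine hf.norm.mono' ((by fun_prop : Continuous fun y : Rn n => wave (-y) ξ).aestronglyMeasurable.mul
      hf.aestronglyMeasurable) (Filter.Eventually.of_forall fun y => ?_)
    rw [norm_mul, norm_wave, one_mul]
  rw [fourierHat_eq, fourierHat_eq, fourierHat_eq, ← integral_sub (key hf) (key hg)]
  simp only [mul_sub]

theorem fourierHat_add {f g : Rn n → ℂ} (hf : Integrable f) (hg : Integrable g) (ξ : Rn n) :
    fourierHat (fun x => f x + g x) ξ = fourierHat f ξ + fourierHat g ξ := by
  have := fourierHat_sub (hf.add hg) hg ξ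
  simp only [Pi.add_apply, add_sub_cancel_right] at this
  rw [this]
  simp [Pi.add_def]

theorem fourierHat_const_mul (c : ℂ) (f : Rn n → ℂ) (ξ : Rn n) :
    fourierHat (fun x => c * f x) ξ = c * fourierHat f ξ := by
  rw [fourierHat_eq, fourierHat_eq, ← integral_const_mul]
  congr 1
  funext y
  ring

/-- The Fourier transform of a product is a convolution. -/
theorem fourierHat_mul {φ f : Rn n → ℂ} (hφ : ContDiff ℝ ∞ φ) {K : Set (Rn n)}
    (hK : IsCompact K) (h0 : ∀ x, x ∉ K → φ x = 0) (hf : Integrable f) (ξ : Rn n) :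
    fourierHat (fun y => φ y * f y) ξ =
      ((2 * Real.pi : ℝ) : ℂ)⁻¹ ^ n * ∫ η, fourierHat φ (ξ - η) * fourierHat f η := by
  have hi := integrable_fourierHat hφ hK h0
  -- After φ is written as a superposition of waves by Fourier inversion, Fubini applies because f
  -- and the transform of φ are integrable.
  have hint : Integrable (Function.uncurry fun (y η : Rn n) =>
      (wave y (-ξ) * f y) * (wave y η * fourierHat φ η)) (volume.prod volume) := by
    have h1 : Integrable (fun p : Rn n × Rn n => f p.1 * fourierHat φ p.2) (volume.prod volume) :=
      hf.mul_prod hi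
    have hc : Continuous fun p : Rn n × Rn n => wave p.1 (-ξ) * wave p.1 p.2 := by fun_prop
    refine (h1.norm.mono' (hc.aestronglyMeasurable.mul h1.aestronglyMeasurable)
      (Filter.Eventually.of_forall fun p => ?_)).congr (Filter.Eventually.of_forall fun p => ?_)
    · simp [norm_wave]
    · simp only [Pi.mul_apply, Function.uncurry_def]
      ring
  have h1 : ∫ η, fourierHat φ (ξ - η) * fourierHat f η = ∫ η, fourierHat φ η * fourierHat f (ξ - η) := by
    rw [← integral_sub_left_eq_self _ volume ξ]
    simp
  calc fourierHat (fun y => φ y * f y) ξ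
      = ∫ y, ((2 * Real.pi : ℝ) : ℂ)⁻¹ ^ n * ∫ η, (wave y (-ξ) * f y) * (wave y η * fourierHat φ η) := by
        rw [fourierHat_eq]
        congr 1
        funext y
        rw [integral_const_mul, ← fourier_inversion hφ hK h0 y, wave_neg_right]
        ring
    _ = ((2 * Real.pi : ℝ) : ℂ)⁻¹ ^ n * ∫ η, ∫ y, (wave y (-ξ) * f y) * (wave y η * fourierHat φ η) := by
        rw [integral_const_mul, integral_integral_swap hint]
    _ = _ := by
        rw [h1]
        congr 2
        funext η
        rw [fourierHat_eq f, ← integral_const_mul]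
        congr 1
        funext y
        rw [← wave_neg_right, show -(ξ - η) = -ξ + η by abel, wave_add_right]
        ring

end Fourier

/-! ### Families with uniform bounds on the whole space -/

/-- A scale whose weights only depend on the parameter. -/
def paramScale {Λ : Type*} (V : Type*) (W j : Λ → ℝ) (hW : ∀ i, 1 ≤ W i) (hj : ∀ i, 1 ≤ j i) :
    Scale Λ V :=
  ⟨W, fun i _ => j i, 0, hW, fun i _ => hj i⟩

/-- `Cls` on the whole space and for all orders of differentiation. -/
def UCls {Λ V : Type*} [NormedAddCommGroup V] [NormedSpace ℝ V] (𝒮 : Scale Λ V) (m : ℝ)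
    (f : Λ → V → ℂ) : Prop :=
  ∀ N, Cls 𝒮 univ univ N m f

namespace UCls

variable {Λ V : Type*} [NormedAddCommGroup V] [NormedSpace ℝ V] {𝒮 : Scale Λ V}
  {m m' : ℝ} {f g : Λ → V → ℂ}

theorem mul (hf : UCls 𝒮 m f) (hg : UCls 𝒮 m' g) : UCls 𝒮 (m + m') (fun i x => f i x * g i x) :=
  fun N => (hf N).mul isOpen_univ subset_rfl (hg N)

theorem add (hf : UCls 𝒮 m f) (hg : UCls 𝒮 m g) : UCls 𝒮 m (fun i x => f i x + g i x) :=
  fun N => (hf N).add isOpen_univ subset_rfl (hg N)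

theorem const_mul (hf : UCls 𝒮 m f) (c : ℂ) : UCls 𝒮 m (fun i x => c * f i x) :=
  fun N => (hf N).const_mul isOpen_univ subset_rfl c

theorem sub (hf : UCls 𝒮 m f) (hg : UCls 𝒮 m g) : UCls 𝒮 m (fun i x => f i x - g i x) := by
  simpa [sub_eq_add_neg] using hf.add (hg.const_mul (-1))

theorem sum {ι : Type*} (s : Finset ι) {F : ι → Λ → V → ℂ} (hF : ∀ j ∈ s, UCls 𝒮 m (F j)) :
    UCls 𝒮 m (fun i x => ∑ j ∈ s, F j i x) :=
  fun N => Cls.sum isOpen_univ subset_rfl s fun j hj => hF j hj N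

theorem mono (hf : UCls 𝒮 m f) (h : m ≤ m') : UCls 𝒮 m' f := fun N => (hf N).mono h

theorem dirD (hf : UCls 𝒮 m f) (l : List V) :
    UCls 𝒮 (m - 𝒮.δ * l.length) (fun i => Colombeau.dirD l (f i)) :=
  fun N => Cls.dirD isOpen_univ hf l N

theorem contDiff (hf : UCls 𝒮 m f) (i : Λ) : ContDiff ℝ ∞ (f i) := contDiffOn_univ.1 ((hf 0).1 i)

theorem bound (hf : UCls 𝒮 m f) (l : List V) : ∃ C : ℝ, ∃ p : ℕ, 0 ≤ C ∧
    ∀ i x, ‖Colombeau.dirD l (f i) x‖ ≤ C * 𝒮.W i ^ p * 𝒮.J i x ^ (m - 𝒮.δ * l.length) := by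
  obtain ⟨C, p, hC, h⟩ := (hf l.length).2 l le_rfl
  exact ⟨C, p, hC, fun i x => h i x (mem_univ x)⟩

end UCls

theorem UCls.of_bounds {Λ V : Type*} [NormedAddCommGroup V] [NormedSpace ℝ V] {𝒮 : Scale Λ V}
    {m : ℝ} {f : Λ → V → ℂ} (h1 : ∀ i, ContDiff ℝ ∞ (f i))
    (h : ∀ l : List V, ∃ C : ℝ, ∃ p : ℕ, ∀ i x,
      ‖Colombeau.dirD l (f i) x‖ ≤ C * 𝒮.W i ^ p * 𝒮.J i x ^ (m - 𝒮.δ * l.length)) : UCls 𝒮 m f :=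
  Cls.of_bounds (fun i => (h1 i).contDiffOn) fun l => by
    obtain ⟨C, p, h⟩ := h l
    exact ⟨C, p, fun i x _ => h i x⟩

section Param

variable {Λ : Type*} {n : ℕ} {W j : Λ → ℝ} {hW : ∀ i, 1 ≤ W i} {hj : ∀ i, 1 ≤ j i}

theorem UCls.exists_bound {V : Type*} [NormedAddCommGroup V] [NormedSpace ℝ V] {m : ℝ}
    {f : Λ → V → ℂ} (hf : UCls (paramScale V W j hW hj) m f)
    (l : List V) : ∃ C : ℝ, ∃ p : ℕ, 0 ≤ C ∧ ∀ i x, ‖Colombeau.dirD l (f i) x‖ ≤ C * W i ^ p * j i ^ m := by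
  simpa [paramScale] using hf.bound l

theorem UCls.of_exists_bound {V : Type*} [NormedAddCommGroup V] [NormedSpace ℝ V] {m : ℝ}
    {f : Λ → V → ℂ} (h1 : ∀ i, ContDiff ℝ ∞ (f i))
    (h : ∀ l : List V, ∃ C : ℝ, ∃ p : ℕ, ∀ i x,
      ‖Colombeau.dirD l (f i) x‖ ≤ C * W i ^ p * j i ^ m) :
    UCls (paramScale V W j hW hj) m f :=
  UCls.of_bounds h1 (by simpa [paramScale] using h)

/-- Uniform bounds for finitely many derivatives at once. -/
theorem UCls.exists_bound_finset {V ι : Type*} [NormedAddCommGroup V] [NormedSpace ℝ V] {m : ℝ}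
    {f : Λ → V → ℂ} (hf : UCls (paramScale V W j hW hj) m f) (s : Finset ι) (l : ι → List V) :
    ∃ C : ℝ, ∃ p : ℕ, 0 ≤ C ∧ ∀ k ∈ s, ∀ i x,
      ‖Colombeau.dirD (l k) (f i) x‖ ≤ C * W i ^ p * j i ^ m := by
  classical
  induction s using Finset.induction_on with
  | empty => exact ⟨0, 0, le_rfl, by simp⟩
  | insert a s _ ih =>
    obtain ⟨C, p, hC, h⟩ := ih
    obtain ⟨D, q, hD, h'⟩ := hf.exists_bound (l a)
    refine ⟨C + D, p + q, by positivity, fun k hk i x => ?_⟩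
    have hJ : 0 ≤ j i ^ m := Real.rpow_nonneg (zero_le_one.trans (hj i)) m
    have h1 := Cls.pow_le_aux (hW i) hC hD hJ p q
    have h2 : 0 ≤ C * W i ^ p * j i ^ m := by have := hW i; positivity
    have h3 : 0 ≤ D * W i ^ q * j i ^ m := by have := hW i; positivity
    rcases Finset.mem_insert.1 hk with rfl | hk
    · exact (h' i x).trans (by linarith)
    · exact (h k hk i x).trans (by linarith)

/-- Uniform decay of the Fourier transforms of a family of test functions. -/
theorem UCls.fourierHat_le {m : ℝ} {f : Λ → Rn n → ℂ} (hf : UCls (paramScale (Rn n) W j hW hj) m f)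
    {K : Set (Rn n)} (hK : IsCompact K) (h0 : ∀ i x, x ∉ K → f i x = 0) (L : ℕ) :
    ∃ C : ℝ, ∃ p : ℕ, 0 ≤ C ∧ ∀ i ξ, jap ξ ^ L * ‖fourierHat (f i) ξ‖ ≤ C * W i ^ p * j i ^ m := by
  obtain ⟨C, p, hC, h⟩ := hf.exists_bound_finset (Finset.univ : Finset (Option (Fin n)))
    (fun k => k.elim [] fun i => List.replicate L (unitVec i))
  refine ⟨((n + 1 : ℝ) ^ L * (n + 1) * volume.real K) * C, p, by positivity, fun i ξ => ?_⟩
  have := jap_pow_mul_fourierHat_le (hf.contDiff i) hK (h0 i) L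
    (fun x => h none (Finset.mem_univ _) i x) (fun k x => h (some k) (Finset.mem_univ _) i x) ξ
  refine this.trans (le_of_eq ?_)
  ring

end Param

/-- A smooth function with compact support, as a constant family. -/
theorem UCls.of_hasCompactSupport {Λ V : Type*} [NormedAddCommGroup V] [NormedSpace ℝ V]
    {𝒮 : Scale Λ V} (hδ : 𝒮.δ = 0) {φ : V → ℂ} (hφ : ContDiff ℝ ∞ φ) {K : Set V} (hK : IsCompact K)
    (h0 : ∀ x, x ∉ K → φ x = 0) : UCls 𝒮 0 (fun _ => φ) :=
  Cls.of_hasCompactSupport hδ hφ hK h0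

/-! ### Transposition -/

section Transpose

variable {n : ℕ}

theorem dirD_slice_left {V V' : Type*} [NormedAddCommGroup V] [NormedSpace ℝ V]
    [NormedAddCommGroup V'] [NormedSpace ℝ V'] {g : V × V' → ℂ} (hg : ContDiff ℝ ∞ g) (y : V')
    (l : List V) : dirD l (fun x => g (x, y)) = fun x => dirD (l.map fun v => (v, (0 : V'))) g (x, y) := by
  have := dirD_comp_affine hg (ContinuousLinearMap.inl ℝ V V') ((0 : V), y) l
  have hm : ⇑(ContinuousLinearMap.inl ℝ V V') = fun v => (v, 0) := funext fun v => by simp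
  rw [hm] at this
  simpa using this

theorem dirD_slice_right {V V' : Type*} [NormedAddCommGroup V] [NormedSpace ℝ V]
    [NormedAddCommGroup V'] [NormedSpace ℝ V'] {g : V × V' → ℂ} (hg : ContDiff ℝ ∞ g) (x : V)
    (l : List V') : dirD l (fun y => g (x, y)) = fun y => dirD (l.map fun v => ((0 : V), v)) g (x, y) := by
  have := dirD_comp_affine hg (ContinuousLinearMap.inr ℝ V V') (x, (0 : V')) l
  have hm : ⇑(ContinuousLinearMap.inr ℝ V V') = fun v => (0, v) := funext fun v => by simp
  rw [hm] at this
  simpa using this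

theorem UCls.slice_left {Λ V V' : Type*} [NormedAddCommGroup V] [NormedSpace ℝ V]
    [NormedAddCommGroup V'] [NormedSpace ℝ V'] {W : Λ → ℝ} {hW : ∀ i, 1 ≤ W i} {j : Λ → ℝ}
    {hj : ∀ i, 1 ≤ j i} {m : ℝ}
    {g : Λ → V × V' → ℂ} (hg : UCls (paramScale (V × V') W j hW hj) m g) {Λ' : Type*} (e : Λ' → Λ)
    (y : Λ' → V') :
    UCls (paramScale V (fun i => W (e i)) (fun i => j (e i)) (fun _ => hW _) (fun _ => hj _)) m
      (fun i x => g (e i) (x, y i)) := by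
  refine UCls.of_exists_bound
    (fun i => (hg.contDiff (e i)).comp (contDiff_id.prodMk contDiff_const)) fun l => ?_
  obtain ⟨C, p, -, h⟩ := hg.exists_bound (l.map fun v => (v, (0 : V')))
  refine ⟨C, p, fun i x => ?_⟩
  rw [dirD_slice_left (hg.contDiff _)]
  exact h _ _

theorem UCls.slice_right {Λ V V' : Type*} [NormedAddCommGroup V] [NormedSpace ℝ V]
    [NormedAddCommGroup V'] [NormedSpace ℝ V'] {W : Λ → ℝ} {hW : ∀ i, 1 ≤ W i} {j : Λ → ℝ}
    {hj : ∀ i, 1 ≤ j i} {m : ℝ}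
    {g : Λ → V × V' → ℂ} (hg : UCls (paramScale (V × V') W j hW hj) m g) {Λ' : Type*} (e : Λ' → Λ)
    (x : Λ' → V) :
    UCls (paramScale V' (fun i => W (e i)) (fun i => j (e i)) (fun _ => hW _) (fun _ => hj _)) m
      (fun i y => g (e i) (x i, y)) := by
  refine UCls.of_exists_bound
    (fun i => (hg.contDiff (e i)).comp (contDiff_const.prodMk contDiff_id)) fun l => ?_
  obtain ⟨C, p, -, h⟩ := hg.exists_bound (l.map fun v => ((0 : V), v))
  refine ⟨C, p, fun i x => ?_⟩
  rw [dirD_slice_right (hg.contDiff _)]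
  exact h _ _

theorem integrable_prod_of_le {F : Rn n × Rn n → ℂ} (hF : Continuous F) {K : Set (Rn n)}
    (hK : IsCompact K) (h0 : ∀ x η, x ∉ K → F (x, η) = 0) {C : ℝ}
    (hC : ∀ x η, ‖F (x, η)‖ ≤ C * (jap η ^ (n + 1))⁻¹) : Integrable F (volume.prod volume) := by
  have h1 : Integrable (K.indicator fun _ : Rn n => C) :=
    (integrable_indicator_iff hK.measurableSet).2 (integrableOn_const hK.measure_ne_top)
  have h2 := h1.mul_prod (integrable_inv_jap_pow (n := n))
  refine h2.mono' hF.aestronglyMeasurable (Filter.Eventually.of_forall fun p => ?_)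
  by_cases hp : p.1 ∈ K
  · simpa [indicator_of_mem hp] using hC p.1 p.2
  · simp [h0 p.1 p.2 hp, indicator_of_notMem hp]

/-- The trivial scale, for bounded families. -/
abbrev unitScale (Λ V : Type*) : Scale Λ V :=
  paramScale V (fun _ => 1) (fun _ => 1) (fun _ => le_rfl) (fun _ => le_rfl)

/-- The transpose of a pseudodifferential operator, in terms of its kernel. -/
theorem integral_pseudo_eq {a V : Rn n × Rn n → ℂ} (ha : ContDiff ℝ ∞ a)
    (hab : ∀ β : List (Rn n), ∃ C : ℝ, ∀ p, ‖symD [] β a p‖ ≤ C) (hV : ContDiff ℝ ∞ V)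
    {K K' : Set (Rn n)} (hK : IsCompact K) (hK' : IsCompact K')
    (h0 : ∀ x y, x ∉ K → V (x, y) = 0) (h0' : ∀ x y, y ∉ K' → V (x, y) = 0) :
    ∫ x, pseudo a (fun y => V (x, y)) x = ((2 * Real.pi : ℝ) : ℂ)⁻¹ ^ n *
      ∫ y, ∫ η, wave (-y) η * (∫ x, wave x η * (a (x, η) * V (x, y))) ∧
    Integrable fun y => ∫ η, wave (-y) η * ∫ x, wave x η * (a (x, η) * V (x, y)) := by
  have hVU : UCls (unitScale Unit (Rn n × Rn n)) 0 (fun _ => V) := by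
    refine UCls.of_hasCompactSupport rfl hV (hK.prod hK') fun p hp => ?_
    by_cases h : p.1 ∈ K
    · exact h0' p.1 p.2 fun h' => hp ⟨h, h'⟩
    · exact h0 p.1 p.2 h
  have hVx : UCls (unitScale (Rn n) (Rn n)) 0 (fun x y => V (x, y)) :=
    hVU.slice_right (fun _ => ()) (fun x => x)
  have hVy : UCls (unitScale (Rn n × Rn n) (Rn n)) 0 (fun q x => V (x, q.1)) :=
    hVU.slice_left (fun _ => ()) (fun q : Rn n × Rn n => q.1)
  have hax : UCls (unitScale (Rn n × Rn n) (Rn n)) 0 (fun q x => a (x, q.2)) := by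
    refine UCls.of_exists_bound (fun q => ha.comp (contDiff_id.prodMk contDiff_const)) fun β => ?_
    obtain ⟨C, hC⟩ := hab β
    refine ⟨C, 0, fun q x => ?_⟩
    rw [dirD_slice_left ha]
    simpa [symD] using hC (x, q.2)
  obtain ⟨C₀, hC₀⟩ := hab []
  have hC₀' : ∀ p, ‖a p‖ ≤ C₀ := hC₀
  obtain ⟨C₁, p₁, hC₁, h1⟩ := hVx.fourierHat_le hK' (fun x y hy => h0' x y hy) (n + 1)
  obtain ⟨C₂, p₂, hC₂, h2⟩ := (hax.mul hVy).fourierHat_le hK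
    (fun q x hx => by simp [h0 x q.1 hx]) (n + 1)
  simp only [one_pow, mul_one, Real.one_rpow] at h1 h2
  have hvc : Continuous V := hV.continuous
  have hac : Continuous a := ha.continuous
  have hcF : Continuous fun q : Rn n × Rn n => fourierHat (fun y => V (q.1, y)) q.2 := by
    simp only [fourierHat_eq]
    refine continuous_integral_of_compact ?_ hK' fun q y hy => by simp [h0' q.1 y hy]
    simp only [Function.uncurry_def]
    fun_prop
  -- Three exchanges of two integrals each: in (x, η), in (x, y) for fixed η, and in (y, η). The
  -- triple integral need not converge absolutely, since decay in η appears only after an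
  -- integration in y (smoothness of V in y) or in x (smoothness of aV in x).
  have i1 : Integrable (Function.uncurry fun x η => wave x η * a (x, η) * fourierHat (fun y => V (x, y)) η)
      (volume.prod volume) := by
    refine integrable_prod_of_le (K := K) (C := C₀ * C₁) ?_ hK ?_ ?_
    · simp only [Function.uncurry_def]
      fun_prop
    · intro x η hx
      simp only [Function.uncurry_apply_pair, fourierHat_eq]
      simp [h0 x _ hx]
    · intro x η
      simp only [Function.uncurry_apply_pair, norm_mul, norm_wave, one_mul]
      have h3 : ‖fourierHat (fun y => V (x, y)) η‖ ≤ C₁ * (jap η ^ (n + 1))⁻¹ := by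
        rw [← div_eq_mul_inv, le_div_iff₀ (pow_pos (jap_pos η) _), mul_comm]
        exact h1 x η
      calc _ ≤ C₀ * (C₁ * (jap η ^ (n + 1))⁻¹) :=
            mul_le_mul (hC₀' _) h3 (norm_nonneg _) ((norm_nonneg _).trans (hC₀' (x, η)))
        _ = _ := by ring
  have i2 : ∀ η, Integrable (Function.uncurry fun x y => wave x η * a (x, η) * (wave (-y) η * V (x, y)))
      (volume.prod volume) := by
    intro η
    have hc : Continuous (Function.uncurry fun x y => wave x η * a (x, η) * (wave (-y) η * V (x, y))) := by
      simp only [Function.uncurry_def]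
      fun_prop
    refine hc.integrable_of_hasCompactSupport (HasCompactSupport.intro (hK.prod hK') fun q hq => ?_)
    by_cases h : q.1 ∈ K
    · simp [Function.uncurry_def, h0' q.1 q.2 fun h' => hq ⟨h, h'⟩]
    · simp [Function.uncurry_def, h0 q.1 q.2 h]
  have i3 : Integrable (Function.uncurry fun y η => wave (-y) η * ∫ x, wave x η * (a (x, η) * V (x, y)))
      (volume.prod volume) := by
    refine integrable_prod_of_le (K := K') (C := C₂) ?_ hK' ?_ ?_
    · have : Continuous fun q : Rn n × Rn n => ∫ x, wave x q.2 * (a (x, q.2) * V (x, q.1)) := by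
        refine continuous_integral_of_compact ?_ hK fun q x hx => by simp [h0 x q.1 hx]
        simp only [Function.uncurry_def]
        fun_prop
      simp only [Function.uncurry_def]
      fun_prop
    · intro y η hy
      simp [h0' _ y hy]
    · intro y η
      -- The inner integral is a Fourier transform at -η in which η is also the frequency argument
      -- of the symbol; the bound `h2` is uniform in that parameter.
      have h3 := h2 (y, η) (-η)
      rw [jap_neg, fourierHat_eq] at h3
      simp only [wave_neg_right, neg_neg] at h3
      simp only [Function.uncurry_apply_pair, norm_mul, norm_wave, one_mul]
      rw [← div_eq_mul_inv, le_div_iff₀ (pow_pos (jap_pos η) _), mul_comm]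
      exact h3
  have s1 : ∫ x, ∫ η, wave x η * a (x, η) * fourierHat (fun y => V (x, y)) η =
      ∫ η, ∫ x, wave x η * a (x, η) * fourierHat (fun y => V (x, y)) η := integral_integral_swap i1
  have s2 : ∀ η, ∫ x, wave x η * a (x, η) * fourierHat (fun y => V (x, y)) η =
      ∫ y, wave (-y) η * ∫ x, wave x η * (a (x, η) * V (x, y)) := by
    intro η
    simp only [fourierHat_eq, ← integral_const_mul]
    rw [integral_integral_swap (i2 η)]
    congr 1
    funext y
    congr 1
    funext x
    ring
  refine ⟨?_, i3.integral_prod_left⟩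
  simp only [pseudo_eq]
  rw [integral_const_mul, s1]
  simp only [s2]
  rw [← integral_integral_swap i3]

/-- The transpose of `a(x,D)` applied to `c(x) e^{-ixξ}`, multiplied by `e^{iyξ}`. -/
def transOp (a : Rn n × Rn n → ℂ) (ξ : Rn n) (c : Rn n → ℂ) (y : Rn n) : ℂ :=
  ((2 * Real.pi : ℝ) : ℂ)⁻¹ ^ n * ∫ ζ, wave y ζ * fourierHat (fun x => a (x, ξ - ζ) * c x) ζ

/-- The general transposition formula for the amplitude e^{-ixξ} v(x,y). The substitution η = ξ - ζ
turns the oscillation into a shift of the frequency argument of a, which can then be expanded around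
ξ. -/
theorem integral_pseudo_eq_transOp {a v : Rn n × Rn n → ℂ} (ha : ContDiff ℝ ∞ a)
    (hab : ∀ β : List (Rn n), ∃ C : ℝ, ∀ p, ‖symD [] β a p‖ ≤ C) (hv : ContDiff ℝ ∞ v)
    {K K' : Set (Rn n)} (hK : IsCompact K) (hK' : IsCompact K')
    (h0 : ∀ x y, x ∉ K → v (x, y) = 0) (h0' : ∀ x y, y ∉ K' → v (x, y) = 0) (ξ : Rn n) :
    ∫ x, pseudo a (fun y => wave (-x) ξ * v (x, y)) x =
      ∫ y, wave (-y) ξ * transOp a ξ (fun x => v (x, y)) y ∧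
    Integrable fun y => wave (-y) ξ * transOp a ξ (fun x => v (x, y)) y := by
  have h := integral_pseudo_eq (V := fun p => wave (-p.1) ξ * v p) ha hab
    ((contDiff_wave_comp contDiff_fst.neg contDiff_const).mul hv) hK hK'
    (fun x y hx => by simp [h0 x y hx]) (fun x y hy => by simp [h0' x y hy])
  simp only at h
  have key : ∀ y, ((2 * Real.pi : ℝ) : ℂ)⁻¹ ^ n *
      ∫ η, wave (-y) η * ∫ x, wave x η * (a (x, η) * (wave (-x) ξ * v (x, y))) =
      wave (-y) ξ * transOp a ξ (fun x => v (x, y)) y := by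
    intro y
    have hs : ∫ η, wave (-y) η * ∫ x, wave x η * (a (x, η) * (wave (-x) ξ * v (x, y))) =
        ∫ ζ, wave (-y) (ξ - ζ) * ∫ x, wave x (ξ - ζ) * (a (x, ξ - ζ) * (wave (-x) ξ * v (x, y))) :=
      (integral_sub_left_eq_self (fun η => wave (-y) η * ∫ x, wave x η *
        (a (x, η) * (wave (-x) ξ * v (x, y)))) volume ξ).symm
    rw [hs, transOp, mul_left_comm, ← integral_const_mul (wave (-y) ξ)]
    congr 2
    funext ζ
    rw [fourierHat_eq, sub_eq_add_neg, wave_add_right, wave_neg_right, neg_neg, mul_assoc]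
    congr 3
    funext x
    rw [wave_add_right, wave_neg_right]
    linear_combination (wave (-x) ζ * (a (x, ξ + -ζ) * v (x, y))) * wave_neg_mul_wave x ξ
  refine ⟨?_, ?_⟩
  · rw [h.1, ← integral_const_mul]
    simp only [key]
  · simpa only [key] using h.2.const_mul (((2 * Real.pi : ℝ) : ℂ)⁻¹ ^ n)

end Transpose

/-! ### The asymptotic expansion of the transposed operator -/

section Expansion

theorem dirD_sub {V : Type*} [NormedAddCommGroup V] [NormedSpace ℝ V] {f g : V → ℂ}
    (hf : ContDiff ℝ ∞ f) (hg : ContDiff ℝ ∞ g) (l : List V) (x : V) :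
    dirD l (fun x => f x - g x) x = dirD l f x - dirD l g x := by
  have h1 : dirD l (f + (-1 : ℂ) • g) x = dirD l f x + dirD l ((-1 : ℂ) • g) x :=
    dirD_add isOpen_univ hf.contDiffOn (contDiff_const.smul hg).contDiffOn l (mem_univ x)
  rw [dirD_smul isOpen_univ hg.contDiffOn (-1 : ℂ) l (mem_univ x)] at h1
  have h2 : (f + (-1 : ℂ) • g) = fun x => f x - g x := by
    funext x
    simp [sub_eq_add_neg]
  rw [h2] at h1
  rw [h1]
  simp [sub_eq_add_neg]

theorem iteratedDeriv_eq_dirD (f : ℝ → ℂ) (k : ℕ) :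
    iteratedDeriv k f = dirD (List.replicate k (1 : ℝ)) f := by
  induction k with
  | zero => simp [dirD]
  | succ k ih =>
    rw [iteratedDeriv_succ, ih]
    rfl

/-- Taylor's formula in terms of iterated directional derivatives. -/
theorem norm_sub_taylor_le {V : Type*} [NormedAddCommGroup V] [NormedSpace ℝ V] {g : V → ℂ}
    (hg : ContDiff ℝ ∞ g) (p v : V) (m : ℕ) {C : ℝ}
    (h : ∀ t ∈ Icc (0 : ℝ) 1, ‖dirD (List.replicate (m + 1) v) g (p + t • v)‖ ≤ C) :
    ‖g (p + v) - ∑ j ∈ Finset.range (m + 1), ((j.factorial : ℝ) : ℂ)⁻¹ * dirD (List.replicate j v) g p‖ ≤ C := by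
  set f : ℝ → ℂ := fun t => g (p + t • v) with hf
  have hfs : ContDiff ℝ ∞ f := by fun_prop
  have hd : ∀ k t, iteratedDeriv k f t = dirD (List.replicate k v) g (p + t • v) := by
    intro k t
    have := dirD_comp_affine hg (ContinuousLinearMap.toSpanSingleton ℝ v) p (List.replicate k 1)
    rw [iteratedDeriv_eq_dirD]
    simpa using congrFun this t
  have hw : ∀ k : ℕ, ∀ t ∈ Icc (0 : ℝ) 1, iteratedDerivWithin k f (Icc 0 1) t =
      dirD (List.replicate k v) g (p + t • v) := by
    intro k t ht
    rw [← hd]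
    exact iteratedDerivWithin_eq_iteratedDeriv (uniqueDiffOn_Icc one_pos)
      (hfs.of_le (by exact_mod_cast le_top)).contDiffAt ht
  have hC : 0 ≤ C := (norm_nonneg _).trans (h 0 (by simp))
  have key := taylor_mean_remainder_bound (f := f) (n := m) (zero_le_one (α := ℝ))
    ((hfs.of_le (by exact_mod_cast le_top)).contDiffOn) (right_mem_Icc.2 zero_le_one) (C := C)
    (fun t ht => by rw [hw _ t ht]; exact h t ht)
  rw [taylor_within_apply] at key
  have hs : ∀ k : ℕ, (((k.factorial : ℝ))⁻¹ * (1 - 0) ^ k) • iteratedDerivWithin k f (Icc 0 1) 0 =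
      ((k.factorial : ℝ) : ℂ)⁻¹ * dirD (List.replicate k v) g p := by
    intro k
    rw [hw k 0 (by simp), Complex.real_smul]
    simp
  simp only [hs] at key
  have h1 : f 1 = g (p + v) := by simp [hf]
  rw [h1] at key
  refine key.trans ?_
  simp only [sub_zero, one_pow, mul_one]
  exact div_le_self hC (by exact_mod_cast Nat.one_le_iff_ne_zero.2 (Nat.factorial_ne_zero m))

variable {n : ℕ}

/-- A family of globally defined symbols of order `0` whose seminorms are dominated by `W`. -/
structure GlobalSymbols {E : Type*} (W : E → ℝ) (a : E → Rn n × Rn n → ℂ) : Prop where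
  contDiff : ∀ ε, ContDiff ℝ ∞ (a ε)
  bound : ∀ α β : List (Rn n), ∃ C : ℝ, 0 ≤ C ∧ ∀ ε p,
    ‖symD α β (a ε) p‖ ≤ C * W ε * (jap p.2 ^ α.length)⁻¹

/-- The scale of weights `W ε ^ p * ⟨ξ⟩ ^ m`. -/
abbrev symScale {E Λ : Type*} {W : E → ℝ} (hW : ∀ ε, 1 ≤ W ε) (e : Λ → E) (ξ : Λ → Rn n) :
    Scale Λ (Rn n) :=
  paramScale (Rn n) (fun i => W (e i)) (fun i => jap (ξ i)) (fun _ => hW _) (fun _ => one_le_jap _)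

theorem inv_jap_pow_eq (ξ : Rn n) (k : ℕ) : (jap ξ ^ k)⁻¹ = jap ξ ^ (-(k : ℝ)) := by
  rw [Real.rpow_neg (jap_pos ξ).le, Real.rpow_natCast]

/-- The list of coordinate vectors given by a multi-index. -/
abbrev dirs {j : ℕ} (s : Fin j → Fin n) : List (Rn n) := List.ofFn fun k => unitVec (s k)

/-- The terms of order at most `m` of the asymptotic expansion of `transOp a ξ c`. -/
def expand (m : ℕ) (a : Rn n × Rn n → ℂ) (ξ : Rn n) (c : Rn n → ℂ) (y : Rn n) : ℂ :=
  ∑ j ∈ Finset.range (m + 1), ∑ s : Fin j → Fin n, (((j.factorial : ℝ) : ℂ)⁻¹ * Complex.I ^ j) *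
    dirD (dirs s) (fun x => symD (dirs s) [] a (x, ξ) * c x) y

/-- In `symD` the ξ-derivatives are outermost; since derivatives commute, the x-derivatives may be
applied last instead. -/
theorem symD_append {a : Rn n × Rn n → ℂ} (ha : ContDiff ℝ ∞ a) (α β : List (Rn n)) (ξ : Rn n) :
    dirD β (fun x => symD α [] a (x, ξ)) = fun x => symD α β a (x, ξ) := by
  have h := contDiff_dirD ha (α.map (fun v => ((0 : Rn n), v)))
  funext x
  simp only [symD, List.map_nil, List.append_nil]
  rw [dirD_slice_left h, ← dirD_append]
  exact congrFun (dirD_perm List.perm_append_comm ha) _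

theorem contDiff_symD_slice {a : Rn n × Rn n → ℂ} (ha : ContDiff ℝ ∞ a) (α β : List (Rn n)) (ξ : Rn n) :
    ContDiff ℝ ∞ (fun x => symD α β a (x, ξ)) :=
  (contDiff_dirD ha _).comp (contDiff_id.prodMk contDiff_const)

section

variable {E Λ : Type*} {W : E → ℝ} {hW : ∀ ε, 1 ≤ W ε} {a : E → Rn n × Rn n → ℂ} {e : Λ → E}
  {ξ : Λ → Rn n}

/-- The symbol is read as a family of functions of x indexed by ε and ξ. Derivatives in x are free,
so the scale has δ = 0, while each ξ-derivative lowers the order in ⟨ξ⟩ by one. -/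
theorem GlobalSymbols.uCls (ha : GlobalSymbols W a) (hW : ∀ ε, 1 ≤ W ε) (e : Λ → E) (ξ : Λ → Rn n)
    (α : List (Rn n)) :
    UCls (symScale hW e ξ) (-(α.length : ℝ)) (fun i x => symD α [] (a (e i)) (x, ξ i)) := by
  refine UCls.of_exists_bound (fun i => contDiff_symD_slice (ha.contDiff _) α [] _) fun β => ?_
  obtain ⟨C, hC, h⟩ := ha.bound α β
  refine ⟨C, 1, fun i x => ?_⟩
  rw [symD_append (ha.contDiff _), pow_one, ← inv_jap_pow_eq]
  exact h _ _

theorem expand_sub {a : Rn n × Rn n → ℂ} (ha : ContDiff ℝ ∞ a) {b c : Rn n → ℂ}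
    (hb : ContDiff ℝ ∞ b) (hc : ContDiff ℝ ∞ c) (m : ℕ) (ξ y : Rn n) :
    expand m a ξ (fun x => b x - c x) y = expand m a ξ b y - expand m a ξ c y := by
  unfold expand
  simp only [← Finset.sum_sub_distrib]
  refine Finset.sum_congr rfl fun j _ => Finset.sum_congr rfl fun s _ => ?_
  rw [← mul_sub]
  congr 1
  have hs := contDiff_symD_slice ha (dirs s) [] ξ
  rw [← dirD_sub (hs.mul hb) (hs.mul hc)]
  simp only [mul_sub]

/-- The expansion is a differential operator in c, hence local. Off the support of c the function
`transOp a ξ c` therefore consists of the remainder only. -/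
theorem expand_eq_zero {a : Rn n × Rn n → ℂ} {c : Rn n → ℂ} {K : Set (Rn n)} (hK : IsClosed K)
    (h0 : ∀ x, x ∉ K → c x = 0) (m : ℕ) (ξ : Rn n) {y : Rn n} (hy : y ∉ K) : expand m a ξ c y = 0 := by
  unfold expand
  refine Finset.sum_eq_zero fun j _ => Finset.sum_eq_zero fun s _ => ?_
  rw [dirD_eq_zero_of_notMem hK (fun x hx => by simp [h0 x hx]) _ hy, mul_zero]

/-- The leading term of the expansion. -/
theorem uCls_expand_sub (ha : GlobalSymbols W a) {d : ℝ} {c : Λ → Rn n → ℂ}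
    (hc : UCls (symScale hW e ξ) d c) (m : ℕ) :
    UCls (symScale hW e ξ) (d - 1) (fun i y => expand m (a (e i)) (ξ i) (c i) y - a (e i) (y, ξ i) * c i y) := by
  -- The term j = 0 is a(y,ξ)c(y). Each remaining term contains j + 1 ≥ 1 derivatives of a in ξ,
  -- whence the gain of one order.
  have h1 : ∀ i y, expand m (a (e i)) (ξ i) (c i) y - a (e i) (y, ξ i) * c i y =
      ∑ j ∈ Finset.range m, ∑ s : Fin (j + 1) → Fin n,
        ((((j + 1).factorial : ℝ) : ℂ)⁻¹ * Complex.I ^ (j + 1)) *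
        dirD (dirs s) (fun x => symD (dirs s) [] (a (e i)) (x, ξ i) * c i x) y := by
    intro i y
    rw [expand, Finset.sum_range_succ']
    simp [dirs, dirD, symD]
  simp only [h1]
  refine UCls.sum _ fun j _ => UCls.sum _ fun s _ => UCls.const_mul ?_ _
  refine (((ha.uCls hW e ξ (dirs s)).mul hc).dirD (dirs s)).mono ?_
  simp only [dirs, List.length_ofFn, symScale, paramScale]
  push_cast
  have := Nat.cast_nonneg (α := ℝ) j
  linarith

theorem zero_prod_neg_eq_sum (ζ : Rn n) :
    ((0 : Rn n), -ζ) = ∑ i, (-ζ i) • ((0 : Rn n), unitVec i) := by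
  conv_lhs => rw [← sum_coord_smul_unitVec ζ]
  refine Prod.ext ?_ ?_
  · simp [Prod.fst_sum]
  · simp [Prod.snd_sum]

/-- The difference between `a(x, ξ - ζ)` and its Taylor polynomial in `ζ`. -/
def taylorRem (m : ℕ) (a : Rn n × Rn n → ℂ) (ξ ζ x : Rn n) : ℂ :=
  a (x, ξ - ζ) - ∑ j ∈ Finset.range (m + 1), ∑ s : Fin j → Fin n,
    (((j.factorial : ℝ) : ℂ)⁻¹ * ((∏ k, (-ζ (s k)) : ℝ) : ℂ)) * symD (dirs s) [] a (x, ξ)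

theorem contDiff_taylorRem {a : Rn n × Rn n → ℂ} (ha : ContDiff ℝ ∞ a) (m : ℕ) (ξ ζ : Rn n) :
    ContDiff ℝ ∞ (taylorRem m a ξ ζ) :=
  (ha.comp (contDiff_id.prodMk contDiff_const)).sub (ContDiff.sum fun _ _ => ContDiff.sum fun s _ =>
    contDiff_const.mul (contDiff_symD_slice ha (dirs s) [] ξ))

/-- Taylor expansion in ξ commutes with ∂_x^β, so the derivative is again a Taylor remainder, namely
that of ∂_x^β a. -/
theorem dirD_taylorRem {a : Rn n × Rn n → ℂ} (ha : ContDiff ℝ ∞ a) (m : ℕ) (ξ ζ : Rn n)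
    (β : List (Rn n)) (x : Rn n) :
    dirD β (taylorRem m a ξ ζ) x = symD [] β a ((x, ξ) + (0, -ζ)) -
      ∑ j ∈ Finset.range (m + 1), ((j.factorial : ℝ) : ℂ)⁻¹ *
        dirD (List.replicate j ((0 : Rn n), -ζ)) (symD [] β a) (x, ξ) := by
  have hβ : ContDiff ℝ ∞ (symD [] β a) := contDiff_dirD ha _
  have hs : ∀ (j : ℕ) (s : Fin j → Fin n), ContDiff ℝ ∞ (fun x =>
      (((j.factorial : ℝ) : ℂ)⁻¹ * ((∏ k, (-ζ (s k)) : ℝ) : ℂ)) * symD (dirs s) [] a (x, ξ)) :=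
    fun j s => contDiff_const.mul (contDiff_symD_slice ha (dirs s) [] ξ)
  have hss : ∀ j : ℕ, ContDiff ℝ ∞ (fun x => ∑ s : Fin j → Fin n,
      (((j.factorial : ℝ) : ℂ)⁻¹ * ((∏ k, (-ζ (s k)) : ℝ) : ℂ)) * symD (dirs s) [] a (x, ξ)) :=
    fun j => ContDiff.sum fun s _ => hs j s
  unfold taylorRem
  have hsl : ContDiff ℝ ∞ fun x => a (x, ξ - ζ) := ha.comp (contDiff_id.prodMk contDiff_const)
  rw [dirD_sub hsl (ContDiff.sum fun j _ => hss j),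
    dirD_sum _ isOpen_univ (fun j _ => (hss j).contDiffOn) β (mem_univ x)]
  congr 1
  · rw [dirD_slice_left ha]
    simp [symD, sub_eq_add_neg]
  · refine Finset.sum_congr rfl fun j _ => ?_
    rw [dirD_sum _ isOpen_univ (fun s _ => (hs j s).contDiffOn) β (mem_univ x),
      zero_prod_neg_eq_sum, dirD_replicate_sum hβ, Finset.mul_sum]
    refine Finset.sum_congr rfl fun s _ => ?_
    rw [dirD_const_mul isOpen_univ (contDiff_symD_slice ha (dirs s) [] ξ).contDiffOn _ β (mem_univ x),
      symD_append ha]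
    simp only [mul_assoc]
    congr 2
    rw [symD, symD, List.map_nil, List.nil_append, ← dirD_append, List.map_ofFn]
    rfl

/-- The derivatives of order m + 1 are evaluated at ξ - tζ, where Peetre's inequality bounds them by
⟨ξ⟩^{-m-1}⟨ζ⟩^{m+1}; the m + 1 factors ζ_k contribute another ⟨ζ⟩^{m+1}. -/
theorem GlobalSymbols.taylorRem_le (ha : GlobalSymbols W a) (hW : ∀ ε, 1 ≤ W ε) (m : ℕ)
    (β : List (Rn n)) :
    ∃ C : ℝ, 0 ≤ C ∧ ∀ ε (ξ ζ x : Rn n), ‖dirD β (taylorRem m (a ε) ξ ζ) x‖ ≤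
      C * W ε * (jap ξ ^ (m + 1))⁻¹ * jap ζ ^ (2 * m + 2) := by
  choose C hC h using fun s : Fin (m + 1) → Fin n => ha.bound (dirs s) β
  have hsum : 0 ≤ ∑ s, C s := Finset.sum_nonneg fun s _ => hC s
  refine ⟨(∑ s, C s) * 2 ^ (m + 1), by positivity, fun ε ξ ζ x => ?_⟩
  have hβ : ContDiff ℝ ∞ (symD [] β (a ε)) := contDiff_dirD (ha.contDiff ε) _
  rw [dirD_taylorRem (ha.contDiff ε)]
  refine norm_sub_taylor_le hβ _ _ m fun t ht => ?_
  rw [zero_prod_neg_eq_sum, dirD_replicate_sum hβ, ← zero_prod_neg_eq_sum]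
  have hW0 : 0 ≤ W ε := zero_le_one.trans (hW ε)
  have hξ := jap_pos ξ
  have hζ := jap_pos ζ
  have hP : (jap (ξ + t • -ζ))⁻¹ ≤ 2 * (jap ξ)⁻¹ * jap ζ := by
    refine (inv_jap_add_le ξ (t • -ζ)).trans ?_
    have := jap_smul_le (t := t) (abs_le.2 ⟨by linarith [ht.1], ht.2⟩) (-ζ)
    rw [jap_neg] at this
    gcongr
  refine (norm_sum_le _ _).trans ?_
  calc _ ≤ ∑ s : Fin (m + 1) → Fin n, C s * (2 ^ (m + 1) * W ε * (jap ξ ^ (m + 1))⁻¹ * jap ζ ^ (2 * m + 2)) := by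
        refine Finset.sum_le_sum fun s _ => ?_
        have h1 : ‖((∏ k, (-ζ (s k)) : ℝ) : ℂ)‖ ≤ jap ζ ^ (m + 1) := by
          rw [Complex.norm_real, Real.norm_eq_abs, Finset.abs_prod]
          calc ∏ k, |(-ζ (s k))| ≤ ∏ _k : Fin (m + 1), jap ζ :=
                Finset.prod_le_prod (fun _ _ => abs_nonneg _) fun k _ => by
                  rw [abs_neg]; exact abs_coord_le_jap ζ _
            _ = _ := by simp
        have h2 : ‖dirD (List.ofFn fun k => ((0 : Rn n), unitVec (s k))) (symD [] β (a ε))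
            ((x, ξ) + t • ((0 : Rn n), -ζ))‖ ≤ C s * W ε * (2 * (jap ξ)⁻¹ * jap ζ) ^ (m + 1) := by
          have h3 := h s ε ((x, ξ) + t • ((0 : Rn n), -ζ))
          have h4 : symD (dirs s) β (a ε) = dirD (List.ofFn fun k => ((0 : Rn n), unitVec (s k)))
              (symD [] β (a ε)) := by
            rw [symD, symD, List.map_nil, List.nil_append, ← dirD_append, List.map_ofFn]
            rfl
          rw [h4] at h3
          refine h3.trans ?_
          have h5 : ((x, ξ) + t • ((0 : Rn n), -ζ)).2 = ξ + t • -ζ := by simp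
          rw [h5, List.length_ofFn, ← inv_pow]
          have := hC s
          have := jap_pos (ξ + t • -ζ)
          gcongr
        rw [norm_mul]
        refine (mul_le_mul h1 h2 (norm_nonneg _) (by positivity)).trans (le_of_eq ?_)
        rw [mul_pow, mul_pow, inv_pow]
        ring
    _ = _ := by rw [← Finset.sum_mul]; ring

/-- The asymptotic expansion of the transposed operator. -/
theorem GlobalSymbols.transOp_sub_expand_le (ha : GlobalSymbols W a) {d : ℝ} {c : Λ → Rn n → ℂ}
    (hc : UCls (symScale hW e ξ) d c) {K : Set (Rn n)} (hK : IsCompact K)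
    (h0 : ∀ i x, x ∉ K → c i x = 0) (m : ℕ) :
    ∃ C : ℝ, ∃ p : ℕ, 0 ≤ C ∧ ∀ i y,
      ‖transOp (a (e i)) (ξ i) (c i) y - expand m (a (e i)) (ξ i) (c i) y‖ ≤
        C * W (e i) ^ p * jap (ξ i) ^ (d - (m + 1)) := by
  -- Division by ⟨ζ⟩^{2m+2} makes the Taylor remainders uniformly bounded in ζ. Below, decay of
  -- order 2m + 2 + (n + 1) compensates this factor and leaves the integrable ⟨ζ⟩^{-n-1}.
  have hrem : UCls (symScale hW (fun q : Λ × Rn n => e q.1) (fun q => ξ q.1)) (-(m + 1 : ℝ))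
      (fun q x => ((jap q.2 ^ (2 * m + 2) : ℝ) : ℂ)⁻¹ * taylorRem m (a (e q.1)) (ξ q.1) q.2 x) := by
    refine UCls.of_exists_bound
      (fun q => contDiff_const.mul (contDiff_taylorRem (ha.contDiff _) m _ _)) fun β => ?_
    obtain ⟨C, hC, h⟩ := ha.taylorRem_le hW m β
    refine ⟨C, 1, fun q x => ?_⟩
    rw [dirD_const_mul isOpen_univ (contDiff_taylorRem (ha.contDiff _) m _ _).contDiffOn _ β (mem_univ x),
      norm_mul, norm_inv, Complex.norm_real, Real.norm_of_nonneg (pow_nonneg (jap_pos _).le _),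
      inv_mul_le_iff₀ (pow_pos (jap_pos _) _)]
    refine (h _ _ _ _).trans (le_of_eq ?_)
    have := inv_jap_pow_eq (ξ q.1) (m + 1)
    push_cast at this
    rw [this]
    ring
  have hc' : UCls (symScale hW (fun q : Λ × Rn n => e q.1) (fun q => ξ q.1)) d (fun q => c q.1) :=
    fun N => (hc N).comp_param Prod.fst (fun _ => rfl) (fun _ _ => rfl) rfl
  obtain ⟨C, p, hC, h⟩ := (hrem.mul hc').fourierHat_le hK (fun q x hx => by simp [h0 q.1 x hx])
    (2 * m + 2 + (n + 1))
  set I₀ : ℝ := ∫ ζ : Rn n, (jap ζ ^ (n + 1))⁻¹ with hI₀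
  have hI₀0 : 0 ≤ I₀ := integral_nonneg fun ζ => inv_nonneg.2 (pow_nonneg (jap_pos ζ).le _)
  refine ⟨‖((2 * Real.pi : ℝ) : ℂ)⁻¹ ^ n‖ * (C * I₀), p, by positivity, fun i y => ?_⟩
  have hci : ContDiff ℝ ∞ (c i) := hc.contDiff i
  have hai := ha.contDiff (e i)
  set B : ℝ := C * W (e i) ^ p * jap (ξ i) ^ (-(m + 1 : ℝ) + d) with hB
  have hR : ∀ ζ, ‖fourierHat (fun x => taylorRem m (a (e i)) (ξ i) ζ x * c i x) ζ‖ ≤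
      B * (jap ζ ^ (n + 1))⁻¹ := by
    intro ζ
    have h1 := h (i, ζ) ζ
    simp only [mul_assoc] at h1
    rw [fourierHat_const_mul, norm_mul, norm_inv, Complex.norm_real,
      Real.norm_of_nonneg (pow_nonneg (jap_pos _).le _), pow_add] at h1
    have h2 := jap_pos ζ
    rw [← div_eq_mul_inv, le_div_iff₀ (pow_pos (jap_pos ζ) _)]
    refine le_trans (le_of_eq ?_) (h1.trans (le_of_eq ?_))
    · field_simp
    · rw [hB]; ring
  have hcR : Continuous fun ζ => fourierHat (fun x => taylorRem m (a (e i)) (ξ i) ζ x * c i x) ζ := by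
    simp only [fourierHat_eq]
    refine continuous_integral_of_compact ?_ hK fun ζ x hx => by simp [h0 i x hx]
    have hcs : ∀ (j : ℕ) (s : Fin j → Fin n), Continuous fun q : Rn n × Rn n =>
        symD (dirs s) [] (a (e i)) (q.2, ξ i) := fun j s =>
      (contDiff_dirD hai _).continuous.comp (continuous_snd.prodMk continuous_const)
    have hac := hai.continuous
    have hcc := hci.continuous
    simp only [Function.uncurry_def, taylorRem]
    fun_prop
  have iR := integrable_of_le_inv_jap hcR hR
  set g : (j : ℕ) → (Fin j → Fin n) → Rn n → ℂ := fun j s x =>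
    dirD (dirs s) (fun x => symD (dirs s) [] (a (e i)) (x, ξ i) * c i x) x with hg
  have hprod : ∀ (j : ℕ) (s : Fin j → Fin n), ContDiff ℝ ∞ fun x => symD (dirs s) [] (a (e i)) (x, ξ i) * c i x :=
    fun j s => (contDiff_symD_slice hai (dirs s) [] _).mul hci
  have hgs : ∀ j s, ContDiff ℝ ∞ (g j s) := fun j s => contDiff_dirD (hprod j s) _
  have hp0 : ∀ (j : ℕ) (s : Fin j → Fin n), ∀ x, x ∉ K → symD (dirs s) [] (a (e i)) (x, ξ i) * c i x = 0 :=
    fun j s x hx => by simp [h0 i x hx]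
  have hg0 : ∀ j s, ∀ x, x ∉ K → g j s x = 0 := fun j s x hx =>
    dirD_eq_zero_of_notMem hK.isClosed (hp0 j s) _ hx
  -- Since -ζ_k = i·(iζ_k), every monomial factor becomes i times a derivative in x; this produces
  -- the factors i^j of `expand`.
  have hterm : ∀ (j : ℕ) (s : Fin j → Fin n) (ζ : Rn n),
      ((∏ k, (-ζ (s k)) : ℝ) : ℂ) * fourierHat (fun x => symD (dirs s) [] (a (e i)) (x, ξ i) * c i x) ζ =
      Complex.I ^ j * fourierHat (g j s) ζ := by
    intro j s ζ
    rw [hg]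
    simp only
    rw [fourierHat_dirD (hprod j s) hK (hp0 j s), ← mul_assoc]
    congr 1
    rw [List.map_ofFn, List.prod_ofFn]
    push_cast
    rw [← Fin.prod_const j Complex.I, ← Finset.prod_mul_distrib]
    refine Finset.prod_congr rfl fun k _ => ?_
    simp only [Function.comp_apply, inner_unitVec]
    rw [← mul_assoc, Complex.I_mul_I]
    ring
  have hsplit : ∀ ζ, fourierHat (fun x => a (e i) (x, ξ i - ζ) * c i x) ζ =
      fourierHat (fun x => taylorRem m (a (e i)) (ξ i) ζ x * c i x) ζ +
      ∑ j ∈ Finset.range (m + 1), ∑ s : Fin j → Fin n,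
        (((j.factorial : ℝ) : ℂ)⁻¹ * Complex.I ^ j) * fourierHat (g j s) ζ := by
    intro ζ
    have hw : Continuous fun y : Rn n => wave (-y) ζ := by fun_prop
    have hint : ∀ (j : ℕ) (s : Fin j → Fin n), Integrable fun y => wave (-y) ζ *
        ((((j.factorial : ℝ) : ℂ)⁻¹ * ((∏ k, (-ζ (s k)) : ℝ) : ℂ)) *
          (symD (dirs s) [] (a (e i)) (y, ξ i) * c i y)) := fun j s =>
      integrable_of_compact (hw.mul (continuous_const.mul (hprod j s).continuous)) hK
        fun x hx => by simp [h0 i x hx]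
    have hfs : ∀ (j : ℕ) (s : Fin j → Fin n), (((j.factorial : ℝ) : ℂ)⁻¹ * Complex.I ^ j) * fourierHat (g j s) ζ =
        ∫ y, wave (-y) ζ * ((((j.factorial : ℝ) : ℂ)⁻¹ * ((∏ k, (-ζ (s k)) : ℝ) : ℂ)) *
          (symD (dirs s) [] (a (e i)) (y, ξ i) * c i y)) := by
      intro j s
      rw [mul_assoc, ← hterm, ← mul_assoc, ← fourierHat_const_mul, fourierHat_eq]
    simp only [hfs]
    have hin : ∀ j : ℕ, Integrable fun y => ∑ s : Fin j → Fin n, wave (-y) ζ *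
        ((((j.factorial : ℝ) : ℂ)⁻¹ * ((∏ k, (-ζ (s k)) : ℝ) : ℂ)) *
          (symD (dirs s) [] (a (e i)) (y, ξ i) * c i y)) := fun j =>
      integrable_finsetSum _ fun s _ => hint j s
    have hfull := integrable_finsetSum (Finset.range (m + 1)) fun j _ => hin j
    simp only [← integral_finsetSum _ fun s _ => hint _ s]
    rw [← integral_finsetSum _ fun j _ => hin j, fourierHat_eq, fourierHat_eq, ← integral_add _ hfull]
    · congr 1
      funext y
      simp only [taylorRem, sub_mul, mul_sub, Finset.sum_mul, Finset.mul_sum, mul_assoc]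
      ring
    · exact integrable_of_compact (hw.mul ((contDiff_taylorRem hai m _ _).mul hci).continuous) hK
        fun x hx => by simp [h0 i x hx]
  have iG : ∀ (j : ℕ) (s : Fin j → Fin n), Integrable fun ζ =>
      wave y ζ * ((((j.factorial : ℝ) : ℂ)⁻¹ * Complex.I ^ j) * fourierHat (g j s) ζ) := by
    intro j s
    have h1 := (integrable_fourierHat (hgs j s) hK (hg0 j s)).const_mul
      (((j.factorial : ℝ) : ℂ)⁻¹ * Complex.I ^ j)
    refine h1.norm.mono' ((by fun_prop : Continuous fun ζ : Rn n => wave y ζ).aestronglyMeasurable.mul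
      h1.aestronglyMeasurable) (Filter.Eventually.of_forall fun ζ => ?_)
    rw [norm_mul, norm_wave, one_mul]
  have iR' : Integrable fun ζ => wave y ζ * fourierHat (fun x => taylorRem m (a (e i)) (ξ i) ζ x * c i x) ζ := by
    refine iR.norm.mono' ((by fun_prop : Continuous fun ζ : Rn n => wave y ζ).aestronglyMeasurable.mul
      iR.aestronglyMeasurable) (Filter.Eventually.of_forall fun ζ => ?_)
    rw [norm_mul, norm_wave, one_mul]
  -- By Fourier inversion the Taylor polynomial contributes exactly `expand`; only the integral of
  -- the remainder is left.
  have hT : transOp (a (e i)) (ξ i) (c i) y - expand m (a (e i)) (ξ i) (c i) y =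
      ((2 * Real.pi : ℝ) : ℂ)⁻¹ ^ n * ∫ ζ, wave y ζ *
        fourierHat (fun x => taylorRem m (a (e i)) (ξ i) ζ x * c i x) ζ := by
    have hin : ∀ j : ℕ, Integrable fun ζ => ∑ s : Fin j → Fin n,
        wave y ζ * ((((j.factorial : ℝ) : ℂ)⁻¹ * Complex.I ^ j) * fourierHat (g j s) ζ) := fun j =>
      integrable_finsetSum _ fun s _ => iG j s
    have hfull := integrable_finsetSum (Finset.range (m + 1)) fun j _ => hin j
    rw [transOp]
    simp only [hsplit, mul_add, Finset.mul_sum]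
    rw [integral_add iR' hfull, integral_finsetSum _ fun j _ => hin j]
    simp only [integral_finsetSum _ fun s _ => iG _ s]
    rw [mul_add, add_sub_assoc, add_eq_left, sub_eq_zero, expand, Finset.mul_sum]
    refine Finset.sum_congr rfl fun j _ => ?_
    rw [Finset.mul_sum]
    refine Finset.sum_congr rfl fun s _ => ?_
    have h3 := fourier_inversion (hgs j s) hK (hg0 j s) y
    have h4 : ∀ ζ, wave y ζ * ((((j.factorial : ℝ) : ℂ)⁻¹ * Complex.I ^ j) * fourierHat (g j s) ζ) =
      (((j.factorial : ℝ) : ℂ)⁻¹ * Complex.I ^ j) * (wave y ζ * fourierHat (g j s) ζ) := fun ζ => by ring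
    simp only [h4]
    rw [integral_const_mul, mul_left_comm, h3]
  rw [hT, norm_mul]
  have hfin : ‖∫ ζ, wave y ζ * fourierHat (fun x => taylorRem m (a (e i)) (ξ i) ζ x * c i x) ζ‖ ≤ B * I₀ := by
    rw [hI₀, ← integral_const_mul]
    refine norm_integral_le_of_norm_le (integrable_inv_jap_pow.const_mul B)
      (Filter.Eventually.of_forall fun ζ => ?_)
    rw [norm_mul, norm_wave, one_mul]
    exact hR ζ
  calc _ ≤ ‖((2 * Real.pi : ℝ) : ℂ)⁻¹ ^ n‖ * (B * I₀) := by gcongr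
    _ = _ := by
      rw [hB, show -(m + 1 : ℝ) + d = d - (m + 1) by ring]
      ring

end

end Expansion

/-! ### The microlocal parametrix -/

section Parametrix

/-- A bound near the support suffices, since all derivatives vanish elsewhere. This makes r/a global
although a is invertible on O only. -/
theorem UCls.of_cls {Λ V : Type*} [NormedAddCommGroup V] [NormedSpace ℝ V] {W j : Λ → ℝ}
    {hW : ∀ i, 1 ≤ W i} {hj : ∀ i, 1 ≤ j i} {m : ℝ} {f : Λ → V → ℂ}
    {O S K : Set V} (hO : IsOpen O) (hK : IsClosed K) (hKO : K ⊆ O) (hKS : K ⊆ S)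
    (hf : ∀ N, Cls (paramScale V W j hW hj) O S N m f) (h0 : ∀ i x, x ∉ K → f i x = 0) :
    UCls (paramScale V W j hW hj) m f := by
  refine UCls.of_exists_bound
    (fun i => contDiff_of_contDiffOn_of_compact hO hK hKO ((hf 0).1 i) (h0 i)) fun l => ?_
  obtain ⟨C, p, hC, h⟩ := (hf l.length).2 l le_rfl
  refine ⟨C, p, fun i x => ?_⟩
  by_cases hx : x ∈ K
  · simpa [paramScale] using h i x (hKS hx)
  · rw [dirD_eq_zero_of_notMem hK (h0 i) l hx, norm_zero]
    have := hW i
    have := hj i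
    positivity

variable {n : ℕ} {E Λ : Type*} {W : E → ℝ} {hW : ∀ ε, 1 ≤ W ε} {a : E → Rn n × Rn n → ℂ} {e : Λ → E}
  {ξ : Λ → Rn n}

theorem transOp_const_mul (a : Rn n × Rn n → ℂ) (ξ : Rn n) (c : Rn n → ℂ) (z : ℂ) (y : Rn n) :
    transOp a ξ (fun x => z * c x) y = z * transOp a ξ c y := by
  unfold transOp
  rw [mul_left_comm z, ← integral_const_mul z]
  congr 2
  funext ζ
  have : (fun x => a (x, ξ - ζ) * (z * c x)) = fun x => z * (a (x, ξ - ζ) * c x) := by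
    funext x
    ring
  rw [this, fourierHat_const_mul]
  ring

/-- Division by an elliptic family of symbols. -/
theorem GlobalSymbols.uCls_div (ha : GlobalSymbols W a) {O K : Set (Rn n)} (hO : IsOpen O)
    (hK : IsClosed K) (hKO : K ⊆ O) {c₀ : ℝ} {q : ℕ} (hc₀ : 0 ≤ c₀)
    (hne : ∀ i, ∀ x ∈ O, a (e i) (x, ξ i) ≠ 0)
    (hell : ∀ i, ∀ x ∈ O, ‖a (e i) (x, ξ i)‖⁻¹ ≤ c₀ * W (e i) ^ q) {d : ℝ} {r : Λ → Rn n → ℂ}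
    (hr : UCls (symScale hW e ξ) d r) (hr0 : ∀ i x, x ∉ K → r i x = 0) :
    UCls (symScale hW e ξ) d (fun i x => r i x * (a (e i) (x, ξ i))⁻¹) := by
  refine UCls.of_cls (S := O) hO hK hKO hKO (fun N => ?_) (fun i x hx => by simp [hr0 i x hx])
  have h1 : ∀ N, Cls (symScale hW e ξ) O O N 0 (fun i x => a (e i) (x, ξ i)) := fun N => by
    have := (ha.uCls hW e ξ [] N).restrict (subset_univ O) (subset_univ O)
    simpa [symD, dirD] using this
  have h2 := Cls.inv hO subset_rfl rfl h1 hne hc₀ hell N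
  have h3 := ((hr N).restrict (subset_univ O) (subset_univ O)).mul hO subset_rfl h2
  simpa using h3

/-- Successive elimination of the error. If the expansion of b is φ + r with r of order -j, then b -
r/a has an error of order -j-1, because the leading term of the expansion is multiplication by a.
The iteration starts from b = 0, r = -φ. -/
theorem GlobalSymbols.exists_expand_eq (ha : GlobalSymbols W a) {O K : Set (Rn n)} (hO : IsOpen O)
    (hK : IsCompact K) (hKO : K ⊆ O) {c₀ : ℝ} {q : ℕ} (hc₀ : 0 ≤ c₀)
    (hne : ∀ i, ∀ x ∈ O, a (e i) (x, ξ i) ≠ 0)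
    (hell : ∀ i, ∀ x ∈ O, ‖a (e i) (x, ξ i)‖⁻¹ ≤ c₀ * W (e i) ^ q) {φ : Rn n → ℂ}
    (hφ : ContDiff ℝ ∞ φ) (hφ0 : ∀ x, x ∉ K → φ x = 0) (m j : ℕ) :
    ∃ b r : Λ → Rn n → ℂ, UCls (symScale hW e ξ) 0 b ∧ UCls (symScale hW e ξ) (-(j : ℝ)) r ∧
      (∀ i x, x ∉ K → b i x = 0) ∧ (∀ i x, x ∉ K → r i x = 0) ∧
      ∀ i y, expand m (a (e i)) (ξ i) (b i) y = φ y + r i y := by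
  induction j with
  | zero =>
    refine ⟨fun _ _ => 0, fun _ x => -1 * φ x, fun N => Cls.zero, ?_, fun _ _ _ => rfl,
      fun i x hx => by simp [hφ0 x hx], fun i y => ?_⟩
    · simpa using (UCls.of_hasCompactSupport (𝒮 := symScale hW e ξ) rfl hφ hK hφ0).const_mul (-1)
    · rw [expand_eq_zero isClosed_empty (fun _ _ => rfl) m _ (notMem_empty y)]
      ring
  | succ j ih =>
    obtain ⟨b, r, hb, hr, hb0, hr0, h⟩ := ih
    have hd := ha.uCls_div hO hK.isClosed hKO hc₀ hne hell hr hr0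
    have hd0 : ∀ i x, x ∉ K → r i x * (a (e i) (x, ξ i))⁻¹ = 0 := fun i x hx => by simp [hr0 i x hx]
    have hj : -(((j + 1 : ℕ) : ℝ)) = -(j : ℝ) - 1 := by push_cast; ring
    refine ⟨fun i x => b i x - r i x * (a (e i) (x, ξ i))⁻¹, fun i y => -1 *
      (expand m (a (e i)) (ξ i) (fun x => r i x * (a (e i) (x, ξ i))⁻¹) y -
        a (e i) (y, ξ i) * (r i y * (a (e i) (y, ξ i))⁻¹)), hb.sub (hd.mono (by simp)), ?_,
      fun i x hx => by simp [hb0 i x hx, hr0 i x hx], fun i x hx => ?_, fun i y => ?_⟩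
    · rw [hj]
      exact (uCls_expand_sub ha hd m).const_mul (-1)
    · beta_reduce
      rw [expand_eq_zero hK.isClosed (hd0 i) m _ hx, hr0 i x hx]
      simp
    · have h1 : a (e i) (y, ξ i) * (r i y * (a (e i) (y, ξ i))⁻¹) = r i y := by
        by_cases hy : y ∈ K
        · have := hne i y (hKO hy)
          field_simp
        · simp [hr0 i y hy]
      beta_reduce
      rw [expand_sub (ha.contDiff _) (hb.contDiff i) (hd.contDiff i), h, h1]
      ring

/-- A microlocal parametrix for the transposed operator, up to order `m`. -/
theorem GlobalSymbols.exists_parametrix (ha : GlobalSymbols W a) {O K : Set (Rn n)} (hO : IsOpen O)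
    (hK : IsCompact K) (hKO : K ⊆ O) {c₀ : ℝ} {q : ℕ} (hc₀ : 0 ≤ c₀)
    (hne : ∀ i, ∀ x ∈ O, a (e i) (x, ξ i) ≠ 0)
    (hell : ∀ i, ∀ x ∈ O, ‖a (e i) (x, ξ i)‖⁻¹ ≤ c₀ * W (e i) ^ q) {φ : Rn n → ℂ}
    (hφ : ContDiff ℝ ∞ φ) (hφ0 : ∀ x, x ∉ K → φ x = 0) (m : ℕ) :
    ∃ b : Λ → Rn n → ℂ, UCls (symScale hW e ξ) 0 b ∧ (∀ i x, x ∉ K → b i x = 0) ∧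
      ∃ C : ℝ, ∃ p : ℕ, 0 ≤ C ∧ ∀ i y,
        ‖transOp (a (e i)) (ξ i) (b i) y - φ y‖ ≤ C * W (e i) ^ p * (jap (ξ i) ^ (m + 1))⁻¹ := by
  -- With m + 1 eliminations the error r reaches the order -(m+1) of the remainder of the expansion.
  obtain ⟨b, r, hb, hr, hb0, hr0, h⟩ := ha.exists_expand_eq (hW := hW) hO hK hKO hc₀ hne hell hφ hφ0 m (m + 1)
  refine ⟨b, hb, hb0, ?_⟩
  obtain ⟨C, p, hC, h1⟩ := ha.transOp_sub_expand_le hb hK hb0 m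
  obtain ⟨D, q, hD, h2⟩ := hr.exists_bound []
  refine ⟨C + D, p + q, by positivity, fun i y => ?_⟩
  have h3 := h1 i y
  have h4 := h2 i y
  have h5 : (0 : ℝ) - (m + 1) = -((m + 1 : ℕ) : ℝ) := by push_cast; ring
  rw [h5, ← inv_jap_pow_eq] at h3
  rw [← inv_jap_pow_eq] at h4
  simp only [dirD] at h4
  refine le_trans ?_ (Cls.pow_le_aux (hW (e i)) hC hD (inv_nonneg.2 (pow_nonneg (jap_pos _).le _)) p q)
  calc ‖transOp (a (e i)) (ξ i) (b i) y - φ y‖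
      = ‖(transOp (a (e i)) (ξ i) (b i) y - expand m (a (e i)) (ξ i) (b i) y) + r i y‖ := by
        rw [h i y]; ring_nf
    _ ≤ _ := (norm_add_le _ _).trans (add_le_add h3 h4)

/-- Multiplying the kernel by a cut-off near the diagonal changes the transposed operator by a
regularizing term. -/
theorem GlobalSymbols.transOp_cutoff_le (ha : GlobalSymbols W a) {O K : Set (Rn n)}
    (hK : IsCompact K) (hKO : K ⊆ O) {b : Λ → Rn n → ℂ} (hb : UCls (symScale hW e ξ) 0 b)
    (hb0 : ∀ i x, x ∉ K → b i x = 0) {χ : Rn n × Rn n → ℂ} (hχ : ContDiff ℝ ∞ χ)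
    (hχc : HasCompactSupport χ) (hχ1 : ∀ x ∈ O, ∀ y ∈ O, χ (x, y) = 1) (m : ℕ) :
    ∃ C : ℝ, ∃ p : ℕ, 0 ≤ C ∧ ∀ i y,
      ‖transOp (a (e i)) (ξ i) (fun x => χ (x, y) * b i x) y - transOp (a (e i)) (ξ i) (b i) y‖ ≤
        C * W (e i) ^ p * (jap (ξ i) ^ (m + 1))⁻¹ := by
  have hχU : UCls (paramScale (Rn n × Rn n) (fun i : Λ => W (e i)) (fun i => jap (ξ i)) (fun _ => hW _)
      (fun _ => one_le_jap _)) 0 (fun _ => χ) :=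
    UCls.of_hasCompactSupport rfl hχ hχc fun p hp => image_eq_zero_of_notMem_tsupport hp
  -- The point y is treated as a parameter of the cut-off amplitude, so that the remainder estimate
  -- is uniform in y and may then be evaluated at that same y.
  have h1 : UCls (symScale hW (fun q : Λ × Rn n => e q.1) (fun q => ξ q.1)) 0 (fun q x => χ (x, q.2)) :=
    hχU.slice_left (fun q : Λ × Rn n => q.1) (fun q => q.2)
  have h2 : UCls (symScale hW (fun q : Λ × Rn n => e q.1) (fun q => ξ q.1)) 0 (fun q => b q.1) :=
    fun N => (hb N).comp_param Prod.fst (fun _ => rfl) (fun _ _ => rfl) rfl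
  obtain ⟨C, p, hC, h3⟩ := ha.transOp_sub_expand_le (h1.mul h2) hK
    (fun q x hx => by simp [hb0 q.1 x hx]) m
  obtain ⟨D, q, hD, h4⟩ := ha.transOp_sub_expand_le hb hK hb0 m
  refine ⟨C + D, p + q, by positivity, fun i y => ?_⟩
  have hj : 0 ≤ (jap (ξ i) ^ (m + 1))⁻¹ := inv_nonneg.2 (pow_nonneg (jap_pos _).le _)
  have hW' := hW (e i)
  -- For y in O the cut-off equals 1 on the support of b and nothing changes. For other y both
  -- expansions vanish by locality, so each transposed function is separately of order -(m+1).
  by_cases hy : y ∈ O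
  · have h5 : (fun x => χ (x, y) * b i x) = b i := by
      funext x
      by_cases hx : x ∈ K
      · rw [hχ1 x (hKO hx) y hy, one_mul]
      · rw [hb0 i x hx, mul_zero]
    rw [h5, sub_self, norm_zero]
    positivity
  · have hyK : y ∉ K := fun h => hy (hKO h)
    have h5 := h3 (i, y) y
    have h6 := h4 i y
    rw [expand_eq_zero hK.isClosed (fun x hx => by simp [hb0 i x hx]) m _ hyK, sub_zero] at h5
    rw [expand_eq_zero hK.isClosed (hb0 i) m _ hyK, sub_zero] at h6
    have h7 : (0 : ℝ) - (m + 1) = -((m + 1 : ℕ) : ℝ) := by push_cast; ring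
    have h8 : (0 : ℝ) + 0 - (m + 1) = -((m + 1 : ℕ) : ℝ) := by push_cast; ring
    rw [h8, ← inv_jap_pow_eq] at h5
    rw [h7, ← inv_jap_pow_eq] at h6
    exact (norm_sub_le _ _).trans ((add_le_add h5 h6).trans (Cls.pow_le_aux hW' hC hD hj p q))

end Parametrix

/-! ### Small parameters -/

section SmallEps

/-- The filter of small values of `ε`. -/
def smallEps : Filter Eps := Filter.comap (fun ε : Eps => (ε : ℝ)) (𝓝 0)

theorem eventually_smallEps {P : Eps → Prop} :
    (∀ᶠ ε in smallEps, P ε) ↔ ∃ ε₀ : ℝ, 0 < ε₀ ∧ ∀ ε : Eps, (ε : ℝ) ≤ ε₀ → P ε := by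
  rw [smallEps, Filter.eventually_comap, Metric.eventually_nhds_iff]
  constructor
  · rintro ⟨δ, hδ, h⟩
    refine ⟨δ / 2, half_pos hδ, fun ε hε => h ?_ ε rfl⟩
    rw [Real.dist_0_eq_abs, abs_of_pos ε.2.1]
    linarith
  · rintro ⟨ε₀, h0, h⟩
    refine ⟨ε₀, h0, fun y hy ε hε => h ε ?_⟩
    rw [← hε, Real.dist_0_eq_abs, abs_of_pos ε.2.1] at hy
    exact hy.le

theorem bigOOn_iff {X : Type*} {S : Set X} {f : Eps → X → ℂ} {p : ℝ} :
    BigOOn S f p ↔ ∃ C : ℝ, ∀ᶠ ε in smallEps, ∀ x ∈ S, ‖f ε x‖ ≤ C * (ε : ℝ) ^ p := by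
  simp only [eventually_smallEps, BigOOn]

theorem eventually_le_smallEps {c : ℝ} (hc : 0 < c) : ∀ᶠ ε : Eps in smallEps, (ε : ℝ) ≤ c :=
  eventually_smallEps.2 ⟨c, hc, fun _ h => h⟩

instance : smallEps.NeBot := by
  refine Filter.comap_neBot fun s hs => ?_
  obtain ⟨δ, hδ, h⟩ := Metric.mem_nhds_iff.1 hs
  have hpos : 0 < min (δ / 2) 1 := lt_min (half_pos hδ) one_pos
  refine ⟨⟨min (δ / 2) 1, hpos, min_le_right _ _⟩, h ?_⟩
  rw [Metric.mem_ball, Real.dist_0_eq_abs, abs_of_pos hpos]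
  exact (min_le_left _ _).trans_lt (half_lt_self hδ)

theorem slowScale.exists_pow_le {w : Eps → ℝ} (hw : w ∈ slowScale) (p : ℕ) :
    ∃ c : ℝ, 0 < c ∧ ∀ ε : Eps, w ε ^ p ≤ c * (ε : ℝ)⁻¹ := by
  obtain ⟨c, hc, h⟩ := hw.2 p (Nat.cast_nonneg p)
  exact ⟨c, hc, fun ε => by simpa using h ε⟩

/-- The definition with exponent 2p gives (w^p ε)² ≤ cε, so w^p ε tends to 0 and is not merely
bounded. -/
theorem slowScale.eventually_pow_mul_le {w : Eps → ℝ} (hw : w ∈ slowScale) (p : ℕ) {η : ℝ} (hη : 0 < η) :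
    ∀ᶠ ε : Eps in smallEps, w ε ^ p * (ε : ℝ) ≤ η := by
  obtain ⟨c, hc, h⟩ := slowScale.exists_pow_le hw (2 * p)
  filter_upwards [eventually_le_smallEps (div_pos (pow_pos hη 2) hc)] with ε hε
  refine abs_le_of_sq_le_sq' ?_ hη.le |>.2
  have h0 : (0 : ℝ) < ε := ε.2.1
  have h1 := h ε
  rw [mul_comm 2 p, pow_mul] at h1
  rw [le_div_iff₀ hc] at hε
  calc (w ε ^ p * (ε : ℝ)) ^ 2 = (w ε ^ p) ^ 2 * (ε : ℝ) ^ 2 := by ring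
    _ ≤ (c * (ε : ℝ)⁻¹) * (ε : ℝ) ^ 2 := by gcongr
    _ = ε * c := by field_simp
    _ ≤ η ^ 2 := hε

end SmallEps

/-! ### Cut-off functions -/

section Cutoff

variable {n : ℕ}

theorem exists_cutoff {K O : Set (Rn n)} (hK : IsCompact K) (hO : IsOpen O) (hKO : K ⊆ O) :
    ∃ κ : Rn n → ℂ, ContDiff ℝ ∞ κ ∧ HasCompactSupport κ ∧ tsupport κ ⊆ O ∧
      ∃ U : Set (Rn n), IsOpen U ∧ K ⊆ U ∧ ∀ x ∈ U, κ x = 1 := by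
  obtain ⟨K₁, hK₁, h1, h2⟩ := exists_compact_between hK hO hKO
  obtain ⟨f, hf1, hf0, -⟩ := exists_contMDiffMap_one_nhds_of_subset_interior
    (n := ⊤) (modelWithCornersSelf ℝ (Rn n)) hK.isClosed h1
  have hs : Function.support (fun x => ((f x : ℝ) : ℂ)) ⊆ K₁ := by
    intro x hx
    by_contra h
    exact hx (by simp [hf0 x h])
  have hts : tsupport (fun x => ((f x : ℝ) : ℂ)) ⊆ K₁ := closure_minimal hs hK₁.isClosed
  refine ⟨fun x => ((f x : ℝ) : ℂ), Complex.ofRealCLM.contDiff.comp f.contMDiff.contDiff,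
    hK₁.of_isClosed_subset (isClosed_tsupport _) hts, hts.trans h2, ?_⟩
  obtain ⟨U, hU, hKU, h⟩ := (mem_nhdsSet_iff_exists (s := {x | f x = 1})).1 hf1
  exact ⟨U, hU, hKU, fun x hx => by
    have : f x = 1 := h hx
    simp [this]⟩

theorem notMem_tsupport {V : Type*} [TopologicalSpace V] {f : V → ℂ} {x : V} (h : x ∉ tsupport f) :
    f x = 0 :=
  image_eq_zero_of_notMem_tsupport h

end Cutoff

/-! ### Symbols cut off in the space variable -/

section CutoffSymbols

variable {n : ℕ}

theorem symD_fst_mul {g : Rn n × Rn n → ℂ} (hg : ContDiff ℝ ∞ g) {κ : Rn n → ℂ}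
    (hκ : ContDiff ℝ ∞ κ) (α : List (Rn n)) (p : Rn n × Rn n) :
    symD α [] (fun p => κ p.1 * g p) p = κ p.1 * symD α [] g p := by
  have h1 : ContDiff ℝ ∞ fun p : Rn n × Rn n => κ p.1 * g p := (hκ.comp contDiff_fst).mul hg
  have h2 := congrFun (dirD_slice_right h1 p.1 α) p.2
  have h3 := congrFun (dirD_slice_right hg p.1 α) p.2
  have h4 : ContDiff ℝ ∞ fun y => g (p.1, y) := hg.comp (contDiff_const.prodMk contDiff_id)
  simp only [symD, List.map_nil, List.append_nil]
  simp only at h2 h3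
  rw [← h2, ← h3]
  exact dirD_const_mul isOpen_univ h4.contDiffOn (κ p.1) α (mem_univ p.2)

theorem GlobalSymbols.mono {E : Type*} {W W' : E → ℝ} {a : E → Rn n × Rn n → ℂ}
    (h : GlobalSymbols W a) (hW : ∀ ε, W ε ≤ W' ε) : GlobalSymbols W' a := by
  refine ⟨h.contDiff, fun α β => ?_⟩
  obtain ⟨C, hC, H⟩ := h.bound α β
  refine ⟨C, hC, fun ε p => (H ε p).trans ?_⟩
  have := jap_pos p.2
  have := hW ε
  gcongr

/-- A cut-off in x turns a net of symbols on Ω × ℝⁿ into global symbols, governed by the single slow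
scale net that belongs to the compact support of κ. -/
theorem slowScaleSymbols.exists_globalSymbols {Ω : Opens (Rn n)} {a : Eps → Rn n × Rn n → ℂ}
    (ha : a ∈ slowScaleSymbols Ω 0) {κ : Rn n → ℂ} (hκ : ContDiff ℝ ∞ κ) (hκc : HasCompactSupport κ)
    (hκΩ : tsupport κ ⊆ Ω) :
    ∃ W ∈ slowScale, (∀ ε, 1 ≤ W ε) ∧ GlobalSymbols W (fun ε p => κ p.1 * a ε p) := by
  obtain ⟨w, hw, hb⟩ := ha.2 (tsupport κ) hκc hκΩ
  obtain ⟨κ', hκ', hκ'c, hκ'Ω, U, hU, hKU, hκ'1⟩ := exists_cutoff hκc Ω.isOpen hκΩ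
  have hphase : ∀ x ∈ Ω, ∀ ξ : Rn n, (x, ξ) ∈ phaseSpace Ω := fun x hx ξ => mk_mem_prod hx trivial
  -- Since κ' = 1 near the support of κ, the globally smooth a' may replace a without changing κa.
  set a' : Eps → Rn n × Rn n → ℂ := fun ε p => κ' p.1 * a ε p with ha'
  have ha's : ∀ ε, ContDiff ℝ ∞ (a' ε) := fun ε => by
    refine contDiff_of_contDiffOn_of_compact (phaseSpace Ω).isOpen
      ((isClosed_tsupport κ').preimage continuous_fst) (fun p hp => hphase p.1 (hκ'Ω hp) p.2)
      ((hκ'.comp contDiff_fst).contDiffOn.mul (ha.1 ε)) fun p hp => ?_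
    simp [ha', notMem_tsupport (show p.1 ∉ tsupport κ' from hp)]
  have hsym : ∀ α β ε, ∀ x ∈ tsupport κ, ∀ ξ, symD α β (a' ε) (x, ξ) = symD α β (a ε) (x, ξ) := by
    intro α β ε x hx ξ
    refine dirD_congr (O := U ×ˢ univ) (hU.prod isOpen_univ) (fun p hp => ?_) _ (mk_mem_prod (hKU hx) trivial)
    simp [ha', hκ'1 p.1 hp.1]
  have hmul : (fun ε p => κ p.1 * a ε p) = fun ε p => κ p.1 * a' ε p := by
    funext ε p
    by_cases hp : p.1 ∈ tsupport κ
    · simp [ha', hκ'1 p.1 (hKU hp)]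
    · simp [notMem_tsupport hp]
  set W : Eps → ℝ := fun ε => max 1 (w ε) with hWdef
  have hW1 : ∀ ε, 1 ≤ W ε := fun ε => le_max_left _ _
  refine ⟨W, max_mem_slowScale one_mem_slowScale hw, hW1, ?_⟩
  rw [hmul]
  refine ⟨fun ε => (hκ.comp contDiff_fst).mul (ha's ε), fun α β => ?_⟩
  set 𝒮 : Scale (Eps × Rn n) (Rn n) := paramScale (Rn n) (fun _ => 1) (fun q => jap q.2)
    (fun _ => le_rfl) (fun _ => one_le_jap _) with h𝒮
  have hslice : ∀ q : Eps × Rn n, ContDiff ℝ ∞ fun x => symD α [] (a' q.1) (x, q.2) := fun q =>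
    contDiff_symD_slice (ha's q.1) α [] q.2
  -- Dividing by W makes the family bounded with trivial weight; W is restored at the end to the
  -- first power, as `GlobalSymbols` requires.
  have hg : ∀ N, Cls 𝒮 univ (tsupport κ) N (-(α.length : ℝ))
      (fun q x => ((W q.1 : ℝ) : ℂ)⁻¹ * symD α [] (a' q.1) (x, q.2)) := by
    refine Cls.of_bounds (fun q => (contDiff_const.mul (hslice q)).contDiffOn) fun l => ?_
    obtain ⟨c, hc, h⟩ := hb α l
    refine ⟨c, 0, fun q x hx => ?_⟩
    have h1 := h q.1 x hx q.2
    rw [dirD_const_mul isOpen_univ (hslice q).contDiffOn _ l (mem_univ x), symD_append (ha's q.1)]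
    beta_reduce
    rw [hsym α l q.1 x hx, norm_mul, norm_inv, Complex.norm_real,
      Real.norm_of_nonneg (zero_le_one.trans (hW1 _)), inv_mul_le_iff₀ (zero_lt_one.trans_le (hW1 _))]
    simp only [h𝒮, paramScale, zero_mul, sub_zero, one_pow, mul_one]
    rw [neg_zero, zero_add, Real.rpow_natCast] at h1
    rw [← inv_jap_pow_eq, ← mul_assoc, ← div_eq_mul_inv, le_div_iff₀ (pow_pos (jap_pos _) _), mul_comm]
    refine h1.trans ?_
    rw [mul_comm]
    gcongr
    exact le_max_right _ _
  have hκU : ∀ N, Cls 𝒮 univ (tsupport κ) N 0 (fun _ => κ) := fun N =>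
    (Cls.of_hasCompactSupport rfl hκ hκc (fun x hx => notMem_tsupport hx) N).restrict
      subset_rfl (subset_univ _)
  obtain ⟨C, p, hC, h⟩ := ((hκU β.length).mul isOpen_univ (subset_univ _) (hg β.length)).2 β le_rfl
  refine ⟨C, hC, fun ε p => ?_⟩
  have hW0 : 0 < W ε := zero_lt_one.trans_le (hW1 ε)
  have hjp := jap_pos p.2
  have h2 := congrFun (symD_append ((hκ.comp contDiff_fst).mul (ha's ε)) α β p.2) p.1
  have h3 : (fun x => symD α [] (fun p => κ p.1 * a' ε p) (x, p.2)) =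
      fun x => ((W ε : ℝ) : ℂ) * (κ x * (((W ε : ℝ) : ℂ)⁻¹ * symD α [] (a' ε) (x, p.2))) := by
    funext x
    have : ((W ε : ℝ) : ℂ) ≠ 0 := by exact_mod_cast hW0.ne'
    rw [symD_fst_mul (ha's ε) hκ]
    field_simp
  have h2' : symD α β (fun p => κ p.1 * a' ε p) p =
      dirD β (fun x => symD α [] (fun p => κ p.1 * a' ε p) (x, p.2)) p.1 := h2.symm
  rw [h2', h3]
  have h4 : ContDiff ℝ ∞ fun x => κ x * (((W ε : ℝ) : ℂ)⁻¹ * symD α [] (a' ε) (x, p.2)) :=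
    hκ.mul (contDiff_const.mul (hslice (ε, p.2)))
  rw [dirD_const_mul isOpen_univ h4.contDiffOn _ β (mem_univ _), norm_mul, Complex.norm_real,
    Real.norm_of_nonneg hW0.le]
  by_cases hp : p.1 ∈ tsupport κ
  · have h5 := h (ε, p.2) p.1 hp
    simp only [h𝒮, paramScale, zero_mul, sub_zero, one_pow, mul_one, zero_add] at h5
    rw [← inv_jap_pow_eq] at h5
    calc _ ≤ W ε * (C * (jap p.2 ^ α.length)⁻¹) := by gcongr
      _ = _ := by ring
  · rw [dirD_eq_zero_of_notMem (isClosed_tsupport κ) (fun x hx => by simp [notMem_tsupport hx]) _ hp]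
    simp only [norm_zero, mul_zero]
    positivity

/-- The net `a` is slow scale micro-elliptic for small `ε`, and `κ` is a cut-off near `U`. -/
structure EllipticAt (Ω : Opens (Rn n)) (a : Eps → Rn n × Rn n → ℂ) (x₀ ξ₀ : Rn n) (κ : Rn n → ℂ)
    (U Γ : Set (Rn n)) (W : Eps → ℝ) (ε₁ : ℝ) : Prop where
  contDiff : ContDiff ℝ ∞ κ
  compact : HasCompactSupport κ
  tsupport_subset : tsupport κ ⊆ Ω
  eq_one : ∀ x ∈ U, κ x = 1
  isOpen : IsOpen U
  mem : x₀ ∈ U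
  subset : U ⊆ Ω
  conic : IsConicNhd Γ ξ₀
  slow : W ∈ slowScale
  one_le : ∀ ε, 1 ≤ W ε
  pos : 0 < ε₁
  symbols : GlobalSymbols W (fun ε p => κ p.1 * a ε p)
  elliptic : ∀ ε : Eps, (ε : ℝ) ≤ ε₁ → ∀ x ∈ U, ∀ ξ ∈ Γ, W ε ≤ ‖ξ‖ → 1 ≤ 2 * W ε * ‖a ε (x, ξ)‖

theorem isSymRep_sub {Ω : Opens (Rn n)} {m : ℝ} {A : Symbol Ω m} {a b : Eps → Rn n × Rn n → ℂ}
    (ha : IsSymRep a A) (hb : IsSymRep b A) {K : Set (Rn n)} (hK : IsCompact K) (hKΩ : K ⊆ Ω)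
    (α β : List (Rn n)) (q : ℕ) :
    ∃ c > 0, ∀ ε : Eps, SeminormLE m K α β (a ε - b ε) (c * (ε : ℝ) ^ q) := by
  obtain ⟨ha, hA⟩ := ha
  obtain ⟨hb, hB⟩ := hb
  have h := (Submodule.Quotient.eq (negligibleSymbols Ω m)).1 (hA.trans hB.symm)
  exact h K hK hKΩ α β q

/-- Ellipticity is witnessed by some representative a₁, but is needed for the one that defines the
operator value. The two differ by O(ε²) while s_ε is O(ε⁻¹), so for small ε at least half of the
lower bound survives. One net, the maximum of W, r and s, then plays all three roles. -/
theorem exists_ellipticAt {Ω : Opens (Rn n)} {A : Symbol Ω 0} {p : Rn n × Rn n} (hp : p ∈ Ell A)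
    {a : Eps → Rn n × Rn n → ℂ} (ha : IsSymRep a A) :
    ∃ κ U Γ W ε₁, EllipticAt Ω a p.1 p.2 κ U Γ W ε₁ := by
  obtain ⟨-, a₁, ha₁, U, Γ, hU, hpU, hUc, hUΩ, hΓ, r, hr, s, hs, h⟩ := hp
  obtain ⟨κ, hκ, hκc, hκΩ, U', hU', hUU', hκ1⟩ := exists_cutoff hUc Ω.isOpen hUΩ
  obtain ⟨W, hW, hW1, hG⟩ := slowScaleSymbols.exists_globalSymbols ha.1 hκ hκc hκΩ
  obtain ⟨c, hc, hn⟩ := isSymRep_sub ha₁ ha hUc hUΩ [] [] 2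
  obtain ⟨d, hd, hs'⟩ := slowScale.exists_pow_le hs 1
  obtain ⟨s₀, hs₀, hsl⟩ := hs.1
  -- For ε ≤ 1/(2cd) one has cε²s_ε = cε·(s_ε ε) ≤ cdε ≤ 1/2, which yields the factor 2 in the
  -- elliptic estimate.
  refine ⟨κ, U, Γ, fun ε => max (W ε) (max r s ε), 1 / (2 * c * d), hκ, hκc, hκΩ,
    fun x hx => hκ1 x (hUU' (subset_closure hx)), hU, hpU, subset_closure.trans hUΩ, hΓ,
    max_mem_slowScale hW (max_mem_slowScale hr hs), fun ε => (hW1 ε).trans (le_max_left _ _),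
    by positivity, hG.mono fun ε => le_max_left _ _, fun ε hε x hx ξ hξ hWξ => ?_⟩
  simp only [Pi.sup_apply] at hWξ ⊢
  have hε0 : (0 : ℝ) < ε := ε.2.1
  have hsε : 0 < s ε := hs₀.trans_le (hsl ε)
  have h1 := h x hx ξ hξ ε (((le_max_left _ _).trans (le_max_right _ _)).trans hWξ)
  have h2 := hn ε x (subset_closure hx) ξ
  have h3 := hs' ε
  simp only [symD, List.map_nil, List.append_nil, dirD, List.length_nil, Nat.cast_zero, neg_zero,
    add_zero, Real.rpow_zero, one_mul, mul_one, pow_one, Pi.sub_apply] at h1 h2 h3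
  have h4 : ‖a₁ ε (x, ξ)‖ ≤ ‖a ε (x, ξ)‖ + c * (ε : ℝ) ^ 2 := by
    calc ‖a₁ ε (x, ξ)‖ = ‖a ε (x, ξ) + (a₁ ε (x, ξ) - a ε (x, ξ))‖ := by congr 1; ring
      _ ≤ _ := (norm_add_le _ _).trans (by gcongr)
  rw [div_le_iff₀ hsε] at h1
  rw [le_div_iff₀ (by positivity)] at hε
  have h5 : s ε * ε ≤ d := by
    calc s ε * ε ≤ (d * (ε : ℝ)⁻¹) * ε := by gcongr
      _ = d := by field_simp
  have h6 : c * (ε : ℝ) ^ 2 * s ε ≤ 1 / 2 := by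
    calc c * (ε : ℝ) ^ 2 * s ε = c * ε * (s ε * ε) := by ring
      _ ≤ c * ε * d := by gcongr
      _ ≤ 1 / 2 := by linarith
  have h7 : 1 ≤ 2 * s ε * ‖a ε (x, ξ)‖ := by
    have := mul_le_mul_of_nonneg_right h4 hsε.le
    linarith
  refine h7.trans ?_
  gcongr
  exact (le_max_right _ _).trans (le_max_right _ _)

end CutoffSymbols

/-! ### Micro-elliptic points lie in the support of the kernel -/

section KernelSupport

variable {n : ℕ}

theorem fourierHat_zero {f : Rn n → ℂ} (hf : ∀ y, f y = 0) (ξ : Rn n) : fourierHat f ξ = 0 := by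
  simp [fourierHat_eq, hf]

theorem pseudo_zero {a : Rn n × Rn n → ℂ} {f : Rn n → ℂ} (hf : ∀ y, f y = 0) (x : Rn n) :
    pseudo a f x = 0 := by
  simp [pseudo_eq, fourierHat_zero hf]

theorem pseudo_congr {a b : Rn n × Rn n → ℂ} {f g : Rn n → ℂ} {x : Rn n}
    (hab : ∀ ξ, a (x, ξ) = b (x, ξ)) (hfg : ∀ y, f y = g y) : pseudo a f x = pseudo b g x := by
  rw [funext hfg]
  simp [pseudo_eq, hab]

theorem pseudo_const_mul (a : Rn n × Rn n → ℂ) (f : Rn n → ℂ) (z : ℂ) (x : Rn n) :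
    pseudo a (fun y => z * f y) x = z * pseudo a f x := by
  simp only [pseudo_eq, fourierHat_const_mul]
  rw [mul_left_comm z, ← integral_const_mul z]
  congr 2
  funext ξ
  ring

theorem UCls.comp_clm {Λ V V' : Type*} [NormedAddCommGroup V] [NormedSpace ℝ V]
    [NormedAddCommGroup V'] [NormedSpace ℝ V'] {W j : Λ → ℝ} {hW : ∀ i, 1 ≤ W i}
    {hj : ∀ i, 1 ≤ j i} {m : ℝ} {g : Λ → V' → ℂ} (hg : UCls (paramScale V' W j hW hj) m g)
    (L : V →L[ℝ] V') : UCls (paramScale V W j hW hj) m (fun i x => g i (L x)) := by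
  refine UCls.of_exists_bound (fun i => (hg.contDiff i).comp L.contDiff) fun l => ?_
  obtain ⟨C, p, -, h⟩ := hg.exists_bound (l.map L)
  refine ⟨C, p, fun i x => ?_⟩
  have := dirD_comp_affine (hg.contDiff i) L 0 l
  simp only [zero_add] at this
  rw [this]
  exact h _ _

theorem norm_prod_inner_le (ξ : Rn n) (l : List (Rn n)) :
    ‖(l.map fun v => Complex.I * ((inner ℝ v ξ : ℝ) : ℂ)).prod‖ ≤ (l.map norm).prod * ‖ξ‖ ^ l.length := by
  induction l with
  | nil => simp
  | cons v l ih =>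
    simp only [List.map_cons, List.prod_cons, norm_mul, Complex.norm_I, one_mul, Complex.norm_real,
      List.length_cons]
    have h0 : 0 ≤ (l.map norm).prod := List.prod_nonneg fun a ha => by
      obtain ⟨v, -, rfl⟩ := List.mem_map.1 ha
      exact norm_nonneg v
    calc _ ≤ (‖v‖ * ‖ξ‖) * ((l.map norm).prod * ‖ξ‖ ^ l.length) :=
          mul_le_mul (norm_inner_le_norm v ξ) ih (norm_nonneg _) (by positivity)
      _ = _ := by ring

theorem uCls_wave {Λ : Type*} {W j : Λ → ℝ} {hW : ∀ i, 1 ≤ W i} {hj : ∀ i, 1 ≤ j i}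
    {ξ : Λ → Rn n} (hξ : ∀ i, ‖ξ i‖ ≤ W i) :
    UCls (paramScale (Rn n) W j hW hj) 0 (fun i x => wave x (ξ i)) := by
  refine UCls.of_exists_bound (fun i => contDiff_wave_comp contDiff_id contDiff_const) fun l => ?_
  have h0 : 0 ≤ (l.map norm).prod := List.prod_nonneg fun a ha => by
    obtain ⟨v, -, rfl⟩ := List.mem_map.1 ha
    exact norm_nonneg v
  refine ⟨(l.map norm).prod, l.length, fun i x => ?_⟩
  rw [dirD_wave_left, norm_mul, norm_wave, mul_one, Real.rpow_zero, mul_one]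
  refine (norm_prod_inner_le (ξ i) l).trans ?_
  gcongr
  exact hξ i

theorem IsConicNhd.ne_zero {Γ : Set (Rn n)} {ξ₀ : Rn n} (h : IsConicNhd Γ ξ₀) : ξ₀ ≠ 0 :=
  fun h0 => h.2.2.1 (h0 ▸ h.2.1)

section

variable {Ω : Opens (Rn n)} {a : Eps → Rn n × Rn n → ℂ} {x₀ ξ₀ : Rn n} {κ : Rn n → ℂ}
  {U Γ : Set (Rn n)} {W : Eps → ℝ} {ε₁ : ℝ}

theorem EllipticAt.exists_parametrix (h : EllipticAt Ω a x₀ ξ₀ κ U Γ W ε₁) {Λ : Type*} {e : Λ → Eps}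
    {ξ : Λ → Rn n} (he : ∀ i, (e i : ℝ) ≤ ε₁) (hΓ : ∀ i, ξ i ∈ Γ) (hξ : ∀ i, W (e i) ≤ ‖ξ i‖)
    {K : Set (Rn n)} (hK : IsCompact K) (hKU : K ⊆ U) {φ : Rn n → ℂ} (hφ : ContDiff ℝ ∞ φ)
    (hφ0 : ∀ x, x ∉ K → φ x = 0) (m : ℕ) :
    ∃ b : Λ → Rn n → ℂ, UCls (symScale h.one_le e ξ) 0 b ∧ (∀ i x, x ∉ K → b i x = 0) ∧
      ∃ C : ℝ, ∃ p : ℕ, 0 ≤ C ∧ ∀ i y,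
        ‖transOp (fun p => κ p.1 * a (e i) p) (ξ i) (b i) y - φ y‖ ≤
          C * W (e i) ^ p * (jap (ξ i) ^ (m + 1))⁻¹ := by
  have hel : ∀ i, ∀ x ∈ U, 1 ≤ 2 * W (e i) * ‖κ x * a (e i) (x, ξ i)‖ := fun i x hx => by
    rw [h.eq_one x hx, one_mul]
    exact h.elliptic _ (he i) x hx _ (hΓ i) (hξ i)
  have hne : ∀ i, ∀ x ∈ U, κ x * a (e i) (x, ξ i) ≠ 0 := fun i x hx h0 => by
    have := hel i x hx
    rw [h0, norm_zero, mul_zero] at this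
    linarith
  refine h.symbols.exists_parametrix (hW := h.one_le) h.isOpen hK hKU (c₀ := 2) (q := 1)
    zero_le_two hne (fun i x hx => ?_) hφ hφ0 m
  rw [pow_one, inv_le_iff_one_le_mul₀ (norm_pos_iff.2 (hne i x hx))]
  exact hel i x hx

theorem one_le_inv_eps (ε : Eps) : 1 ≤ ((ε : ℝ))⁻¹ := (one_le_inv₀ ε.2.1).2 ε.2.2

/-- A proper cut-off equals 1 only near the support of the kernel, so this places x₀ where the
cut-off is harmless. The kernel is tested on e^{-ixξ_ε} b(x) φ(y) e^{iyξ_ε}, where ξ_ε has the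
direction of ξ₀ and length ε⁻¹, and b is a parametrix for φ. Transposition gives the value ∫φ² +
O(W_ε^p ε), which is not negligible. -/
theorem EllipticAt.mem_kernelSupport (h : EllipticAt Ω a x₀ ξ₀ κ U Γ W ε₁) {A : Symbol Ω 0}
    (ha : IsSymRep a A) : (x₀, x₀) ∈ kernelSupport A := by
  have hx₀ : x₀ ∈ Ω := h.subset h.mem
  refine ⟨mk_mem_prod hx₀ hx₀, fun V hV hVΩ => ?_⟩
  obtain ⟨u₁, hu₁, u₂, hu₂, huV⟩ := mem_nhds_prod_iff.1 (V.isOpen.mem_nhds hV)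
  obtain ⟨f, hfs, hfc, hf, hfr, hf1⟩ := exists_contDiff_tsupport_subset (n := ⊤)
    (Filter.inter_mem (Filter.inter_mem hu₁ hu₂) (h.isOpen.mem_nhds h.mem))
  set K : Set (Rn n) := tsupport f with hKdef
  have hK : IsCompact K := hfc
  have hKU : K ⊆ U := fun x hx => (hfs hx).2
  have hKV : K ×ˢ K ⊆ V := fun p hp => huV ⟨(hfs hp.1).1.1, (hfs hp.2).1.2⟩
  set φ : Rn n → ℂ := fun x => ((f x : ℝ) : ℂ) with hφdef
  have hφ : ContDiff ℝ ∞ φ := Complex.ofRealCLM.contDiff.comp hf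
  have hf0 : ∀ x, x ∉ K → f x = 0 := fun x hx => image_eq_zero_of_notMem_tsupport hx
  have hφ0 : ∀ x, x ∉ K → φ x = 0 := fun x hx => by simp [hφdef, hf0 x hx]
  have hφ1 : ∀ x, ‖φ x‖ ≤ 1 := fun x => by
    have := hfr (mem_range_self x)
    rw [hφdef, Complex.norm_real, Real.norm_of_nonneg this.1]
    exact this.2
  have hξ₀ := h.conic.ne_zero
  have hnξ₀ : 0 < ‖ξ₀‖ := norm_pos_iff.2 hξ₀
  set ξ : Eps → Rn n := fun ε => ((ε : ℝ)⁻¹ * ‖ξ₀‖⁻¹) • ξ₀ with hξ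
  have hξn : ∀ ε, ‖ξ ε‖ = (ε : ℝ)⁻¹ := fun ε => by
    have : (0 : ℝ) < ε := ε.2.1
    rw [hξ, norm_smul, Real.norm_of_nonneg (by positivity), mul_assoc, inv_mul_cancel₀ hnξ₀.ne', mul_one]
  have hξΓ : ∀ ε, ξ ε ∈ Γ := fun ε => by
    have : (0 : ℝ) < ε := ε.2.1
    exact h.conic.2.2.2 _ (by positivity) _ h.conic.2.1
  -- For ε ≤ ε₂ one has W_ε ≤ ε⁻¹ = |ξ_ε|, so ξ_ε is in the elliptic range. For larger ε the test
  -- net is set to 0.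
  obtain ⟨ε₂, hε₂, hsm⟩ := eventually_smallEps.1 ((slowScale.eventually_pow_mul_le h.slow 1 one_pos).and
    (eventually_le_smallEps h.pos))
  set e : {ε : Eps // (ε : ℝ) ≤ ε₂} → Eps := Subtype.val with he
  -- Order 0 suffices: the error W^p⟨ξ_ε⟩⁻¹ is at most W^p ε.
  obtain ⟨b, hb, hb0, C, p, hC, hT⟩ := h.exists_parametrix (e := e) (ξ := fun i => ξ (e i))
    (fun i => (hsm i.1 i.2).2) (fun i => hξΓ _) (fun i => by
      have h1 := (hsm i.1 i.2).1
      have h2 : (0 : ℝ) < i.1 := i.1.2.1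
      rw [hξn, ← one_div, le_div_iff₀ h2]
      simpa using h1) hK hKU hφ hφ0 0
  set v : Eps → Rn n × Rn n → ℂ := fun ε => if hε : (ε : ℝ) ≤ ε₂ then fun q =>
    wave (-q.1) (ξ ε) * (b ⟨ε, hε⟩ q.1 * (φ q.2 * wave q.2 (ξ ε))) else 0 with hv
  refine ⟨a, v, ha, ⟨⟨fun ε => ?_, fun K' hK' hK'V l => ?_⟩, K ×ˢ K, hK.prod hK, hKV, fun ε q hq => ?_⟩,
    fun hneg => ?_⟩
  rotate_left 2
  · by_cases hε : (ε : ℝ) ≤ ε₂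
    · simp only [hv, hε, dif_pos]
      by_cases h1 : q.1 ∈ K
      · rw [hφ0 q.2 fun h2 => hq ⟨h1, h2⟩]
        simp
      · rw [hb0 _ _ h1]
        simp
    · simp [hv, hε]
  · -- the kernel is not negligible
    obtain ⟨c', ε₃, hε₃, hk⟩ := hneg 1
    set I : ℝ := ∫ y, f y * f y with hI
    have hIpos : 0 < I := by
      refine Continuous.integral_pos_of_hasCompactSupport_nonneg_nonzero (x := x₀)
        (hf.continuous.mul hf.continuous) (hfc.mul_right) (fun x => mul_self_nonneg _) ?_
      rw [hf1]; norm_num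
    set D : ℝ := C * volume.real K with hD
    have hD0 : 0 ≤ D := by positivity
    have hmain : ∀ ε : Eps, (ε : ℝ) ≤ ε₂ → I ≤ ‖kernel Ω a v ε‖ + D * (W ε ^ p * ε) := by
      intro ε hε
      have hεpos : (0 : ℝ) < ε := ε.2.1
      have hbs : ContDiff ℝ ∞ (b ⟨ε, hε⟩) := hb.contDiff _
      have h1 : kernel Ω a v ε = ∫ x, pseudo (fun q => κ q.1 * a ε q)
          (fun y => wave (-x) (ξ ε) * (b ⟨ε, hε⟩ x * (φ y * wave y (ξ ε)))) x := by
        rw [kernel, setIntegral_eq_integral_of_forall_compl_eq_zero]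
        · congr 1
          funext x
          by_cases hx : x ∈ K
          · refine pseudo_congr (fun η => ?_) fun y => ?_
            · simp [h.eq_one x (hKU hx)]
            · simp [hv, hε]
          · rw [pseudo_zero, pseudo_zero]
            · intro y; simp [hb0 _ _ hx]
            · intro y; simp [hv, hε, hb0 _ _ hx]
        · intro x hx
          refine pseudo_zero (fun y => ?_) x
          have : x ∉ K := fun hxK => hx (h.subset (hKU hxK))
          simp [hv, hε, hb0 _ _ this]
      have hsv : ContDiff ℝ ∞ fun q : Rn n × Rn n => b ⟨ε, hε⟩ q.1 * (φ q.2 * wave q.2 (ξ ε)) :=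
        (hbs.comp contDiff_fst).mul ((hφ.comp contDiff_snd).mul (contDiff_wave_comp contDiff_snd contDiff_const))
      have hbd : ∀ β : List (Rn n), ∃ C : ℝ, ∀ q, ‖symD [] β (fun q => κ q.1 * a ε q) q‖ ≤ C := fun β => by
        obtain ⟨C, -, H⟩ := h.symbols.bound [] β
        exact ⟨C * W ε, fun q => by simpa using H ε q⟩
      have h2 := (integral_pseudo_eq_transOp (h.symbols.contDiff ε) hbd hsv hK hK
        (fun x y hx => by simp [hb0 _ _ hx]) (fun x y hy => by simp [hφ0 _ hy]) (ξ ε))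
      rw [h1, h2.1]
      have h3 : ∀ y, wave (-y) (ξ ε) * transOp (fun q => κ q.1 * a ε q) (ξ ε)
          (fun x => b ⟨ε, hε⟩ x * (φ y * wave y (ξ ε))) y =
          φ y * transOp (fun q => κ q.1 * a ε q) (ξ ε) (b ⟨ε, hε⟩) y := by
        intro y
        have : (fun x => b ⟨ε, hε⟩ x * (φ y * wave y (ξ ε))) =
          fun x => (φ y * wave y (ξ ε)) * b ⟨ε, hε⟩ x := funext fun x => mul_comm _ _
        rw [this, transOp_const_mul]
        linear_combination (φ y * transOp (fun q => κ q.1 * a ε q) (ξ ε) (b ⟨ε, hε⟩) y) *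
          wave_neg_mul_wave y (ξ ε)
      have h2' := h2.2
      simp only [h3] at h2' ⊢
      have h4 : ((I : ℝ) : ℂ) = ∫ y, φ y * φ y := by
        rw [hI, ← integral_complex_ofReal]
        simp [hφdef]
      have hiφ : Integrable fun y => φ y * φ y :=
        integrable_of_compact (hφ.continuous.mul hφ.continuous) hK fun x hx => by simp [hφ0 x hx]
      have h5 : ‖∫ y, (φ y * transOp (fun q => κ q.1 * a ε q) (ξ ε) (b ⟨ε, hε⟩) y - φ y * φ y)‖ ≤
          C * W ε ^ p * (jap (ξ ε) ^ (0 + 1))⁻¹ * volume.real K := by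
        refine norm_integral_le_of_compact hK (fun x hx => by simp [hφ0 x hx]) fun x _ => ?_
        rw [← mul_sub, norm_mul]
        have := hT ⟨ε, hε⟩ x
        calc _ ≤ 1 * _ := mul_le_mul (hφ1 x) this (norm_nonneg _) zero_le_one
          _ = _ := one_mul _
      rw [integral_sub h2' hiφ, ← h4] at h5
      have h6 : (jap (ξ ε) ^ (0 + 1))⁻¹ ≤ ε := by
        rw [zero_add, pow_one, inv_le_comm₀ (jap_pos _) hεpos, ← hξn]
        exact norm_le_jap _
      have h7 : I = ‖((I : ℝ) : ℂ)‖ := by rw [Complex.norm_real, Real.norm_of_nonneg hIpos.le]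
      rw [h7]
      refine (norm_le_norm_add_norm_sub' _ (∫ y, φ y * transOp (fun q => κ q.1 * a ε q) (ξ ε) (b ⟨ε, hε⟩) y)).trans ?_
      rw [norm_sub_rev]
      refine add_le_add le_rfl (h5.trans ?_)
      have hW0 : 0 ≤ W ε := zero_le_one.trans (h.one_le ε)
      calc _ ≤ C * W ε ^ p * ε * volume.real K := by gcongr
        _ = _ := by rw [hD]; ring
    -- Both the parametrix error and the supposed bound c'ε of the kernel become at most I/4,
    -- contradicting I > 0.
    have hev1 := slowScale.eventually_pow_mul_le h.slow p (η := I / (4 * (D + 1))) (by positivity)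
    have hev2 := eventually_le_smallEps (c := I / (4 * (|c'| + 1))) (by positivity)
    obtain ⟨ε, h1, h2, h3, h4⟩ := (((hev1.and (hev2.and ((eventually_le_smallEps hε₂).and
      (eventually_le_smallEps hε₃))))).exists)
    have h5 := hmain ε h3
    have h6 := hk ε h4
    rw [Real.rpow_one] at h6
    have hεpos : (0 : ℝ) < ε := ε.2.1
    have h7 : c' * ε ≤ I / 4 := by
      calc c' * ε ≤ (|c'| + 1) * ε := by gcongr; exact (le_abs_self c').trans (by linarith)
        _ ≤ (|c'| + 1) * (I / (4 * (|c'| + 1))) := by gcongr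
        _ = I / 4 := by field_simp
    have h8 : D * (W ε ^ p * ε) ≤ I / 4 := by
      have hW0 : 0 ≤ W ε := zero_le_one.trans (h.one_le ε)
      calc D * (W ε ^ p * ε) ≤ (D + 1) * (W ε ^ p * ε) := by gcongr; linarith
        _ ≤ (D + 1) * (I / (4 * (D + 1))) := by gcongr
        _ = I / 4 := by field_simp
    linarith
  -- The test net is moderate with weight ε⁻¹: derivatives of the waves cost |ξ_ε| = ε⁻¹ each, and
  -- those of b cost W^p ≤ cε⁻¹.
  all_goals
    have hbM : UCls (paramScale (Rn n) (fun i => ((e i : ℝ))⁻¹) (fun _ => 1) (fun _ => one_le_inv_eps _)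
        (fun _ => le_rfl)) 0 b := by
      refine UCls.of_exists_bound (fun i => hb.contDiff i) fun l => ?_
      obtain ⟨C, p, hC, H⟩ := hb.exists_bound l
      obtain ⟨c, hc, H'⟩ := slowScale.exists_pow_le h.slow p
      refine ⟨C * c, 1, fun i x => (H i x).trans ?_⟩
      simp only [Real.rpow_zero, mul_one, pow_one]
      rw [mul_assoc]
      gcongr
      exact H' _
    have hw1 : UCls (paramScale (Rn n) (fun i => ((e i : ℝ))⁻¹) (fun _ => 1) (fun _ => one_le_inv_eps _)
        (fun _ => le_rfl)) 0 (fun i x => wave x (ξ (e i))) := uCls_wave fun i => (hξn _).le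
    have hw2 : UCls (paramScale (Rn n) (fun i => ((e i : ℝ))⁻¹) (fun _ => 1) (fun _ => one_le_inv_eps _)
        (fun _ => le_rfl)) 0 (fun i x => wave x (-ξ (e i))) := uCls_wave fun i => by
      rw [norm_neg]; exact (hξn _).le
    have hφU : UCls (paramScale (Rn n) (fun i => ((e i : ℝ))⁻¹) (fun _ => 1) (fun _ => one_le_inv_eps _)
        (fun _ => le_rfl)) 0 (fun _ => φ) := UCls.of_hasCompactSupport rfl hφ hK hφ0
    have hvU := (hw2.comp_clm (ContinuousLinearMap.fst ℝ (Rn n) (Rn n))).mul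
      ((hbM.comp_clm (ContinuousLinearMap.fst ℝ (Rn n) (Rn n))).mul
        ((hφU.mul hw1).comp_clm (ContinuousLinearMap.snd ℝ (Rn n) (Rn n))))
    have hvi : ∀ (ε : Eps) (hε : (ε : ℝ) ≤ ε₂), v ε = fun q => wave (ContinuousLinearMap.fst ℝ (Rn n) (Rn n) q) (-ξ (e ⟨ε, hε⟩)) *
        (b ⟨ε, hε⟩ (ContinuousLinearMap.fst ℝ (Rn n) (Rn n) q) *
        (φ (ContinuousLinearMap.snd ℝ (Rn n) (Rn n) q) *
          wave (ContinuousLinearMap.snd ℝ (Rn n) (Rn n) q) (ξ (e ⟨ε, hε⟩)))) := by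
      intro ε hε
      funext q
      simp [hv, hε, he, wave_neg_right]
  · by_cases hε : (ε : ℝ) ≤ ε₂
    · rw [hvi ε hε]
      exact (hvU.contDiff ⟨ε, hε⟩).contDiffOn
    · simp only [hv, hε]
      exact contDiffOn_const
  · obtain ⟨C, p, hC, H⟩ := hvU.exists_bound l
    refine ⟨p, C, ε₂, hε₂, fun ε hε q _ => ?_⟩
    have := H ⟨ε, hε⟩ q
    beta_reduce
    rw [hvi ε hε]
    refine this.trans (le_of_eq ?_)
    rw [Real.rpow_neg ε.2.1.le, Real.rpow_natCast, Real.one_rpow, mul_one, inv_pow]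

end

end KernelSupport

/-! ### Regularity at micro-elliptic points -/

section Regularity

variable {n : ℕ}

theorem Eps.rpow_neg_le (ε : Eps) {p q : ℝ} (h : p ≤ q) : (ε : ℝ) ^ (-p) ≤ (ε : ℝ) ^ (-q) :=
  Real.rpow_le_rpow_of_exponent_ge ε.2.1 ε.2.2 (neg_le_neg h)

theorem Eps.rpow_pos (ε : Eps) (p : ℝ) : 0 < (ε : ℝ) ^ p := Real.rpow_pos_of_pos ε.2.1 p

theorem BigOOn.exists_nonneg {X : Type*} {S : Set X} {f : Eps → X → ℂ} {p : ℝ} (h : BigOOn S f p) :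
    ∃ C : ℝ, 0 ≤ C ∧ ∀ᶠ ε in smallEps, ∀ x ∈ S, ‖f ε x‖ ≤ C * (ε : ℝ) ^ p := by
  obtain ⟨C, h⟩ := bigOOn_iff.1 h
  refine ⟨|C|, abs_nonneg C, h.mono fun ε hε x hx => (hε x hx).trans ?_⟩
  have := ε.rpow_pos p
  gcongr
  exact le_abs_self C

/-! ### Fourier transforms of a net multiplied by parametrix amplitudes -/

section Pairing

variable {Λ : Type*} {W : Eps → ℝ} {hW : ∀ ε, 1 ≤ W ε} {e : Λ → Eps} {ξ : Λ → Rn n}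
  {f : Eps → Rn n → ℂ} {O K : Set (Rn n)} {b : Λ → Rn n → ℂ}

/-- A derivative of the amplitude b is O(W^p) with p depending on the derivative, yet O(ε⁻¹) in
every case. The exponent M thus grows by exactly 1, independently of l; this keeps the final
exponent uniform. The bound holds for all frequencies attached to ε at once. -/
theorem eventually_norm_dirD_mul_le (hs : W ∈ slowScale) (hO : IsOpen O) (hK : IsClosed K) (hKO : K ⊆ O)
    (hf : ∀ ε, ContDiffOn ℝ ∞ (f ε) O) (hb : UCls (symScale hW e ξ) 0 b)
    (hb0 : ∀ i x, x ∉ K → b i x = 0) {M : ℝ} {l : List (Rn n)}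
    (h : ∀ p ∈ splits l, BigOOn K (fun ε => dirD p.1 (f ε)) (-M)) :
    ∃ C : ℝ, 0 ≤ C ∧ ∀ᶠ ε in smallEps, ∀ i, e i = ε → ∀ x,
      ‖dirD l (fun x => f ε x * b i x) x‖ ≤ C * (ε : ℝ) ^ (-(M + 1)) := by
  have hterm : ∀ p ∈ splits l, ∃ C : ℝ, 0 ≤ C ∧ ∀ᶠ ε in smallEps, ∀ i, e i = ε → ∀ x ∈ K,
      ‖dirD p.1 (f ε) x * dirD p.2 (b i) x‖ ≤ C * (ε : ℝ) ^ (-(M + 1)) := by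
    intro p hp
    obtain ⟨C₁, hC₁, h1⟩ := (h p hp).exists_nonneg
    obtain ⟨C₂, q, hC₂, h2⟩ := hb.exists_bound p.2
    obtain ⟨c, hc, h3⟩ := slowScale.exists_pow_le hs q
    refine ⟨C₁ * (C₂ * c), by positivity, h1.mono fun ε hε i hi x hx => ?_⟩
    have h4 := h2 i x
    simp only [Real.rpow_zero, mul_one] at h4
    rw [hi] at h4
    have hpos := ε.rpow_pos (-M)
    have hε0 : (0 : ℝ) < ε := ε.2.1
    rw [norm_mul, neg_add, Real.rpow_add hε0, Real.rpow_neg_one]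
    calc _ ≤ (C₁ * (ε : ℝ) ^ (-M)) * (C₂ * (c * (ε : ℝ)⁻¹)) :=
          mul_le_mul (hε x hx) (h4.trans (by gcongr; exact h3 ε)) (norm_nonneg _) (by positivity)
      _ = _ := by ring
  have hsum : ∀ S : List (List (Rn n) × List (Rn n)), (∀ p ∈ S, p ∈ splits l) →
      ∃ C : ℝ, 0 ≤ C ∧ ∀ᶠ ε in smallEps, ∀ i, e i = ε → ∀ x ∈ K,
        ‖(S.map fun p => dirD p.1 (f ε) x * dirD p.2 (b i) x).sum‖ ≤ C * (ε : ℝ) ^ (-(M + 1)) := by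
    intro S
    induction S with
    | nil => exact fun _ => ⟨0, le_rfl, Filter.Eventually.of_forall fun ε i _ x _ => by simp⟩
    | cons p S ih =>
      intro hS
      obtain ⟨C₁, hC₁, h1⟩ := hterm p (hS p (by simp))
      obtain ⟨C₂, hC₂, h2⟩ := ih fun q hq => hS q (by simp [hq])
      refine ⟨C₁ + C₂, by positivity, ?_⟩
      filter_upwards [h1, h2] with ε h1 h2 i hi x hx
      rw [List.map_cons, List.sum_cons, add_mul]
      exact (norm_add_le _ _).trans (add_le_add (h1 i hi x hx) (h2 i hi x hx))
  obtain ⟨C, hC, h⟩ := hsum (splits l) fun p hp => hp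
  refine ⟨C, hC, h.mono fun ε hε i hi x => ?_⟩
  by_cases hx : x ∈ K
  · rw [dirD_mul hO (hf ε) (hb.contDiff i).contDiffOn l (hKO hx)]
    exact hε i hi x hx
  · rw [dirD_eq_zero_of_notMem hK (fun x hx => by simp [hb0 i x hx]) l hx, norm_zero]
    have := ε.rpow_pos (-(M + 1))
    positivity

theorem eventually_jap_pow_mul_fourierHat_le (hs : W ∈ slowScale) (hO : IsOpen O) (hK : IsCompact K)
    (hKO : K ⊆ O) (hf : ∀ ε, ContDiffOn ℝ ∞ (f ε) O) (hb : UCls (symScale hW e ξ) 0 b)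
    (hb0 : ∀ i x, x ∉ K → b i x = 0) {M : ℝ} {L : ℕ} (h0 : BigOOn K f (-M))
    (h : ∀ k, ∀ p ∈ splits (List.replicate L (unitVec k)), BigOOn K (fun ε => dirD p.1 (f ε)) (-M)) :
    ∃ C : ℝ, 0 ≤ C ∧ ∀ᶠ ε in smallEps, ∀ i, e i = ε →
      jap (ξ i) ^ L * ‖fourierHat (fun x => f ε x * b i x) (ξ i)‖ ≤ C * (ε : ℝ) ^ (-(M + 1)) := by
  obtain ⟨C₀, hC₀, H0⟩ := eventually_norm_dirD_mul_le (l := []) hs hO hK.isClosed hKO hf hb hb0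
    (M := M) (by simpa [splits, dirD] using h0)
  choose C hC H using fun k => eventually_norm_dirD_mul_le (l := List.replicate L (unitVec k)) hs hO
    hK.isClosed hKO hf hb hb0 (h k)
  have hS : 0 ≤ ∑ k, C k := Finset.sum_nonneg fun k _ => hC k
  refine ⟨((n + 1 : ℝ) ^ L * (n + 1) * volume.real K) * (C₀ + ∑ k, C k), by positivity, ?_⟩
  filter_upwards [H0, Filter.eventually_all.2 H] with ε H0 H i hi
  have hpos := ε.rpow_pos (-(M + 1))
  have hsm : ContDiff ℝ ∞ fun x => f ε x * b i x :=
    contDiff_of_contDiffOn_of_compact hO hK.isClosed hKO ((hf ε).mul (hb.contDiff i).contDiffOn)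
      fun x hx => by simp [hb0 i x hx]
  rw [mul_assoc]
  refine jap_pow_mul_fourierHat_le hsm hK (fun x hx => by simp [hb0 i x hx]) L (fun x => ?_)
    (fun k x => ?_) (ξ i)
  · refine (H0 i hi x).trans ?_
    gcongr
    linarith
  · refine (H k i hi x).trans ?_
    gcongr
    exact (Finset.single_le_sum (fun k _ => hC k) (Finset.mem_univ k)).trans (by linarith)

theorem exists_bigOOn_forall {ι X : Type*} {K : Set X} {F : ι → Eps → X → ℂ}
    (h : ∀ i, ∃ p : ℝ, BigOOn K (F i) (-p)) (S : List ι) :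
    ∃ M : ℝ, ∀ i ∈ S, BigOOn K (F i) (-M) := by
  induction S with
  | nil => exact ⟨0, by simp⟩
  | cons i S ih =>
    obtain ⟨M, hM⟩ := ih
    obtain ⟨p, hp⟩ := h i
    refine ⟨max p M, fun j hj => ?_⟩
    rcases List.mem_cons.1 hj with rfl | hj
    · exact hp.mono (neg_le_neg (le_max_left _ _))
    · exact (hM j hj).mono (neg_le_neg (le_max_right _ _))

/-- Negligibility concerns values only, so derivatives are handled by interpolation: with F the
modulus of the transform, (⟨ξ⟩^L F)² = (⟨ξ⟩^{2L} F)·F, where the first factor is moderate and the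
second as small as desired. -/
theorem eventually_fourierHat_le_of_negligible (hs : W ∈ slowScale) (hO : IsOpen O) (hK : IsCompact K)
    (hKO : K ⊆ O) (hf : ∀ ε, ContDiffOn ℝ ∞ (f ε) O) (hb : UCls (symScale hW e ξ) 0 b)
    (hb0 : ∀ i x, x ∉ K → b i x = 0)
    (hmod : ∀ l : List (Rn n), ∃ p : ℝ, BigOOn K (fun ε => dirD l (f ε)) (-p))
    (hneg : ∀ q : ℝ, BigOOn K f q) (L : ℕ) :
    ∃ C : ℝ, 0 ≤ C ∧ ∀ᶠ ε in smallEps, ∀ i, e i = ε →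
      jap (ξ i) ^ L * ‖fourierHat (fun x => f ε x * b i x) (ξ i)‖ ≤ C := by
  obtain ⟨M, hM⟩ := exists_bigOOn_forall hmod ((List.finRange n).flatMap fun k =>
    (splits (List.replicate (2 * L) (unitVec k))).map Prod.fst)
  obtain ⟨C₁, hC₁, h1⟩ := eventually_jap_pow_mul_fourierHat_le (L := 2 * L) hs hO hK hKO hf hb hb0
    (hneg (-M)) fun k p hp => hM p.1 (by
      simp only [List.mem_flatMap, List.mem_map]
      exact ⟨k, List.mem_finRange k, p, hp, rfl⟩)
  -- The choice -(M+2) gives F = O(ε^{M+1}), which exactly cancels the growth ε^{-(M+1)} of the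
  -- first factor.
  obtain ⟨C₂, hC₂, h2⟩ := eventually_jap_pow_mul_fourierHat_le (L := 0) (M := -(M + 2)) hs hO hK hKO hf
    hb hb0 (hneg _) fun k p hp => by
      simp only [List.replicate_zero, splits, List.mem_singleton] at hp
      rw [hp]
      exact hneg _
  refine ⟨C₁ + C₂, by positivity, ?_⟩
  filter_upwards [h1, h2] with ε h1 h2 i hi
  have h1 := h1 i hi
  have h2 := h2 i hi
  have hε0 : (0 : ℝ) < ε := ε.2.1
  set F := ‖fourierHat (fun x => f ε x * b i x) (ξ i)‖ with hF
  have hF0 : 0 ≤ F := norm_nonneg _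
  rw [pow_zero, one_mul, show -(-(M + 2) + 1) = M + 1 by ring] at h2
  refine abs_le_of_sq_le_sq' ?_ (by positivity) |>.2
  have h3 : (ε : ℝ) ^ (-(M + 1)) * (ε : ℝ) ^ (M + 1) = 1 := by
    rw [← Real.rpow_add hε0, neg_add_cancel, Real.rpow_zero]
  have hpos := ε.rpow_pos (-(M + 1))
  calc (jap (ξ i) ^ L * F) ^ 2 = (jap (ξ i) ^ (2 * L) * F) * F := by ring
    _ ≤ (C₁ * (ε : ℝ) ^ (-(M + 1))) * (C₂ * (ε : ℝ) ^ (M + 1)) := by gcongr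
    _ = C₁ * C₂ * ((ε : ℝ) ^ (-(M + 1)) * (ε : ℝ) ^ (M + 1)) := by ring
    _ = C₁ * C₂ := by rw [h3, mul_one]
    _ ≤ (C₁ + C₂) ^ 2 := by nlinarith

end Pairing

/-- Duality applied to the amplitude u(y) χ(x,y) b(x): the transform of wb at ξ is the integral of
e^{-iyξ} u(y) against the transposed operator, which may be replaced by φ up to the error τ. -/
theorem norm_fourierHat_mul_le_of_transOp {a : Rn n × Rn n → ℂ} (ha : ContDiff ℝ ∞ a)
    (hab : ∀ β : List (Rn n), ∃ C : ℝ, ∀ p, ‖symD [] β a p‖ ≤ C) {χ : Rn n × Rn n → ℂ}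
    (hχ : ContDiff ℝ ∞ χ) {b u φ w : Rn n → ℂ} (hb : ContDiff ℝ ∞ b) (hu : ContDiff ℝ ∞ u)
    (hφ : Continuous φ) {K K' : Set (Rn n)} (hK : IsCompact K) (hK' : IsCompact K')
    (hb0 : ∀ x, x ∉ K → b x = 0) (hu0 : ∀ x, x ∉ K' → u x = 0) (ξ : Rn n)
    (hw : ∀ x ∈ K, w x = pseudo a (fun y => χ (x, y) * u y) x) {τ D : ℝ}
    (hT : ∀ y, ‖transOp a ξ (fun x => χ (x, y) * b x) y - φ y‖ ≤ τ) (hD : ∀ y ∈ K', ‖u y‖ ≤ D) :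
    ‖fourierHat (fun y => φ y * u y) ξ‖ ≤
      ‖fourierHat (fun x => w x * b x) ξ‖ + D * τ * volume.real K' := by
  set v : Rn n × Rn n → ℂ := fun q => u q.2 * (χ q * b q.1) with hv
  have hvs : ContDiff ℝ ∞ v := (hu.comp contDiff_snd).mul (hχ.mul (hb.comp contDiff_fst))
  obtain ⟨h1, h2⟩ := integral_pseudo_eq_transOp ha hab hvs hK hK'
    (fun x y hx => by simp [hv, hb0 x hx]) (fun x y hy => by simp [hv, hu0 y hy]) ξ
  have h3 : fourierHat (fun x => w x * b x) ξ = ∫ x, pseudo a (fun y => wave (-x) ξ * v (x, y)) x := by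
    rw [fourierHat_eq]
    congr 1
    funext x
    by_cases hx : x ∈ K
    · rw [hw x hx, mul_comm (pseudo _ _ _), ← mul_assoc, ← pseudo_const_mul]
      refine pseudo_congr (fun _ => rfl) fun y => ?_
      simp only [hv]
      ring
    · rw [pseudo_zero fun y => by simp [hv, hb0 x hx], hb0 x hx]
      simp
  have h4 : ∀ y, wave (-y) ξ * transOp a ξ (fun x => v (x, y)) y =
      wave (-y) ξ * (u y * transOp a ξ (fun x => χ (x, y) * b x) y) := fun y =>
    congrArg (wave (-y) ξ * ·) (transOp_const_mul a ξ (fun x => χ (x, y) * b x) (u y) y)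
  simp only [h4] at h1 h2
  have h5 : Integrable fun y => wave (-y) ξ * (φ y * u y) :=
    integrable_of_compact (by have := hu.continuous; fun_prop) hK' fun y hy => by simp [hu0 y hy]
  have h6 : ‖∫ y, (wave (-y) ξ * (φ y * u y) -
      wave (-y) ξ * (u y * transOp a ξ (fun x => χ (x, y) * b x) y))‖ ≤ D * τ * volume.real K' := by
    refine norm_integral_le_of_compact hK' (fun y hy => by simp [hu0 y hy]) fun y hy => ?_
    rw [← mul_sub, norm_mul, norm_wave, one_mul, mul_comm (φ y), ← mul_sub, norm_mul, norm_sub_rev]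
    have := hD y hy
    exact mul_le_mul this (hT y) (norm_nonneg _) ((norm_nonneg _).trans this)
  rw [integral_sub h5 h2, ← h1, ← h3, ← fourierHat_eq (fun y => φ y * u y)] at h6
  exact (norm_le_norm_add_norm_sub' _ _).trans (add_le_add le_rfl h6)

/-- Properness of the support of χ: over the compact set K only a compact set of y contributes, so u
may be replaced by βu without changing the operator value on K. -/
theorem IsProperCutoff.exists_localization {Ω : Opens (Rn n)} {C : Set (Rn n × Rn n)}
    {χ : Rn n × Rn n → ℂ} (hχ : IsProperCutoff Ω C χ) {K : Set (Rn n)} (hK : IsCompact K) (hKΩ : K ⊆ Ω) :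
    ∃ β : Rn n → ℂ, ContDiff ℝ ∞ β ∧ HasCompactSupport β ∧ tsupport β ⊆ Ω ∧ (∀ x ∈ K, β x = 1) ∧
      ∀ x ∈ K, ∀ y, χ (x, y) ≠ 0 → β y = 1 := by
  have hQ := (hχ.2.2.1.2 K hK hKΩ).1
  set Q := closure (Function.support χ) ∩ (opensProd Ω Ω : Opens (Rn n × Rn n)) ∩ Prod.fst ⁻¹' K with hQdef
  have hQΩ : Prod.snd '' Q ⊆ (Ω : Set (Rn n)) := by
    rintro _ ⟨q, hq, rfl⟩
    exact hq.1.2.2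
  obtain ⟨β, hβ, hβc, hβΩ, U, -, hU, h1⟩ := exists_cutoff ((hQ.image continuous_snd).union hK) Ω.isOpen
    (union_subset hQΩ hKΩ)
  refine ⟨β, hβ, hβc, hβΩ, fun x hx => h1 x (hU (Or.inr hx)), fun x hx y hxy => h1 y (hU (Or.inl ?_))⟩
  refine ⟨(x, y), ⟨⟨subset_closure hxy, ?_⟩, hx⟩, rfl⟩
  by_contra hn
  exact hxy (hχ.2.1 _ hn)

theorem isRep_sub {Ω : Opens (Rn n)} {U : G Ω} {u v : Eps → Rn n → ℂ} (hu : IsRep u U) (hv : IsRep v U)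
    {K : Set (Rn n)} (hK : IsCompact K) (hKΩ : K ⊆ Ω) (q : ℝ) : BigOOn K (u - v) q := by
  obtain ⟨hu, hU⟩ := hu
  obtain ⟨hv, hV⟩ := hv
  have h := (Submodule.Quotient.eq (negligible Ω)).1 (hU.trans hV.symm)
  exact h K hK hKΩ q

theorem jap_rpow_le_pow_ceil (ξ : Rn n) (l : ℝ) : jap ξ ^ l ≤ jap ξ ^ ⌈l⌉₊ := by
  rw [← Real.rpow_natCast]
  exact Real.rpow_le_rpow_of_exponent_le (one_le_jap ξ) (Nat.le_ceil l)

/-- Frequencies in the cone are split at |ξ| = W_ε. Above, the parametrix expresses the transform of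
φu by that of wb; below, moderateness and the slow scale property are enough. -/
theorem microlocallyRegular_of_mem_ell {Ω : Opens (Rn n)} {A : Symbol Ω 0} {U V : G Ω}
    (hAU : IsOpValue A U V) (hV : V ∈ Ginf Ω) {p : Rn n × Rn n} (hp : p ∈ Ell A) :
    MicrolocallyRegular U p.1 p.2 := by
  obtain ⟨a, u, w, χ, ha, hu, hw, hχ, hwa⟩ := hAU
  obtain ⟨w₁, hw₁, hreg⟩ := hV
  obtain ⟨κ, O₁, Γ, W, ε₁, h⟩ := exists_ellipticAt hp ha
  set x₀ := p.1
  have hmem := h.mem_kernelSupport ha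
  -- a ball around the base point on whose square the cut-off is one
  have hχ1 : ∀ᶠ q in 𝓝 (x₀, x₀), χ q = 1 := hχ.2.2.2.filter_mono (nhds_le_nhdsSet hmem)
  obtain ⟨s₁, hs₁, s₂, hs₂, hs⟩ := mem_nhds_prod_iff.1 hχ1
  obtain ⟨ρ, hρ, hball⟩ := Metric.mem_nhds_iff.1
    (Filter.inter_mem (Filter.inter_mem hs₁ hs₂) (h.isOpen.mem_nhds h.mem))
  set K : Set (Rn n) := Metric.closedBall x₀ (ρ / 2) with hKdef
  have hKc : IsCompact K := isCompact_closedBall _ _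
  have hKball : K ⊆ s₁ ∩ s₂ ∩ O₁ :=
    (Metric.closedBall_subset_ball (half_lt_self hρ)).trans hball
  have hKO₁ : K ⊆ O₁ := fun x hx => (hKball hx).2
  have hKΩ : K ⊆ Ω := hKO₁.trans h.subset
  have hχK : ∀ x ∈ K, ∀ y ∈ K, χ (x, y) = 1 := fun x hx y hy =>
    hs (show (x, y) ∈ s₁ ×ˢ s₂ from ⟨(hKball hx).1.1, (hKball hy).1.2⟩)
  set O : Set (Rn n) := Metric.ball x₀ (ρ / 2) with hO
  have hOK : O ⊆ K := Metric.ball_subset_closedBall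
  obtain ⟨φ, hφ, hφc, hφO, O₂, hO₂, hxO₂, hφ1⟩ := exists_cutoff (isCompact_singleton (x := x₀))
    Metric.isOpen_ball (singleton_subset_iff.2 (Metric.mem_ball_self (half_pos hρ)))
  have hφ0 : ∀ x, x ∉ tsupport φ → φ x = 0 := fun x hx => notMem_tsupport hx
  have hφK : tsupport φ ⊆ K := hφO.trans hOK
  have hφΩ : tsupport φ ⊆ Ω := hφK.trans hKΩ
  obtain ⟨β, hβ, hβc, hβΩ, hβK, hβχ⟩ := hχ.exists_localization hKc hKΩ
  have hβ0 : ∀ x, x ∉ tsupport β → β x = 0 := fun x hx => notMem_tsupport hx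
  -- global cut-offs
  set χ' : Rn n × Rn n → ℂ := fun q => (κ q.1 * β q.2) * χ q with hχ'
  have hsub : tsupport κ ×ˢ tsupport β ⊆ (opensProd Ω Ω : Opens (Rn n × Rn n)) :=
    fun q hq => ⟨h.tsupport_subset hq.1, hβΩ hq.2⟩
  have hχ'0 : ∀ q, q ∉ tsupport κ ×ˢ tsupport β → χ' q = 0 := fun q hq => by
    by_cases h1 : q.1 ∈ tsupport κ
    · simp [hχ', hβ0 q.2 fun h2 => hq ⟨h1, h2⟩]
    · simp [hχ', notMem_tsupport h1]
  have hχ's : ContDiff ℝ ∞ χ' :=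
    contDiff_of_contDiffOn_of_compact (opensProd Ω Ω).isOpen
      (h.compact.isClosed.prod hβc.isClosed) hsub
      (((h.contDiff.comp contDiff_fst).mul (hβ.comp contDiff_snd)).contDiffOn.mul hχ.1) hχ'0
  have hχ'c : HasCompactSupport χ' := HasCompactSupport.intro (h.compact.prod hβc) hχ'0
  have hχ'1 : ∀ x ∈ O, ∀ y ∈ O, χ' (x, y) = 1 := fun x hx y hy => by
    simp [hχ', h.eq_one x (hKO₁ (hOK hx)), hβK y (hOK hy), hχK x (hOK hx) y (hOK hy)]
  have hus : ∀ ε, ContDiff ℝ ∞ fun y => β y * u ε y := fun ε =>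
    contDiff_of_contDiffOn_of_compact Ω.isOpen hβc.isClosed hβΩ
      (hβ.contDiffOn.mul (hu.1.1 ε)) fun y hy => by simp [hβ0 y hy]
  have hφu : ∀ ε, (fun y => φ y * u ε y) = fun y => φ y * (β y * u ε y) := fun ε => by
    funext y
    by_cases hy : y ∈ tsupport φ
    · rw [hβK y (hφK hy), one_mul]
    · simp [hφ0 y hy]
  have hwK : ∀ ε, ∀ x ∈ K, w ε x =
      pseudo (fun q => κ q.1 * a ε q) (fun y => χ' (x, y) * (β y * u ε y)) x := fun ε x hx => by
    rw [hwa ε x (hKΩ hx)]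
    refine pseudo_congr (fun ξ => by simp [h.eq_one x (hKO₁ hx)]) fun y => ?_
    by_cases hxy : χ (x, y) = 0
    · simp [hχ', hxy]
    · simp [hχ', hβχ x hx y hxy, h.eq_one x (hKO₁ hx)]
  -- the regular and the negligible part
  obtain ⟨N, hN⟩ := hreg K hKc hKΩ
  -- The value net w need not satisfy the 𝒢^∞ estimates itself; only w₁ does.
  have hw₂mod : w - w₁ ∈ moderate Ω := (moderate Ω).sub_mem hw.1 hw₁.1
  have hw₂neg : ∀ q : ℝ, BigOOn K (w - w₁) q := isRep_sub hw hw₁ hKc hKΩ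
  obtain ⟨p₀, hp₀⟩ := hu.1.2 (tsupport β) hβc hβΩ []
  obtain ⟨C₀, hC₀, hu0⟩ := hp₀.exists_nonneg
  obtain ⟨D, hD⟩ := hβc.exists_bound_of_continuousOn hβ.continuous.continuousOn
  have hD' : ∀ y, ‖β y‖ ≤ |D| := fun y => by
    by_cases hy : y ∈ tsupport β
    · exact (hD y hy).trans (le_abs_self D)
    · simp [hβ0 y hy]
  have hu' : ∀ᶠ ε in smallEps, ∀ y, ‖β y * u ε y‖ ≤ |D| * C₀ * (ε : ℝ) ^ (-p₀) := by
    refine hu0.mono fun ε hε y => ?_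
    have hpos := ε.rpow_pos (-p₀)
    by_cases hy : y ∈ tsupport β
    · rw [norm_mul, mul_assoc]
      exact mul_le_mul (hD' y) (hε y hy) (norm_nonneg _) (abs_nonneg D)
    · rw [hβ0 y hy, zero_mul, norm_zero]
      positivity
  -- The exponent is fixed before l is given: N + 1 serves the regular part, 0 the negligible part,
  -- and p₀ + 1 both the parametrix error and the low frequencies.
  set M : ℝ := max (max (N + 1) 0) (p₀ + 1) with hM
  refine ⟨u, hu, φ, hφ, hφc, hφΩ, hφ1 x₀ (hxO₂ rfl), Γ, h.conic, M, fun l => ?_⟩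
  -- L is also the order of the parametrix, whose error ⟨ξ⟩^{-L-1} absorbs the weight ⟨ξ⟩^L.
  obtain ⟨L, hL⟩ : ∃ L : ℕ, L = ⌈l⌉₊ := ⟨_, rfl⟩
  -- All pairs (ε, ξ) in the elliptic range form one index set, which makes the bounds on the
  -- parametrix uniform in both.
  set Λ : Type := {q : Eps × Rn n // (q.1 : ℝ) ≤ ε₁ ∧ q.2 ∈ Γ ∧ W q.1 ≤ ‖q.2‖}
  obtain ⟨b, hb, hb0, C, q, hC, hT⟩ := h.exists_parametrix (Λ := Λ) (e := fun i => i.1.1)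
    (ξ := fun i => i.1.2) (fun i => i.2.1) (fun i => i.2.2.1) (fun i => i.2.2.2) hφc
    (hφK.trans hKO₁) hφ hφ0 L
  obtain ⟨C', q', hC', hT'⟩ := h.symbols.transOp_cutoff_le (hW := h.one_le) hφc hφO hb hb0 hχ's hχ'c hχ'1 L
  obtain ⟨c, hc, hWc⟩ := slowScale.exists_pow_le h.slow (max q q')
  obtain ⟨c', hc', hWc'⟩ := slowScale.exists_pow_le h.slow L
  have hb0' : ∀ i x, x ∉ K → b i x = 0 := fun i x hx => hb0 i x fun hx' => hx (hφK hx')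
  obtain ⟨C₁, hC₁, H1⟩ := eventually_jap_pow_mul_fourierHat_le (L := L) h.slow Ω.isOpen hKc hKΩ
    hw₁.1.1 hb hb0' (hN []) fun k p _ => hN p.1
  obtain ⟨C₂, hC₂, H2⟩ := eventually_fourierHat_le_of_negligible h.slow Ω.isOpen hKc hKΩ
    hw₂mod.1 hb hb0' (hw₂mod.2 K hKc hKΩ) hw₂neg L
  set vol := volume.real (tsupport β)
  have hvol : 0 ≤ vol := measureReal_nonneg
  obtain ⟨D', hD'φ⟩ := hφc.exists_bound_of_continuousOn hφ.continuous.continuousOn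
  have hD'φ' : ∀ y, ‖φ y‖ ≤ |D'| := fun y => by
    by_cases hy : y ∈ tsupport φ
    · exact (hD'φ y hy).trans (le_abs_self D')
    · simp [hφ0 y hy]
  refine bigOOn_iff.2 ⟨2 ^ L * c' * (|D'| * (|D| * C₀) * vol) +
    (C₁ + C₂ + |D| * C₀ * ((C + C') * c) * vol), ?_⟩
  filter_upwards [hu', H1, H2, eventually_le_smallEps h.pos] with ε hu' H1 H2 hε ξ hξ
  have hε0 : (0 : ℝ) < ε := ε.2.1
  have hpM := ε.rpow_pos (-M)
  have hpp := ε.rpow_pos (-p₀)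
  have hW0 : 0 ≤ W ε := zero_le_one.trans (h.one_le ε)
  have hjap := jap_pos ξ
  have hM1 : (ε : ℝ) ^ (-(p₀ + 1)) ≤ (ε : ℝ) ^ (-M) := ε.rpow_neg_le (le_max_right _ _)
  have hM2 : (ε : ℝ) ^ (-(N + 1)) ≤ (ε : ℝ) ^ (-M) :=
    ε.rpow_neg_le ((le_max_left _ _).trans (le_max_left _ _))
  have hM3 : 1 ≤ (ε : ℝ) ^ (-M) := by
    have := ε.rpow_neg_le (p := 0) (q := M) ((le_max_right _ _).trans (le_max_left _ _))
    simpa using this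
  have hpe : (ε : ℝ)⁻¹ * (ε : ℝ) ^ (-p₀) = (ε : ℝ) ^ (-(p₀ + 1)) := by
    rw [neg_add, Real.rpow_add hε0, Real.rpow_neg_one, mul_comm]
  rw [norm_mul, Complex.norm_real, Real.norm_of_nonneg (jap_rpow_nonneg _ _), hφu]
  have hjl : jap ξ ^ l ≤ jap ξ ^ L := hL ▸ jap_rpow_le_pow_ceil ξ l
  refine (mul_le_mul_of_nonneg_right hjl (norm_nonneg _)).trans ?_
  -- Below the elliptic range ⟨ξ⟩ ≤ 2W_ε, so the weight ⟨ξ⟩^L costs only one factor ε⁻¹.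
  rcases lt_or_ge ‖ξ‖ (W ε) with hlow | hhigh
  · have h1 : jap ξ ^ L ≤ 2 ^ L * (c' * (ε : ℝ)⁻¹) := by
      calc jap ξ ^ L ≤ (2 * W ε) ^ L := by
            gcongr
            linarith [jap_le_one_add_norm ξ, h.one_le ε]
        _ = 2 ^ L * W ε ^ L := mul_pow _ _ _
        _ ≤ _ := by gcongr; exact hWc' ε
    have h2 : ‖fourierHat (fun y => φ y * (β y * u ε y)) ξ‖ ≤
        |D'| * (|D| * C₀ * (ε : ℝ) ^ (-p₀)) * vol := by
      refine norm_fourierHat_le hβc (fun y hy => by simp [hβ0 y hy]) (fun y _ => ?_) ξ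
      rw [norm_mul]
      exact mul_le_mul (hD'φ' y) (hu' y) (norm_nonneg _) (abs_nonneg _)
    calc _ ≤ (2 ^ L * (c' * (ε : ℝ)⁻¹)) * (|D'| * (|D| * C₀ * (ε : ℝ) ^ (-p₀)) * vol) := by gcongr
      _ = 2 ^ L * c' * (|D'| * (|D| * C₀) * vol) * ((ε : ℝ)⁻¹ * (ε : ℝ) ^ (-p₀)) := by ring
      _ ≤ 2 ^ L * c' * (|D'| * (|D| * C₀) * vol) * (ε : ℝ) ^ (-M) := by
        rw [hpe]
        gcongr
      _ ≤ _ := by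
        gcongr
        have : 0 ≤ C₁ + C₂ + |D| * C₀ * ((C + C') * c) * vol := by positivity
        linarith
  · set i : Λ := ⟨(ε, ξ), hε, hξ, hhigh⟩
    set τ : ℝ := (C + C') * (c * (ε : ℝ)⁻¹) * (jap ξ ^ (L + 1))⁻¹ with hτ
    have hbd : ∀ β : List (Rn n), ∃ C : ℝ, ∀ q, ‖symD [] β (fun q => κ q.1 * a ε q) q‖ ≤ C := fun β => by
      obtain ⟨C, -, H⟩ := h.symbols.bound [] β
      exact ⟨C * W ε, fun q => by simpa using H ε q⟩
    have hWm : ∀ k ≤ max q q', W ε ^ k ≤ c * (ε : ℝ)⁻¹ := fun k hk =>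
      (pow_le_pow_right₀ (h.one_le ε) hk).trans (hWc ε)
    have hTτ : ∀ y, ‖transOp (fun q => κ q.1 * a ε q) ξ (fun x => χ' (x, y) * b i x) y - φ y‖ ≤ τ := by
      intro y
      have h1 := hT i y
      have h2 := hT' i y
      have h3 := hWm q (le_max_left _ _)
      have h4 := hWm q' (le_max_right _ _)
      refine (norm_sub_le_norm_sub_add_norm_sub _
        (transOp (fun q => κ q.1 * a ε q) ξ (b i) y) _).trans ?_
      refine (add_le_add h2 h1).trans ?_
      rw [hτ, add_mul C, add_mul, add_comm]
      gcongr
    have hmain := norm_fourierHat_mul_le_of_transOp (h.symbols.contDiff ε) hbd hχ's (hb.contDiff i)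
      (hus ε) hφ.continuous hKc hβc (hb0' i) (fun y hy => by simp [hβ0 y hy]) ξ (hwK ε) hTτ
      (fun y _ => hu' y)
    have hsplit : fourierHat (fun x => w ε x * b i x) ξ =
        fourierHat (fun x => w₁ ε x * b i x) ξ + fourierHat (fun x => (w - w₁) ε x * b i x) ξ := by
      have hint : ∀ g : Rn n → ℂ, ContDiffOn ℝ ∞ g Ω → Integrable fun x => g x * b i x := fun g hg =>
        integrable_of_compact (contDiff_of_contDiffOn_of_compact Ω.isOpen hKc.isClosed hKΩ
          (hg.mul (hb.contDiff i).contDiffOn) fun x hx => by simp [hb0' i x hx]).continuous hKc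
          fun x hx => by simp [hb0' i x hx]
      rw [← fourierHat_add (hint _ (hw₁.1.1 ε)) (hint _ (hw₂mod.1 ε))]
      congr 1
      funext x
      simp only [Pi.sub_apply]
      ring
    have h1 := H1 i rfl
    have h2 := H2 i rfl
    have h3 : jap ξ ^ L * τ ≤ (C + C') * (c * (ε : ℝ)⁻¹) := by
      rw [hτ, mul_comm, mul_assoc]
      refine mul_le_of_le_one_right (by positivity) ?_
      rw [inv_mul_le_iff₀ (by positivity), mul_one]
      exact pow_le_pow_right₀ (one_le_jap ξ) (Nat.le_succ L)
    have h4 : jap ξ ^ L * ‖fourierHat (fun x => w ε x * b i x) ξ‖ ≤ C₁ * (ε : ℝ) ^ (-(N + 1)) + C₂ := by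
      rw [hsplit]
      refine (mul_le_mul_of_nonneg_left (norm_add_le _ _) (by positivity)).trans ?_
      rw [mul_add]
      exact add_le_add h1 h2
    calc _ ≤ jap ξ ^ L * (‖fourierHat (fun x => w ε x * b i x) ξ‖ +
          |D| * C₀ * (ε : ℝ) ^ (-p₀) * τ * vol) := by gcongr
      _ = jap ξ ^ L * ‖fourierHat (fun x => w ε x * b i x) ξ‖ +
          |D| * C₀ * (ε : ℝ) ^ (-p₀) * (jap ξ ^ L * τ) * vol := by ring
      _ ≤ (C₁ * (ε : ℝ) ^ (-(N + 1)) + C₂) +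
          |D| * C₀ * (ε : ℝ) ^ (-p₀) * ((C + C') * (c * (ε : ℝ)⁻¹)) * vol := by gcongr
      _ = C₁ * (ε : ℝ) ^ (-(N + 1)) + C₂ * 1 +
          |D| * C₀ * ((C + C') * c) * vol * ((ε : ℝ)⁻¹ * (ε : ℝ) ^ (-p₀)) := by ring
      _ ≤ C₁ * (ε : ℝ) ^ (-M) + C₂ * (ε : ℝ) ^ (-M) +
          |D| * C₀ * ((C + C') * c) * vol * (ε : ℝ) ^ (-M) := by
        rw [hpe]
        gcongr
      _ = (C₁ + C₂ + |D| * C₀ * ((C + C') * c) * vol) * (ε : ℝ) ^ (-M) := by ring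
      _ ≤ _ := by
        have : 0 ≤ 2 ^ L * c' * (|D'| * (|D| * C₀) * vol) := by positivity
        exact mul_le_mul_of_nonneg_right (by linarith) hpM.le

end Regularity
/-! ### Symbols of order zero in the frequency variable -/

section FrequencySymbols

variable {n : ℕ}

/-- The scale of symbols that do not depend on the space variable. -/
def japScale (n : ℕ) : Scale Unit (Rn n) :=
  ⟨fun _ => 1, fun _ ξ => jap ξ, 1, fun _ => le_rfl, fun _ ξ => one_le_jap ξ⟩

theorem cls_zero_order {m C : ℝ} {f : Rn n → ℂ} (hf : ContDiff ℝ ∞ f)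
    (h : ∀ ξ, ‖f ξ‖ ≤ C * jap ξ ^ m) : Cls (japScale n) univ univ 0 m (fun _ => f) := by
  refine ⟨fun _ => hf.contDiffOn, fun l hl => ⟨|C|, 0, abs_nonneg C, fun _ ξ _ => ?_⟩⟩
  obtain rfl : l = [] := List.length_eq_zero_iff.1 (Nat.le_zero.1 hl)
  simp only [dirD, japScale, one_pow, mul_one, List.length_nil, Nat.cast_zero, mul_zero, sub_zero]
  exact (h ξ).trans (mul_le_mul_of_nonneg_right (le_abs_self C) (jap_rpow_nonneg ξ m))

theorem cls_const (c : ℂ) : ∀ N, Cls (japScale n) univ univ N 0 (fun _ _ => c)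
  | 0 => cls_zero_order (C := ‖c‖) contDiff_const fun ξ => by simp
  | N + 1 => (cls_zero_order (C := ‖c‖) contDiff_const fun ξ => by simp).succ fun v => by
    have : (fun _ : Unit => dirD [v] (fun _ : Rn n => c)) = fun _ _ => 0 := by
      funext i ξ
      simp [dirD]
    rw [this]
    exact Cls.zero

theorem cls_coord (i : Fin n) (N : ℕ) : Cls (japScale n) univ univ N 1 (fun _ ξ => ((ξ i : ℝ) : ℂ)) := by
  have h0 : Cls (japScale n) univ univ 0 1 (fun _ ξ => ((ξ i : ℝ) : ℂ)) := by
    refine cls_zero_order (C := 1) (Complex.ofRealCLM.comp (EuclideanSpace.proj i)).contDiff fun ξ => ?_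
    rw [Complex.norm_real, Real.rpow_one, one_mul]
    exact abs_coord_le_jap ξ i
  refine (h0.succ (N := N) fun v => ?_).mono_order (Nat.le_succ N)
  have h1 : (fun _ : Unit => dirD [v] (fun ξ : Rn n => ((ξ i : ℝ) : ℂ))) = fun _ _ => ((v i : ℝ) : ℂ) := by
    funext _ ξ
    exact congrArg (fun L => L v)
      (Complex.ofRealCLM.comp (EuclideanSpace.proj i : Rn n →L[ℝ] ℝ)).fderiv
  rw [h1]
  exact (cls_const _ N).mono (by simp [japScale])

/-- The derivative is arranged as three factors ⟨ξ⟩⁻¹ and a linear form, of total order -3 + 1 = -2;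
this closes the induction in `cls_inv_jap`. -/
theorem dirD_inv_jap (v ξ : Rn n) :
    dirD [v] (fun ξ => (((jap ξ)⁻¹ : ℝ) : ℂ)) ξ =
      (-1 : ℂ) * ((((jap ξ)⁻¹ : ℝ) : ℂ) * ((((jap ξ)⁻¹ : ℝ) : ℂ) * ((((jap ξ)⁻¹ : ℝ) : ℂ) *
        ∑ i, ((v i : ℝ) : ℂ) * ((ξ i : ℝ) : ℂ)))) := by
  have hj := jap_pos ξ
  have h1 : HasFDerivAt (fun ξ : Rn n => 1 + ‖ξ‖ ^ 2) (2 • innerSL ℝ ξ) ξ :=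
    (hasStrictFDerivAt_norm_sq ξ).hasFDerivAt.const_add 1
  have h2 : HasFDerivAt (jap : Rn n → ℝ) _ ξ := h1.sqrt (by positivity)
  have h3 := (Complex.ofRealCLM.hasFDerivAt (x := (jap ξ)⁻¹)).comp ξ
    ((hasDerivAt_inv hj.ne').comp_hasFDerivAt ξ h2)
  have h4 : dirD [v] (fun ξ => (((jap ξ)⁻¹ : ℝ) : ℂ)) ξ = _ := congrArg (fun L => L v) h3.fderiv
  have h5 : (inner ℝ ξ v : ℝ) = ∑ i, v i * ξ i := by
    simp [PiLp.inner_apply]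
  rw [h4]
  simp only [ContinuousLinearMap.comp_apply, _root_.smul_apply, Complex.ofRealCLM_apply,
    innerSL_apply_apply, smul_eq_mul, h5, nsmul_eq_mul]
  rw [show Real.sqrt (1 + ‖ξ‖ ^ 2) = jap ξ from rfl]
  push_cast
  have : ((jap ξ : ℝ) : ℂ) ≠ 0 := by exact_mod_cast hj.ne'
  field_simp

theorem contDiff_inv_jap : ContDiff ℝ ∞ (fun ξ : Rn n => (((jap ξ)⁻¹ : ℝ) : ℂ)) :=
  Complex.ofRealCLM.contDiff.comp (contDiff_jap.inv fun ξ => (jap_pos ξ).ne')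

theorem cls_inv_jap : ∀ N, Cls (japScale n) univ univ N (-1) (fun _ ξ => (((jap ξ)⁻¹ : ℝ) : ℂ)) := by
  have h0 : Cls (japScale n) univ univ 0 (-1) (fun _ ξ => (((jap ξ)⁻¹ : ℝ) : ℂ)) := by
    refine cls_zero_order (C := 1) contDiff_inv_jap fun ξ => ?_
    rw [Complex.norm_real, Real.norm_of_nonneg (inv_nonneg.2 (jap_pos ξ).le), Real.rpow_neg_one, one_mul]
  intro N
  induction N with
  | zero => exact h0
  | succ N ih =>
    refine h0.succ fun v => ?_
    have h1 : (fun _ : Unit => dirD [v] (fun ξ : Rn n => (((jap ξ)⁻¹ : ℝ) : ℂ))) = fun _ ξ => _ :=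
      funext fun _ => funext fun ξ => dirD_inv_jap v ξ
    rw [h1]
    have hs : Cls (japScale n) univ univ N 1 (fun _ ξ => ∑ i, ((v i : ℝ) : ℂ) * ((ξ i : ℝ) : ℂ)) :=
      Cls.sum isOpen_univ subset_rfl _ fun i _ => (cls_coord i N).const_mul isOpen_univ subset_rfl _
    refine Cls.mono ((ih.mul isOpen_univ subset_rfl (ih.mul isOpen_univ subset_rfl
      (ih.mul isOpen_univ subset_rfl hs))).const_mul isOpen_univ subset_rfl (-1)) ?_
    simp only [japScale]
    norm_num

/-- The projection of frequencies to the open unit ball. -/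
def dir (ξ : Rn n) : Rn n := (jap ξ)⁻¹ • ξ

theorem contDiff_dir : ContDiff ℝ ∞ (dir : Rn n → Rn n) :=
  (contDiff_jap.inv fun ξ => (jap_pos ξ).ne').smul contDiff_id

theorem cls_dir_coord (i : Fin n) (N : ℕ) :
    Cls (japScale n) univ univ N 0 (fun _ ξ => ((dir ξ i : ℝ) : ℂ)) := by
  have h := (cls_inv_jap N).mul isOpen_univ subset_rfl (cls_coord i N)
  rw [neg_add_cancel] at h
  refine h.congr isOpen_univ subset_rfl fun _ ξ _ => ?_
  simp [dir]

theorem dirD_comp_dir {g : Rn n → ℂ} (hg : ContDiff ℝ ∞ g) (v ξ : Rn n) :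
    dirD [v] (fun ξ => g (dir ξ)) ξ =
      ∑ i, dirD [v] (fun ξ => ((dir ξ i : ℝ) : ℂ)) ξ * dirD [unitVec i] g (dir ξ) := by
  have hd := ((contDiff_dir (n := n)).differentiable (by simp) ξ).hasFDerivAt
  have hg' := (hg.differentiable (by simp) (dir ξ)).hasFDerivAt
  have h1 : dirD [v] (fun ξ => g (dir ξ)) ξ = fderiv ℝ g (dir ξ) (fderiv ℝ dir ξ v) :=
    congrArg (fun L => L v) (hg'.comp ξ hd).fderiv
  have h2 : ∀ i, dirD [v] (fun ξ => ((dir ξ i : ℝ) : ℂ)) ξ = ((fderiv ℝ dir ξ v i : ℝ) : ℂ) := fun i =>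
    congrArg (fun L => L v) (((Complex.ofRealCLM.comp
      (EuclideanSpace.proj i : Rn n →L[ℝ] ℝ)).hasFDerivAt.comp ξ hd).fderiv)
  rw [h1]
  conv_lhs => rw [← sum_coord_smul_unitVec (fderiv ℝ dir ξ v)]
  rw [map_sum]
  refine Finset.sum_congr rfl fun i _ => ?_
  rw [h2, map_smul, Complex.real_smul]
  rfl

/-- By the chain rule ∂_v(g ∘ `dir`) is a sum of products of ∂_v `dir`_i, of order -1, and (∂_i g) ∘
`dir`; hence g varies in the induction. Such functions replace symbols homogeneous of degree 0,
which would be singular at the origin. -/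
theorem cls_comp_dir : ∀ (N : ℕ) {g : Rn n → ℂ}, ContDiff ℝ ∞ g →
    (∀ l : List (Rn n), ∃ C : ℝ, ∀ x, ‖dirD l g x‖ ≤ C) →
    Cls (japScale n) univ univ N 0 (fun _ ξ => g (dir ξ)) := by
  have h0 : ∀ {g : Rn n → ℂ}, ContDiff ℝ ∞ g → (∀ l : List (Rn n), ∃ C : ℝ, ∀ x, ‖dirD l g x‖ ≤ C) →
      Cls (japScale n) univ univ 0 0 (fun _ ξ => g (dir ξ)) := fun hg hb => by
    obtain ⟨C, h⟩ := hb []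
    exact cls_zero_order (hg.comp contDiff_dir) fun ξ => by
      simpa [dirD] using h (dir ξ)
  intro N
  induction N with
  | zero => exact fun hg hb => h0 hg hb
  | succ N ih =>
    intro g hg hb
    refine (h0 hg hb).succ fun v => ?_
    have h1 : (fun _ : Unit => dirD [v] (fun ξ : Rn n => g (dir ξ))) = fun _ ξ => _ :=
      funext fun _ => funext fun ξ => dirD_comp_dir hg v ξ
    rw [h1]
    refine Cls.sum isOpen_univ subset_rfl _ fun i _ => ?_
    have h2 := Cls.dirD isOpen_univ (cls_dir_coord i) [v] N
    have h3 := ih (contDiff_dirD hg [unitVec i]) fun l => by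
      obtain ⟨C, h⟩ := hb (l ++ [unitVec i])
      exact ⟨C, fun x => by simpa only [dirD_append] using h x⟩
    refine (h2.mul isOpen_univ subset_rfl h3).mono ?_
    simp

/-- Symbols of order zero that only depend on the frequency. -/
structure FrequencySymbol (ψ : Rn n → ℂ) : Prop where
  contDiff : ContDiff ℝ ∞ ψ
  bound : ∀ l : List (Rn n), ∃ C : ℝ, 0 ≤ C ∧ ∀ ξ, ‖dirD l ψ ξ‖ ≤ C * (jap ξ ^ l.length)⁻¹

theorem frequencySymbol_comp_dir {g : Rn n → ℂ} (hg : ContDiff ℝ ∞ g) (hc : HasCompactSupport g) :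
    FrequencySymbol fun ξ => g (dir ξ) := by
  refine ⟨hg.comp contDiff_dir, fun l => ?_⟩
  have hb : ∀ l : List (Rn n), ∃ C : ℝ, ∀ x, ‖dirD l g x‖ ≤ C := fun l => by
    obtain ⟨C, h⟩ := hc.exists_bound_of_continuousOn (contDiff_dirD hg l).continuous.continuousOn
    refine ⟨|C|, fun x => ?_⟩
    by_cases hx : x ∈ tsupport g
    · exact (h x hx).trans (le_abs_self C)
    · rw [dirD_eq_zero_of_notMem (isClosed_tsupport g) (fun x hx => notMem_tsupport hx) l hx, norm_zero]
      exact abs_nonneg C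
  obtain ⟨C, p, hC, h⟩ := (cls_comp_dir l.length hg hb).2 l le_rfl
  refine ⟨C, hC, fun ξ => ?_⟩
  have := h () ξ trivial
  simp only [japScale, one_pow, mul_one, one_mul, zero_sub] at this
  rwa [← inv_jap_pow_eq] at this

end FrequencySymbols

/-! ### Differentiation under the integral sign -/

section ParametricIntegrals

variable {n : ℕ} {V : Type*} [NormedAddCommGroup V] [NormedSpace ℝ V]

/-- Functions that decrease faster than every power. -/
def RapidDecay (k : Rn n → ℂ) : Prop :=
  ∀ L : ℕ, ∃ C : ℝ, 0 ≤ C ∧ ∀ η, ‖k η‖ ≤ C * (jap η ^ L)⁻¹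

/-- The scale with weight `⟨η⟩` for families depending on a frequency. -/
abbrev freqScale (n : ℕ) (V : Type*) : Scale (Rn n) V :=
  paramScale V jap (fun _ => 1) one_le_jap (fun _ => le_rfl)

theorem RapidDecay.exists_le {k : Rn n → ℂ} (hk : RapidDecay k) {E : V × Rn n → ℂ}
    (hU : UCls (freqScale n V) 0 fun η p => E (p, η)) (l : List V) :
    ∃ C : ℝ, 0 ≤ C ∧ ∀ p η, ‖dirD l (fun p => E (p, η)) p * k η‖ ≤ C * (jap η ^ (n + 1))⁻¹ := by
  obtain ⟨C, q, hC, h⟩ := hU.exists_bound l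
  obtain ⟨D, hD, h'⟩ := hk (q + (n + 1))
  refine ⟨C * D, by positivity, fun p η => ?_⟩
  have hj := jap_pos η
  have h1 := h η p
  rw [Real.one_rpow, mul_one] at h1
  rw [norm_mul]
  calc _ ≤ (C * jap η ^ q) * (D * (jap η ^ (q + (n + 1)))⁻¹) :=
        mul_le_mul h1 (h' η) (norm_nonneg _) (by positivity)
    _ = _ := by
      rw [pow_add]
      field_simp

theorem slice_dirD {E : V × Rn n → ℂ} (hE : ContDiff ℝ ∞ E) (l : List V) (η : Rn n) :
    (fun p => dirD (l.map fun v => (v, (0 : Rn n))) E (p, η)) = dirD l (fun p => E (p, η)) :=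
  (dirD_slice_left hE η l).symm

theorem UCls.slice_dirD {E : V × Rn n → ℂ} (hE : ContDiff ℝ ∞ E)
    (hU : UCls (freqScale n V) 0 fun η p => E (p, η)) (l : List V) :
    UCls (freqScale n V) 0 fun η p => Colombeau.dirD (l.map fun v => (v, (0 : Rn n))) E (p, η) := by
  have h := hU.dirD l
  rw [show (0 : ℝ) - (freqScale n V).δ * l.length = 0 by simp [paramScale]] at h
  have h2 : (fun η p => Colombeau.dirD (l.map fun v => (v, (0 : Rn n))) E (p, η)) =
      fun η => Colombeau.dirD l fun p => E (p, η) := funext fun η => Colombeau.slice_dirD hE l η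
  rw [h2]
  exact h

variable [FiniteDimensional ℝ V]

/-- Dominated differentiation: derivatives of E in p grow at most polynomially in η, uniformly in p,
and the rapid decay of k leaves the integrable majorant ⟨η⟩^{-n-1}. -/
theorem hasFDerivAt_integral_mul {E : V × Rn n → ℂ} (hE : ContDiff ℝ ∞ E)
    (hU : UCls (freqScale n V) 0 fun η p => E (p, η)) {k : Rn n → ℂ} (hkc : Continuous k)
    (hk : RapidDecay k) (p : V) :
    ∃ L : V →L[ℝ] ℂ, HasFDerivAt (fun p => ∫ η, E (p, η) * k η) L p ∧
      ∀ v, L v = ∫ η, dirD [v] (fun p => E (p, η)) p * k η := by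
  have hEc := hE.continuous
  have hdE : Continuous (fderiv ℝ E) := hE.continuous_fderiv (by simp)
  set F' : V → Rn n → V →L[ℝ] ℂ := fun p η =>
    k η • (fderiv ℝ E (p, η)).comp (ContinuousLinearMap.inl ℝ V (Rn n)) with hF'
  have hslice : ∀ p η, HasFDerivAt (fun p => E (p, η))
      ((fderiv ℝ E (p, η)).comp (ContinuousLinearMap.inl ℝ V (Rn n))) p := fun p η =>
    ((hE.differentiable (by simp) (p, η)).hasFDerivAt).comp p (hasFDerivAt_prodMk_left p η)
  have hdir : ∀ p η v, dirD [v] (fun p => E (p, η)) p =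
      (fderiv ℝ E (p, η)).comp (ContinuousLinearMap.inl ℝ V (Rn n)) v := fun p η v =>
    congrArg (fun L => L v) (hslice p η).fderiv
  obtain ⟨C₀, -, h0⟩ := hk.exists_le hU []
  -- The operator norm of the derivative is bounded by finitely many directional derivatives, those
  -- along a basis.
  set B := Module.finBasis ℝ V
  choose C hC h1 using fun i => hk.exists_le hU [B i]
  obtain ⟨c, hc, hB⟩ := B.exists_opNorm_le (F := ℂ)
  have hS : 0 ≤ ∑ i, C i := Finset.sum_nonneg fun i _ => hC i
  have hcont : ∀ p, Continuous (F' p) := fun p => by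
    have : Continuous fun η => (fderiv ℝ E (p, η)).comp (ContinuousLinearMap.inl ℝ V (Rn n)) :=
      (hdE.comp (by fun_prop)).clm_comp continuous_const
    exact hkc.smul this
  have hbound : ∀ p η, ‖F' p η‖ ≤ c * (∑ i, C i) * (jap η ^ (n + 1))⁻¹ := fun p η => by
    have hj := jap_pos η
    rw [mul_assoc]
    refine hB (by positivity) fun i => ?_
    have h2 := h1 i p η
    rw [hdir] at h2
    simp only [hF', _root_.smul_apply, smul_eq_mul]
    rw [mul_comm]
    refine h2.trans ?_
    gcongr
    exact Finset.single_le_sum (fun i _ => hC i) (Finset.mem_univ i)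
  have hint : Integrable fun η : Rn n => c * (∑ i, C i) * (jap η ^ (n + 1))⁻¹ :=
    integrable_inv_jap_pow.const_mul _
  refine ⟨∫ η, F' p η, ?_, fun v => ?_⟩
  · refine hasFDerivAt_integral_of_dominated_of_fderiv_le (F' := F') Filter.univ_mem
      (Filter.Eventually.of_forall fun p => ?_) ?_ (hcont p).aestronglyMeasurable
      (Filter.Eventually.of_forall fun η p _ => hbound p η) hint
      (Filter.Eventually.of_forall fun η p _ => ?_)
    · exact ((hEc.comp (by fun_prop)).mul hkc).aestronglyMeasurable
    · exact integrable_of_le_inv_jap ((hEc.comp (by fun_prop)).mul hkc) (h0 p)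
    · exact (hslice p η).mul_const (k η)
  · rw [ContinuousLinearMap.integral_apply (hint.mono' (hcont p).aestronglyMeasurable
      (Filter.Eventually.of_forall (hbound p)))]
    congr 1
    funext η
    rw [hdir]
    simp only [hF', _root_.smul_apply, smul_eq_mul]
    ring

theorem contDiff_integral_mul {E : V × Rn n → ℂ} (hE : ContDiff ℝ ∞ E)
    (hU : UCls (freqScale n V) 0 fun η p => E (p, η)) {k : Rn n → ℂ} (hkc : Continuous k)
    (hk : RapidDecay k) : ContDiff ℝ ∞ fun p => ∫ η, E (p, η) * k η := by
  rw [contDiff_infty]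
  intro m
  induction m generalizing E with
  | zero =>
    rw [Nat.cast_zero, contDiff_zero, continuous_iff_continuousAt]
    intro p
    obtain ⟨L, hL, -⟩ := hasFDerivAt_integral_mul hE hU hkc hk p
    exact hL.continuousAt
  | succ m ih =>
    rw [Nat.cast_succ, contDiff_succ_iff_fderiv_apply]
    refine ⟨fun p => ?_, by simp, fun v => ?_⟩
    · obtain ⟨L, hL, -⟩ := hasFDerivAt_integral_mul hE hU hkc hk p
      exact hL.differentiableAt
    · have h1 : (fun p => fderiv ℝ (fun p => ∫ η, E (p, η) * k η) p v) =
          fun p => ∫ η, dirD ([v].map fun v => (v, (0 : Rn n))) E (p, η) * k η := by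
        funext p
        obtain ⟨L, hL, h⟩ := hasFDerivAt_integral_mul hE hU hkc hk p
        rw [hL.fderiv, h]
        congr 1
        funext η
        rw [← congrFun (slice_dirD hE [v] η) p]
      rw [h1]
      exact ih (contDiff_dirD hE _) (hU.slice_dirD hE [v])

theorem dirD_integral_mul {E : V × Rn n → ℂ} (hE : ContDiff ℝ ∞ E)
    (hU : UCls (freqScale n V) 0 fun η p => E (p, η)) {k : Rn n → ℂ} (hkc : Continuous k)
    (hk : RapidDecay k) : ∀ l : List V, dirD l (fun p => ∫ η, E (p, η) * k η) =
      fun p => ∫ η, dirD l (fun p => E (p, η)) p * k η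
  | [] => rfl
  | v :: l => by
    funext p
    simp only [dirD, dirD_integral_mul hE hU hkc hk l]
    have h1 : (fun p => ∫ η, dirD l (fun p => E (p, η)) p * k η) =
        fun p => ∫ η, dirD (l.map fun v => (v, (0 : Rn n))) E (p, η) * k η := by
      funext p
      congr 1
      funext η
      rw [← congrFun (slice_dirD hE l η) p]
    obtain ⟨L, hL, h⟩ := hasFDerivAt_integral_mul (contDiff_dirD hE (l.map fun v => (v, (0 : Rn n))))
      (hU.slice_dirD hE l) hkc hk p
    rw [h1, hL.fderiv, h]
    congr 1
    funext η
    rw [slice_dirD hE l η]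
    rfl

end ParametricIntegrals
/-! ### Localized Fourier multipliers as pseudodifferential operators -/

section ConeSymbol

variable {n : ℕ}

theorem FrequencySymbol.exists_norm_le {ψ : Rn n → ℂ} (hψ : FrequencySymbol ψ) :
    ∃ C : ℝ, 0 ≤ C ∧ ∀ ξ, ‖ψ ξ‖ ≤ C := by
  obtain ⟨C, hC, h⟩ := hψ.bound []
  exact ⟨C, hC, fun ξ => by simpa [dirD] using h ξ⟩

theorem FrequencySymbol.uCls_translate {ψ : Rn n → ℂ} (hψ : FrequencySymbol ψ) :
    UCls (freqScale n (Rn n)) 0 fun η ξ => ψ (η + ξ) := by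
  refine UCls.of_exists_bound (fun η => hψ.contDiff.comp (contDiff_const.add contDiff_id)) fun l => ?_
  obtain ⟨C, hC, h⟩ := hψ.bound l
  refine ⟨C, 0, fun η ξ => ?_⟩
  have h1 := congrFun (dirD_comp_affine hψ.contDiff (ContinuousLinearMap.id ℝ (Rn n)) η l) ξ
  simp only [ContinuousLinearMap.coe_id', id_eq, List.map_id] at h1
  rw [h1, pow_zero, mul_one, Real.one_rpow, mul_one]
  exact (h _).trans (mul_le_of_le_one_right hC (inv_le_one_of_one_le₀ (one_le_pow₀ (one_le_jap _))))

theorem FrequencySymbol.uCls_wave_mul {ψ : Rn n → ℂ} (hψ : FrequencySymbol ψ) :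
    UCls (freqScale n (Rn n × Rn n)) 0 fun η p => wave p.1 η * ψ (η + p.2) := by
  have h1 : UCls (freqScale n (Rn n)) 0 fun η x => wave x η := uCls_wave fun η => norm_le_jap η
  have h := (h1.comp_clm (ContinuousLinearMap.fst ℝ (Rn n) (Rn n))).mul
    (hψ.uCls_translate.comp_clm (ContinuousLinearMap.snd ℝ (Rn n) (Rn n)))
  rw [add_zero] at h
  exact h

/-- The amplitude `∫ e^{ixη} ψ(η + ξ) k(η) dη`. -/
def convAmp (ψ k : Rn n → ℂ) (p : Rn n × Rn n) : ℂ := ∫ η, (wave p.1 η * ψ (η + p.2)) * k η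

/-- Peetre's inequality moves the decay of ∂^α ψ from η + ξ to ξ at the price ⟨η⟩^{|α|}; derivatives
of the wave in x cost ⟨η⟩^{|β|}. The rapid decay of k pays for both. -/
theorem FrequencySymbol.globalSymbols_convAmp {ψ k : Rn n → ℂ} (hψ : FrequencySymbol ψ)
    (hkc : Continuous k) (hk : RapidDecay k) :
    GlobalSymbols (fun _ : Unit => 1) fun _ => convAmp ψ k := by
  have hE : ContDiff ℝ ∞ fun q : (Rn n × Rn n) × Rn n => wave q.1.1 q.2 * ψ (q.2 + q.1.2) :=
    (contDiff_wave_comp (contDiff_fst.comp contDiff_fst) contDiff_snd).mul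
      (hψ.contDiff.comp (contDiff_snd.add (contDiff_snd.comp contDiff_fst)))
  refine ⟨fun _ => contDiff_integral_mul hE hψ.uCls_wave_mul hkc hk, fun α β => ?_⟩
  have h0 : 0 ≤ (β.map norm).prod := List.prod_nonneg fun a ha => by
    obtain ⟨v, -, rfl⟩ := List.mem_map.1 ha
    exact norm_nonneg v
  obtain ⟨C, hC, hα⟩ := hψ.bound α
  obtain ⟨D, hD, hk'⟩ := hk (β.length + α.length + (n + 1))
  set I : ℝ := ∫ η : Rn n, (jap η ^ (n + 1))⁻¹
  have hI : 0 ≤ I := integral_nonneg fun η => inv_nonneg.2 (pow_nonneg (jap_pos η).le _)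
  set B : ℝ := (β.map norm).prod * (C * 2 ^ α.length) * D with hB
  refine ⟨B * I, by positivity, fun _ p => ?_⟩
  obtain ⟨x, ξ⟩ := p
  have hjξ := jap_pos ξ
  have h1 : symD α β (convAmp ψ k) (x, ξ) = ∫ η, (dirD β (fun x => wave x η) x *
      dirD α (fun ξ => ψ (η + ξ)) ξ) * k η := by
    rw [symD, show convAmp ψ k = fun p => ∫ η, (wave p.1 η * ψ (η + p.2)) * k η from rfl,
      dirD_integral_mul hE hψ.uCls_wave_mul hkc hk]
    beta_reduce
    congr 1
    funext η
    have h2 := dirD_fst_snd_mul (f := fun x => wave x η) (g := fun ξ => ψ (η + ξ))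
      (contDiff_wave_comp contDiff_id contDiff_const)
      (hψ.contDiff.comp (contDiff_const.add contDiff_id)) α β
    exact congrArg (· * k η) (congrFun h2 (x, ξ))
  rw [h1]
  have h2 : ∀ η, ‖(dirD β (fun x => wave x η) x * dirD α (fun ξ => ψ (η + ξ)) ξ) * k η‖ ≤
      B * (jap ξ ^ α.length)⁻¹ * (jap η ^ (n + 1))⁻¹ := fun η => by
    have hjη := jap_pos η
    have h3 : ‖dirD β (fun x => wave x η) x‖ ≤ (β.map norm).prod * jap η ^ β.length := by
      rw [dirD_wave_left, norm_mul, norm_wave, mul_one]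
      refine (norm_prod_inner_le η β).trans ?_
      gcongr
      exact norm_le_jap η
    have h4 : ‖dirD α (fun ξ => ψ (η + ξ)) ξ‖ ≤
        C * (2 ^ α.length * (jap ξ ^ α.length)⁻¹ * jap η ^ α.length) := by
      have h1 := congrFun (dirD_comp_affine hψ.contDiff (ContinuousLinearMap.id ℝ (Rn n)) η α) ξ
      simp only [ContinuousLinearMap.coe_id', id_eq, List.map_id] at h1
      rw [h1]
      refine (hα _).trans ?_
      gcongr
      rw [← inv_pow, ← inv_pow, ← mul_pow, ← mul_pow, add_comm η]
      exact pow_le_pow_left₀ (inv_nonneg.2 (jap_pos _).le) (inv_jap_add_le ξ η) _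
    rw [norm_mul, norm_mul]
    calc _ ≤ ((β.map norm).prod * jap η ^ β.length) *
          (C * (2 ^ α.length * (jap ξ ^ α.length)⁻¹ * jap η ^ α.length)) *
          (D * (jap η ^ (β.length + α.length + (n + 1)))⁻¹) := by
            gcongr
            exact hk' η
      _ = _ := by
        rw [hB, pow_add _ (β.length + α.length), pow_add _ β.length]
        field_simp
  refine (norm_integral_le_of_norm_le (integrable_inv_jap_pow.const_mul _)
    (Filter.Eventually.of_forall h2)).trans (le_of_eq ?_)
  rw [integral_const_mul]
  ring

theorem GlobalSymbols.fst_mul {b : Rn n × Rn n → ℂ} (hb : GlobalSymbols (fun _ : Unit => 1) fun _ => b)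
    {φ : Rn n → ℂ} (hφ : ContDiff ℝ ∞ φ) (hφc : HasCompactSupport φ) :
    GlobalSymbols (fun _ : Unit => 1) fun _ p => φ p.1 * b p := by
  have hs : ContDiff ℝ ∞ fun p : Rn n × Rn n => φ p.1 * b p :=
    (hφ.comp contDiff_fst).mul (hb.contDiff ())
  refine ⟨fun _ => hs, fun α β => ?_⟩
  have h1 := (UCls.of_hasCompactSupport rfl hφ hφc fun x hx => notMem_tsupport hx).mul
    (hb.uCls (fun _ => le_rfl) (fun _ : Rn n => ()) id α)
  obtain ⟨C, p, hC, h⟩ := h1.exists_bound β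
  refine ⟨C, hC, fun _ q => ?_⟩
  obtain ⟨x, ξ⟩ := q
  have h2 := h ξ x
  have h3 := congrFun (symD_append hs α β ξ) x
  simp only [symD_fst_mul (hb.contDiff ()) hφ] at h3
  simp only [one_pow, mul_one, zero_add, id_eq] at h2
  rw [← h3, mul_one, inv_jap_pow_eq]
  exact h2

theorem GlobalSymbols.mem_slowScaleSymbols {a : Rn n × Rn n → ℂ}
    (ha : GlobalSymbols (fun _ : Unit => 1) fun _ => a) (Ω : Opens (Rn n)) :
    (fun _ => a) ∈ slowScaleSymbols Ω 0 := by
  refine ⟨fun _ => (ha.contDiff ()).contDiffOn, fun K _ _ => ⟨_, one_mem_slowScale, fun α β => ?_⟩⟩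
  obtain ⟨C, hC, h⟩ := ha.bound α β
  refine ⟨C + 1, by positivity, fun _ x _ ξ => ?_⟩
  have h1 := h () (x, ξ)
  have hj := pow_pos (jap_pos ξ) α.length
  rw [neg_zero, zero_add, Real.rpow_natCast]
  calc _ ≤ jap ξ ^ α.length * (C * 1 * (jap ξ ^ α.length)⁻¹) := by gcongr
    _ = C := by field_simp
    _ ≤ _ := by linarith

theorem rapidDecay_fourierHat {f : Rn n → ℂ} (hf : ContDiff ℝ ∞ f) (hc : HasCompactSupport f) :
    RapidDecay (fourierHat f) :=
  fun L => exists_fourierHat_le hf hc (fun _ hx => notMem_tsupport hx) L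

theorem continuous_fourierHat_of_hasCompactSupport {f : Rn n → ℂ} (hf : Continuous f)
    (hc : HasCompactSupport f) : Continuous (fourierHat f) :=
  continuous_fourierHat hf hc fun _ hx => notMem_tsupport hx

/-- The symbol of the operator `φ ψ(D) φ`. -/
def coneSymbol (φ ψ : Rn n → ℂ) (p : Rn n × Rn n) : ℂ :=
  (((2 * Real.pi : ℝ) : ℂ)⁻¹ ^ n * φ p.1) * convAmp ψ (fourierHat φ) p

theorem globalSymbols_coneSymbol {φ ψ : Rn n → ℂ} (hφ : ContDiff ℝ ∞ φ) (hφc : HasCompactSupport φ)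
    (hψ : FrequencySymbol ψ) : GlobalSymbols (fun _ : Unit => 1) fun _ => coneSymbol φ ψ :=
  (hψ.globalSymbols_convAmp (continuous_fourierHat_of_hasCompactSupport hφ.continuous hφc)
    (rapidDecay_fourierHat hφ hφc)).fst_mul (contDiff_const.mul hφ) hφc.mul_left

/-- Interchanging integrals after ζ = η + ξ, the convolution of the transforms of φ and f appears,
which is the transform of φf. Thus the operator is φ ψ(D) φ, and its second cut-off localises f. -/
theorem pseudo_coneSymbol {φ ψ f : Rn n → ℂ} (hφ : ContDiff ℝ ∞ φ) (hφc : HasCompactSupport φ)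
    (hψ : FrequencySymbol ψ) (hf : ContDiff ℝ ∞ f) (hfc : HasCompactSupport f) (x : Rn n) :
    pseudo (coneSymbol φ ψ) f x = φ x * (((2 * Real.pi : ℝ) : ℂ)⁻¹ ^ n *
      ∫ ζ, wave x ζ * (ψ ζ * fourierHat (fun y => φ y * f y) ζ)) := by
  set z : ℂ := ((2 * Real.pi : ℝ) : ℂ)⁻¹ ^ n with hz
  set g : Rn n → ℂ := fun ζ => wave x ζ * ψ ζ with hg
  have hφi := integrable_fourierHat hφ hφc fun _ hx => notMem_tsupport hx
  have hfi := integrable_fourierHat hf hfc fun _ hx => notMem_tsupport hx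
  obtain ⟨C, hC, hψC⟩ := hψ.exists_norm_le
  have hgc : Continuous g := by
    have := hψ.contDiff.continuous
    fun_prop
  have hgC : ∀ ζ, ‖g ζ‖ ≤ C := fun ζ => by
    rw [hg, norm_mul, norm_wave, one_mul]
    exact hψC ζ
  have hint : Integrable (Function.uncurry fun (ζ ξ : Rn n) =>
      g ζ * (fourierHat f ξ * fourierHat φ (ζ - ξ))) (volume.prod volume) := by
    have h1 := hfi.convolution_integrand (ContinuousLinearMap.mul ℝ ℂ) hφi
    have h2 : Continuous fun p : Rn n × Rn n => g p.1 := hgc.comp continuous_fst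
    exact h1.bdd_mul h2.aestronglyMeasurable (Filter.Eventually.of_forall fun p => hgC p.1)
  have h1 : ∀ ξ, wave x ξ * coneSymbol φ ψ (x, ξ) * fourierHat f ξ =
      (z * φ x) * ∫ ζ, g ζ * (fourierHat f ξ * fourierHat φ (ζ - ξ)) := fun ξ => by
    have h2 : wave x ξ * convAmp ψ (fourierHat φ) (x, ξ) = ∫ ζ, g ζ * fourierHat φ (ζ - ξ) := by
      rw [convAmp, ← integral_const_mul, ← integral_add_right_eq_self (fun ζ => g ζ * fourierHat φ (ζ - ξ)) ξ]
      congr 1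
      funext η
      simp only [hg, wave_add_right, add_sub_cancel_right]
      ring
    calc _ = (z * φ x) * (fourierHat f ξ * (wave x ξ * convAmp ψ (fourierHat φ) (x, ξ))) := by
          rw [coneSymbol]
          ring
      _ = _ := by
        rw [h2, ← integral_const_mul (fourierHat f ξ)]
        congr 2
        funext ζ
        ring
  rw [pseudo_eq]
  simp only [h1]
  rw [integral_const_mul, ← integral_integral_swap hint]
  have h2 : ∀ ζ, ∫ ξ, g ζ * (fourierHat f ξ * fourierHat φ (ζ - ξ)) = g ζ * ∫ ξ, fourierHat φ (ζ - ξ) * fourierHat f ξ :=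
    fun ζ => by
      rw [integral_const_mul]
      congr 2
      funext ξ
      ring
  have h3 : ∀ ζ, wave x ζ * (ψ ζ * fourierHat (fun y => φ y * f y) ζ) =
      z * (g ζ * ∫ ξ, fourierHat φ (ζ - ξ) * fourierHat f ξ) := fun ζ => by
    rw [fourierHat_mul hφ hφc (fun _ hx => notMem_tsupport hx)
      (integrable_of_compact hf.continuous hfc fun _ hx => notMem_tsupport hx)]
    simp only [hg]
    ring
  simp only [h2, h3]
  rw [integral_const_mul]
  ring

/-! ### Kernel supports and negligible changes of the symbol -/

theorem norm_pseudo_le {d : Rn n × Rn n → ℂ} {f : Rn n → ℂ} {x : Rn n} {D B : ℝ} (hD : 0 ≤ D)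
    (hd : ∀ ξ, ‖d (x, ξ)‖ ≤ D) (hf : ∀ ξ, jap ξ ^ (n + 1) * ‖fourierHat f ξ‖ ≤ B) :
    ‖pseudo d f x‖ ≤ ‖((2 * Real.pi : ℝ) : ℂ)⁻¹ ^ n‖ * (D * B * ∫ ξ : Rn n, (jap ξ ^ (n + 1))⁻¹) := by
  rw [pseudo_eq, norm_mul]
  gcongr
  rw [← integral_const_mul]
  refine norm_integral_le_of_norm_le (integrable_inv_jap_pow.const_mul _)
    (Filter.Eventually.of_forall fun ξ => ?_)
  have hj := pow_pos (jap_pos ξ) (n + 1)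
  rw [norm_mul, norm_mul, norm_wave, one_mul, mul_assoc]
  refine mul_le_mul (hd ξ) ?_ (norm_nonneg _) hD
  rw [← div_eq_mul_inv, le_div_iff₀ hj, mul_comm]
  exact hf ξ

theorem pseudo_sub {a b : Rn n × Rn n → ℂ} {f : Rn n → ℂ} {x : Rn n}
    (ha : Continuous fun ξ => a (x, ξ)) (hb : Continuous fun ξ => b (x, ξ)) {C D : ℝ}
    (haC : ∀ ξ, ‖a (x, ξ)‖ ≤ C) (hbD : ∀ ξ, ‖b (x, ξ)‖ ≤ D) (hf : ContDiff ℝ ∞ f)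
    (hfc : HasCompactSupport f) : pseudo (a - b) f x = pseudo a f x - pseudo b f x := by
  have hi := integrable_fourierHat hf hfc fun _ hx => notMem_tsupport hx
  have hint : ∀ {a : Rn n × Rn n → ℂ} {C : ℝ}, (Continuous fun ξ => a (x, ξ)) → (∀ ξ, ‖a (x, ξ)‖ ≤ C) →
      Integrable fun ξ => wave x ξ * a (x, ξ) * fourierHat f ξ := fun {a C} ha haC => by
    have hc : Continuous fun ξ => wave x ξ * a (x, ξ) :=
      (continuous_wave_comp continuous_const continuous_id).mul ha
    exact hi.bdd_mul hc.aestronglyMeasurable (Filter.Eventually.of_forall fun ξ => by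
      rw [norm_mul, norm_wave, one_mul]
      exact haC ξ)
  rw [pseudo_eq, pseudo_eq, pseudo_eq, ← mul_sub, ← integral_sub (hint ha haC) (hint hb hbD)]
  congr 2
  funext ξ
  simp only [Pi.sub_apply]
  ring

/-- By definition the support is only relatively closed in Ω × Ω; lying in a closed set contained in
Ω × Ω makes it closed. -/
theorem isClosed_kernelSupport {Ω : Opens (Rn n)} {m : ℝ} {A : Symbol Ω m} {S : Set (Rn n × Rn n)}
    (hS : IsClosed S) (hSΩ : S ⊆ opensProd Ω Ω) (h : kernelSupport A ⊆ S) :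
    IsClosed (kernelSupport A) := by
  rw [← isOpen_compl_iff, isOpen_iff_forall_mem_open]
  intro p hp
  by_cases hpS : p ∈ S
  · have hpΩ : p ∈ opensProd Ω Ω := hSΩ hpS
    by_contra hcon
    refine hp ⟨hpΩ, fun W hW hWΩ => ?_⟩
    by_contra hW'
    exact hcon ⟨W, fun q hq hqA => hW' (hqA.2 W hq hWΩ), W.isOpen, hW⟩
  · exact ⟨Sᶜ, fun q hq hqA => hq (h hqA), hS.isOpen_compl, hpS⟩

/-- The support is tested with all representatives, whereas the vanishing is known for the constant
net a. The difference of representatives is O(ε^k) for every k, and the partial Fourier transforms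
of a test net decay with moderate constants, so the kernel is still negligible. -/
theorem kernelSupport_subset {Ω : Opens (Rn n)} {A : Symbol Ω 0} {a : Rn n × Rn n → ℂ}
    (ha : IsSymRep (fun _ => a) A) {S : Set (Rn n × Rn n)} (hS : IsClosed S)
    (h : ∀ (f : Rn n → ℂ) (x : Rn n), ContDiff ℝ ∞ f → HasCompactSupport f →
      (∀ y, (x, y) ∈ S → f y = 0) → pseudo a f x = 0) : kernelSupport A ⊆ S := by
  rintro p ⟨hpΩ, hp⟩
  by_contra hpS
  obtain ⟨a', v, ha', ⟨hv, K, hK, hKW, hv0⟩, hneg⟩ := hp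
    ⟨(opensProd Ω Ω : Set (Rn n × Rn n)) ∩ Sᶜ, (opensProd Ω Ω).isOpen.inter hS.isOpen_compl⟩
    ⟨hpΩ, hpS⟩ fun q hq => hq.1
  refine hneg fun q => ?_
  have hvs : ∀ ε, ContDiff ℝ ∞ (v ε) := fun ε =>
    contDiff_of_contDiffOn_of_compact (Opens.isOpen _) hK.isClosed hKW (hv.1 ε) (hv0 ε)
  set K₁ := Prod.fst '' K with hK₁
  set K₂ := Prod.snd '' K with hK₂
  have hK₁c : IsCompact K₁ := hK.image continuous_fst
  have hK₂c : IsCompact K₂ := hK.image continuous_snd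
  have hK₁Ω : K₁ ⊆ Ω := by
    rintro _ ⟨r, hr, rfl⟩
    exact (hKW hr).1.1
  have hv1 : ∀ ε x y, x ∉ K₁ → v ε (x, y) = 0 := fun ε x y hx => hv0 ε _ fun hxy => hx ⟨_, hxy, rfl⟩
  have hv2 : ∀ ε x y, y ∉ K₂ → v ε (x, y) = 0 := fun ε x y hy => hv0 ε _ fun hxy => hy ⟨_, hxy, rfl⟩
  have hvx : ∀ ε x, ContDiff ℝ ∞ fun y => v ε (x, y) := fun ε x =>
    (hvs ε).comp (contDiff_const.prodMk contDiff_id)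
  have hvc : ∀ ε x, HasCompactSupport fun y => v ε (x, y) := fun ε x =>
    HasCompactSupport.intro hK₂c fun y hy => hv2 ε x y hy
  -- uniform decay of the partial Fourier transforms
  set ls : List (List (Rn n × Rn n)) :=
    [] :: (List.finRange n).map fun i => List.replicate (n + 1) ((0 : Rn n), unitVec i) with hls
  obtain ⟨M, hM⟩ := exists_bigOOn_forall (hv.2 K hK hKW) ls
  have hMl : ∀ l ∈ ls, ∃ C : ℝ, 0 ≤ C ∧ ∀ᶠ ε in smallEps, ∀ r, ‖dirD l (v ε) r‖ ≤ C * (ε : ℝ) ^ (-M) := by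
    intro l hl
    obtain ⟨C, hC, H⟩ := (hM l hl).exists_nonneg
    refine ⟨C, hC, H.mono fun ε hε r => ?_⟩
    have := ε.rpow_pos (-M)
    by_cases hr : r ∈ K
    · exact hε r hr
    · rw [dirD_eq_zero_of_notMem hK.isClosed (hv0 ε) l hr, norm_zero]
      positivity
  obtain ⟨C₀, hC₀, H0⟩ := hMl [] (by simp [hls])
  choose C hC H using fun i => hMl (List.replicate (n + 1) ((0 : Rn n), unitVec i)) (by
    simp [hls])
  have hsum : 0 ≤ ∑ i, C i := Finset.sum_nonneg fun i _ => hC i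
  -- With this k the factor ε^k beats the growth ε^{-M} of the test net and leaves ε^q.
  set k := ⌈q + M⌉₊ with hk
  obtain ⟨c, hc, hd⟩ := isSymRep_sub ha' ha hK₁c hK₁Ω [] [] k
  set B := (n + 1 : ℝ) ^ (n + 1) * (n + 1) * volume.real K₂ with hB
  have hB0 : 0 ≤ B := by positivity
  set I : ℝ := ∫ ξ : Rn n, (jap ξ ^ (n + 1))⁻¹
  have hI : 0 ≤ I := integral_nonneg fun η => inv_nonneg.2 (pow_nonneg (jap_pos η).le _)
  refine ⟨‖((2 * Real.pi : ℝ) : ℂ)⁻¹ ^ n‖ * (c * (B * (C₀ + ∑ i, C i)) * I) * volume.real K₁,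
    eventually_smallEps.1 ?_⟩
  filter_upwards [H0, Filter.eventually_all.2 H] with ε H0 H
  have hε0 : (0 : ℝ) < ε := ε.2.1
  have hεM := ε.rpow_pos (-M)
  have hF : ∀ x ξ, jap ξ ^ (n + 1) * ‖fourierHat (fun y => v ε (x, y)) ξ‖ ≤
      B * ((C₀ + ∑ i, C i) * (ε : ℝ) ^ (-M)) := fun x ξ => by
    refine jap_pow_mul_fourierHat_le (hvx ε x) hK₂c (hv2 ε x) (n + 1) (fun y => ?_) (fun i y => ?_) ξ
    · refine (H0 (x, y)).trans ?_
      gcongr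
      linarith
    · rw [dirD_slice_right (hvs ε) x, List.map_replicate]
      refine (H i (x, y)).trans ?_
      gcongr
      exact (Finset.single_le_sum (fun i _ => hC i) (Finset.mem_univ i)).trans (by linarith)
  have hps : ∀ x ∈ K₁, ‖pseudo (a' ε) (fun y => v ε (x, y)) x‖ ≤
      ‖((2 * Real.pi : ℝ) : ℂ)⁻¹ ^ n‖ * (c * (ε : ℝ) ^ k * (B * ((C₀ + ∑ i, C i) * (ε : ℝ) ^ (-M))) * I) := by
    intro x hx
    have hslice : ∀ {a : Eps → Rn n × Rn n → ℂ}, a ∈ slowScaleSymbols Ω 0 →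
        (Continuous fun ξ => a ε (x, ξ)) ∧ ∃ C : ℝ, ∀ ξ, ‖a ε (x, ξ)‖ ≤ C := fun {a} ha => by
      refine ⟨continuous_iff_continuousAt.2 fun ξ => ?_, ?_⟩
      · have hmem : (x, ξ) ∈ phaseSpace Ω := mk_mem_prod (hK₁Ω hx) trivial
        exact ((ha.1 ε).continuousOn.continuousAt ((phaseSpace Ω).isOpen.mem_nhds hmem)).comp
          (Continuous.prodMk_right x).continuousAt
      · obtain ⟨w, -, hw⟩ := ha.2 K₁ hK₁c hK₁Ω
        obtain ⟨c, -, hw⟩ := hw [] []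
        refine ⟨c * w ε, fun ξ => ?_⟩
        have := hw ε x hx ξ
        simpa [symD, dirD] using this
    obtain ⟨hc1, C1, hb1⟩ := hslice ha'.1
    obtain ⟨hc2, C2, hb2⟩ := hslice ha.1
    have h1 := pseudo_sub hc1 hc2 hb1 hb2 (hvx ε x) (hvc ε x)
    rw [h (fun y => v ε (x, y)) x (hvx ε x) (hvc ε x) fun y hy => hv0 ε _ fun hxy => (hKW hxy).2 hy,
      sub_zero] at h1
    rw [← h1]
    refine norm_pseudo_le (by positivity) (fun ξ => ?_) (hF x)
    have := hd ε x hx ξ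
    simpa [symD, dirD] using this
  have hker : kernel Ω a' v ε = ∫ x, pseudo (a' ε) (fun y => v ε (x, y)) x := by
    rw [kernel, setIntegral_eq_integral_of_forall_compl_eq_zero]
    exact fun x hx => pseudo_zero (fun y => hv1 ε x y fun h => hx (hK₁Ω h)) x
  rw [hker]
  refine (norm_integral_le_of_compact hK₁c (fun x hx => pseudo_zero (fun y => hv1 ε x y hx) x) hps).trans ?_
  have hpow : (ε : ℝ) ^ k * (ε : ℝ) ^ (-M) ≤ (ε : ℝ) ^ q := by
    rw [← Real.rpow_natCast, ← Real.rpow_add hε0]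
    refine Real.rpow_le_rpow_of_exponent_ge hε0 ε.2.2 ?_
    have := Nat.le_ceil (q + M)
    linarith
  calc _ = ‖((2 * Real.pi : ℝ) : ℂ)⁻¹ ^ n‖ * (c * (B * (C₀ + ∑ i, C i)) * I) * volume.real K₁ *
        ((ε : ℝ) ^ k * (ε : ℝ) ^ (-M)) := by ring
    _ ≤ _ := by gcongr

end ConeSymbol
/-! ### Elliptic operators at points of microlocal regularity -/

section EllipticOperators

variable {n : ℕ}

/-- Derivatives in x only produce powers of ⟨ζ⟩, absorbed by the hypothesis with a larger L but the
same N. In this way regularity in a cone becomes a 𝒢^∞ estimate. -/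
theorem bigOOn_dirD_integral_wave {ψ : Rn n → ℂ} (hψ : FrequencySymbol ψ) {v : Eps → Rn n → ℂ}
    (hv : ∀ ε, ContDiff ℝ ∞ (v ε)) (hvc : ∀ ε, HasCompactSupport (v ε)) {N : ℝ}
    (hreg : ∀ L : ℕ, BigOOn {ξ | ψ ξ ≠ 0} (fun ε ξ => ((jap ξ ^ L : ℝ) : ℂ) * fourierHat (v ε) ξ) (-N)) :
    (∀ ε, ContDiff ℝ ∞ fun x => ∫ ζ, wave x ζ * (ψ ζ * fourierHat (v ε) ζ)) ∧
    ∀ (K : Set (Rn n)) (l : List (Rn n)),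
      BigOOn K (fun ε => dirD l fun x => ∫ ζ, wave x ζ * (ψ ζ * fourierHat (v ε) ζ)) (-N) := by
  obtain ⟨D, hD, hψD⟩ := hψ.exists_norm_le
  have hU : UCls (freqScale n (Rn n)) 0 fun η x => wave x η := uCls_wave fun η => norm_le_jap η
  have hc : ∀ ε, Continuous fun ζ => ψ ζ * fourierHat (v ε) ζ := fun ε =>
    hψ.contDiff.continuous.mul (continuous_fourierHat_of_hasCompactSupport (hv ε).continuous (hvc ε))
  have hd : ∀ ε, RapidDecay fun ζ => ψ ζ * fourierHat (v ε) ζ := fun ε L => by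
    obtain ⟨C, hC, h⟩ := rapidDecay_fourierHat (hv ε) (hvc ε) L
    refine ⟨D * C, by positivity, fun η => ?_⟩
    rw [norm_mul, mul_assoc]
    exact mul_le_mul (hψD η) (h η) (norm_nonneg _) hD
  refine ⟨fun ε => contDiff_integral_mul contDiff_wave hU (hc ε) (hd ε), fun K l => ?_⟩
  obtain ⟨C, q, hC, hl⟩ := hU.exists_bound l
  obtain ⟨B, hB, h⟩ := (hreg (q + (n + 1))).exists_nonneg
  refine bigOOn_iff.2 ⟨C * (D * B) * ∫ ξ : Rn n, (jap ξ ^ (n + 1))⁻¹, h.mono fun ε hε x _ => ?_⟩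
  have hpos := ε.rpow_pos (-N)
  rw [dirD_integral_mul contDiff_wave hU (hc ε) (hd ε) l]
  have hle : ∀ ζ, ‖dirD l (fun x => wave x ζ) x * (ψ ζ * fourierHat (v ε) ζ)‖ ≤
      C * (D * B) * (ε : ℝ) ^ (-N) * (jap ζ ^ (n + 1))⁻¹ := fun ζ => by
    have hj := jap_pos ζ
    by_cases hζ : ψ ζ = 0
    · rw [hζ, zero_mul, mul_zero, norm_zero]
      positivity
    have h1 := hε ζ hζ
    rw [norm_mul, Complex.norm_real, Real.norm_of_nonneg (by positivity)] at h1
    have h2 := hl ζ x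
    rw [Real.one_rpow, mul_one] at h2
    have hj' : (0 : ℝ) < jap ζ ^ (n + 1) := by positivity
    rw [← div_eq_mul_inv, le_div_iff₀ hj', norm_mul, norm_mul]
    calc _ ≤ (C * jap ζ ^ q) * (D * ‖fourierHat (v ε) ζ‖) * jap ζ ^ (n + 1) := by
          gcongr
          exact hψD ζ
      _ = C * D * (jap ζ ^ (q + (n + 1)) * ‖fourierHat (v ε) ζ‖) := by ring
      _ ≤ C * D * (B * (ε : ℝ) ^ (-N)) := by gcongr
      _ = _ := by ring
  refine (norm_integral_le_of_norm_le (integrable_inv_jap_pow.const_mul _)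
    (Filter.Eventually.of_forall hle)).trans (le_of_eq ?_)
  rw [integral_const_mul]
  ring

theorem exists_isProperCutoff {Ω : Opens (Rn n)} {S : Set (Rn n)} (hS : IsCompact S) (hSΩ : S ⊆ Ω) :
    ∃ β : Rn n → ℂ, ContDiff ℝ ∞ β ∧ HasCompactSupport β ∧ tsupport β ⊆ Ω ∧ (∀ x ∈ S, β x = 1) ∧
      ∀ C ⊆ S ×ˢ S, IsProperCutoff Ω C fun p => β p.1 * β p.2 := by
  obtain ⟨β, hβ, hβc, hβΩ, O, hO, hSO, hβ1⟩ := exists_cutoff hS Ω.isOpen hSΩ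
  refine ⟨β, hβ, hβc, hβΩ, fun x hx => hβ1 x (hSO hx), fun C hC => ⟨?_, ?_, ?_, ?_⟩⟩
  · exact ((hβ.comp contDiff_fst).mul (hβ.comp contDiff_snd)).contDiffOn
  · intro p hp
    by_contra h
    exact hp ⟨hβΩ (subset_tsupport β (left_ne_zero_of_mul h)),
      hβΩ (subset_tsupport β (right_ne_zero_of_mul h))⟩
  · have hQ : closure (Function.support fun p : Rn n × Rn n => β p.1 * β p.2) ⊆ tsupport β ×ˢ tsupport β :=
      closure_minimal (fun p hp => ⟨subset_tsupport β (left_ne_zero_of_mul hp),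
        subset_tsupport β (right_ne_zero_of_mul hp)⟩) (hβc.isClosed.prod hβc.isClosed)
    have hQΩ : closure (Function.support fun p : Rn n × Rn n => β p.1 * β p.2) ⊆
        (opensProd Ω Ω : Opens (Rn n × Rn n)) := fun p hp => ⟨hβΩ (hQ hp).1, hβΩ (hQ hp).2⟩
    rw [inter_eq_left.2 hQΩ]
    have hc := (hβc.prod hβc).of_isClosed_subset isClosed_closure hQ
    exact ⟨hQΩ, fun K hK _ => ⟨hc.inter_right (hK.isClosed.preimage continuous_fst),
      hc.inter_right (hK.isClosed.preimage continuous_snd)⟩⟩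
  · refine Filter.Eventually.filter_mono (nhdsSet_mono hC) ?_
    refine Filter.mem_of_superset ((hO.prod hO).mem_nhdsSet.2 (prod_mono hSO hSO)) fun p hp => ?_
    change β p.1 * β p.2 = 1
    rw [hβ1 _ hp.1, hβ1 _ hp.2, one_mul]

/-- The support of the kernel is a compact subset of supp φ × supp φ, so properness is automatic. -/
theorem exists_coneOperator {Ω : Opens (Rn n)} {U : G Ω} {u : Eps → Rn n → ℂ} (hu : IsRep u U)
    {φ ψ : Rn n → ℂ} (hφ : ContDiff ℝ ∞ φ) (hφc : HasCompactSupport φ) (hφΩ : tsupport φ ⊆ Ω)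
    (hψ : FrequencySymbol ψ) {N : ℝ}
    (hreg : ∀ L : ℕ, BigOOn {ξ | ψ ξ ≠ 0}
      (fun ε ξ => ((jap ξ ^ L : ℝ) : ℂ) * fourierHat (fun y => φ y * u ε y) ξ) (-N)) :
    ∃ A : Symbol Ω 0, IsSymRep (fun _ => coneSymbol φ ψ) A ∧ ProperlySupported A ∧
      ∃ V ∈ Ginf Ω, IsOpValue A U V := by
  have hmem := (globalSymbols_coneSymbol hφ hφc hψ).mem_slowScaleSymbols Ω
  set A : Symbol Ω 0 := (negligibleSymbols Ω 0).mkQ ⟨_, hmem⟩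
  have hA : IsSymRep (fun _ => coneSymbol φ ψ) A := ⟨hmem, rfl⟩
  have hφ0 : ∀ x, x ∉ tsupport φ → φ x = 0 := fun x hx => notMem_tsupport hx
  set S := tsupport φ with hS
  have hSΩ : S ×ˢ S ⊆ (opensProd Ω Ω : Opens (Rn n × Rn n)) := prod_mono hφΩ hφΩ
  have hsub : kernelSupport A ⊆ S ×ˢ S := by
    refine kernelSupport_subset hA (hφc.isClosed.prod hφc.isClosed) fun f x hf hfc h => ?_
    rw [pseudo_coneSymbol hφ hφc hψ hf hfc]
    by_cases hx : x ∈ S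
    · have : ∀ y, φ y * f y = 0 := fun y => by
        by_cases hy : y ∈ S
        · rw [h y ⟨hx, hy⟩, mul_zero]
        · rw [hφ0 y hy, zero_mul]
      simp [fourierHat_zero this]
    · rw [hφ0 x hx, zero_mul]
  have hcompact : IsCompact (kernelSupport A) := (hφc.prod hφc).of_isClosed_subset
    (isClosed_kernelSupport (hφc.isClosed.prod hφc.isClosed) hSΩ hsub) hsub
  refine ⟨A, hA, ⟨hsub.trans hSΩ, fun K hK _ => ⟨hcompact.inter_right (hK.isClosed.preimage continuous_fst),
    hcompact.inter_right (hK.isClosed.preimage continuous_snd)⟩⟩, ?_⟩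
  -- Since β = 1 on supp φ, the proper cut-off β(x)β(y) is swallowed by the two factors φ of the
  -- operator.
  obtain ⟨β, hβ, hβc, hβΩ, hβ1, hβC⟩ := exists_isProperCutoff hφc hφΩ
  have hsm : ∀ {θ : Rn n → ℂ}, ContDiff ℝ ∞ θ → HasCompactSupport θ → tsupport θ ⊆ Ω → ∀ ε,
      ContDiff ℝ ∞ fun y => θ y * u ε y := fun hθ hθc hθΩ ε =>
    contDiff_of_contDiffOn_of_compact Ω.isOpen hθc.isClosed hθΩ (hθ.contDiffOn.mul (hu.1.1 ε))
      fun y hy => by rw [notMem_tsupport hy, zero_mul]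
  obtain ⟨hF, hFb⟩ := bigOOn_dirD_integral_wave hψ (hsm hφ hφc hφΩ) (fun ε => hφc.mul_right) hreg
  set z : ℂ := ((2 * Real.pi : ℝ) : ℂ)⁻¹ ^ n with hz
  set w : Eps → Rn n → ℂ := fun ε x =>
    (∫ ζ, wave x ζ * (ψ ζ * fourierHat (fun y => φ y * u ε y) ζ)) * (z * φ x) with hw
  have hws : ∀ ε, ContDiff ℝ ∞ (w ε) := fun ε => (hF ε).mul (contDiff_const.mul hφ)
  have hwb : ∀ (K : Set (Rn n)) (l : List (Rn n)), BigOOn K (fun ε => dirD l (w ε)) (-(N + 1)) := fun K l => by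
    have hb : UCls (symScale (fun _ => le_rfl) (id : Eps → Eps) fun _ => (0 : Rn n)) 0
        fun _ x => z * φ x := UCls.of_hasCompactSupport rfl (contDiff_const.mul hφ) hφc fun x hx => by
      rw [hφ0 x hx, mul_zero]
    -- The product estimate is reused with the slow scale net 1. The resulting exponent N + 1 is
    -- wasteful, but independent of l.
    obtain ⟨C, -, h⟩ := eventually_norm_dirD_mul_le (l := l) one_mem_slowScale isOpen_univ hφc.isClosed
      (subset_univ _) (fun ε => (hF ε).contDiffOn) hb (fun _ x hx => by rw [hφ0 x hx, mul_zero])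
      fun p _ => hFb _ p.1
    exact bigOOn_iff.2 ⟨C, h.mono fun ε hε x _ => hε ε rfl x⟩
  have hwm : w ∈ moderate Ω := ⟨fun ε => (hws ε).contDiffOn, fun K _ _ l => ⟨N + 1, hwb K l⟩⟩
  refine ⟨(negligible Ω).mkQ ⟨w, hwm⟩, ⟨w, ⟨hwm, rfl⟩, fun K _ _ => ⟨N + 1, hwb K⟩⟩,
    fun _ => coneSymbol φ ψ, u, w, _, hA, hu, ⟨hwm, rfl⟩, hβC _ hsub, fun ε x _ => ?_⟩
  have h1 : (fun y => β x * β y * u ε y) = fun y => β x * (β y * u ε y) := funext fun y => mul_assoc _ _ _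
  have h2 : (fun y => φ y * (β y * u ε y)) = fun y => φ y * u ε y := funext fun y => by
    by_cases hy : y ∈ S
    · rw [hβ1 y hy, one_mul]
    · rw [hφ0 y hy, zero_mul, zero_mul]
  beta_reduce
  rw [h1, pseudo_const_mul, pseudo_coneSymbol hφ hφc hψ (hsm hβ hβc hβΩ ε) hβc.mul_right, h2]
  by_cases hx : x ∈ S
  · rw [hβ1 x hx, hw]
    ring
  · simp [hw, hφ0 x hx]

/-- Taylor's formula of order 0: the gradient of ψ is O(⟨·⟩⁻¹), Peetre's inequality along the
segment costs one factor ⟨η⟩, and the increment η another. -/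
theorem FrequencySymbol.exists_norm_sub_le {ψ : Rn n → ℂ} (hψ : FrequencySymbol ψ) :
    ∃ C : ℝ, 0 ≤ C ∧ ∀ ξ η, ‖ψ (η + ξ) - ψ ξ‖ ≤ C * (jap ξ)⁻¹ * jap η ^ 2 := by
  choose C hC h using fun i : Fin n => hψ.bound [unitVec i]
  have hS : 0 ≤ ∑ i, C i := Finset.sum_nonneg fun i _ => hC i
  refine ⟨2 * ∑ i, C i, by positivity, fun ξ η => ?_⟩
  have hjξ := jap_pos ξ
  have hjη := jap_pos η
  have h1 := norm_sub_taylor_le hψ.contDiff ξ η 0 (C := 2 * (∑ i, C i) * (jap ξ)⁻¹ * jap η ^ 2)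
    fun t ht => by
      have hd : dirD (List.replicate (0 + 1) η) ψ (ξ + t • η) =
          ∑ i, ((η i : ℝ) : ℂ) * dirD [unitVec i] ψ (ξ + t • η) := by
        simp only [zero_add, List.replicate_one, dirD]
        conv_lhs => rw [← sum_coord_smul_unitVec η]
        rw [map_sum]
        refine Finset.sum_congr rfl fun i _ => ?_
        rw [map_smul, Complex.real_smul, sum_coord_smul_unitVec]
      have ht1 : |t| ≤ 1 := abs_le.2 ⟨by linarith [ht.1], ht.2⟩
      have hj : (jap (ξ + t • η))⁻¹ ≤ 2 * (jap ξ)⁻¹ * jap η :=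
        (inv_jap_add_le ξ (t • η)).trans (by gcongr; exact jap_smul_le ht1 η)
      rw [hd]
      calc _ ≤ ∑ i, jap η * (C i * (2 * (jap ξ)⁻¹ * jap η)) := by
            refine (norm_sum_le _ _).trans (Finset.sum_le_sum fun i _ => ?_)
            rw [norm_mul, Complex.norm_real]
            have h2 := h i (ξ + t • η)
            rw [List.length_singleton, pow_one] at h2
            refine mul_le_mul (abs_coord_le_jap η i) (h2.trans ?_) (norm_nonneg _) hjη.le
            have := hC i
            gcongr
        _ = _ := by
          rw [← Finset.mul_sum, ← Finset.sum_mul]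
          ring
  simpa [dirD, add_comm] using h1

/-- This identifies the principal symbol. Replacing ψ(η + ξ) by ψ(ξ) in the amplitude costs
O(⟨ξ⟩⁻¹), and the remaining integral is φ(x) by Fourier inversion. -/
theorem exists_norm_coneSymbol_sub_le {φ ψ : Rn n → ℂ} (hφ : ContDiff ℝ ∞ φ) (hφc : HasCompactSupport φ)
    (hψ : FrequencySymbol ψ) :
    ∃ C : ℝ, 0 ≤ C ∧ ∀ x ξ, ‖coneSymbol φ ψ (x, ξ) - φ x * φ x * ψ ξ‖ ≤ C * (jap ξ)⁻¹ := by
  obtain ⟨C, hC, h⟩ := hψ.exists_norm_sub_le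
  obtain ⟨D, hD, hk⟩ := rapidDecay_fourierHat hφ hφc (2 + (n + 1))
  obtain ⟨B₀, hB₀⟩ := hφc.exists_bound_of_continuous hφ.continuous
  have hB0 : 0 ≤ B₀ := (norm_nonneg _).trans (hB₀ 0)
  have hφi := integrable_fourierHat hφ hφc fun _ hx => notMem_tsupport hx
  obtain ⟨M, hM, hψM⟩ := hψ.exists_norm_le
  set z : ℂ := ((2 * Real.pi : ℝ) : ℂ)⁻¹ ^ n with hz
  set I : ℝ := ∫ ξ : Rn n, (jap ξ ^ (n + 1))⁻¹
  have hI : 0 ≤ I := integral_nonneg fun η => inv_nonneg.2 (pow_nonneg (jap_pos η).le _)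
  refine ⟨‖z‖ * B₀ * (C * D * I), by positivity, fun x ξ => ?_⟩
  have hjξ := jap_pos ξ
  have hψc := hψ.contDiff.continuous
  have hi1 : Integrable fun η => (wave x η * ψ (η + ξ)) * fourierHat φ η :=
    hφi.bdd_mul (c := M) (by fun_prop : Continuous fun η => wave x η * ψ (η + ξ)).aestronglyMeasurable
      (Filter.Eventually.of_forall fun η => by
        rw [norm_mul, norm_wave, one_mul]
        exact hψM _)
  have hi2 : Integrable fun η => ψ ξ * (wave x η * fourierHat φ η) :=
    (hφi.bdd_mul (c := 1) (by fun_prop : Continuous fun η => wave x η).aestronglyMeasurable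
      (Filter.Eventually.of_forall fun η => (norm_wave x η).le)).const_mul _
  have h1 : coneSymbol φ ψ (x, ξ) - φ x * φ x * ψ ξ = z * φ x *
      ∫ η, ((wave x η * ψ (η + ξ)) * fourierHat φ η - ψ ξ * (wave x η * fourierHat φ η)) := by
    rw [integral_sub hi1 hi2, integral_const_mul, coneSymbol, convAmp, mul_sub]
    congr 1
    have := fourier_inversion hφ hφc (fun _ hx => notMem_tsupport hx) x
    linear_combination (-(φ x * ψ ξ)) * this
  rw [h1, norm_mul, norm_mul]
  have h2 : ‖∫ η, ((wave x η * ψ (η + ξ)) * fourierHat φ η - ψ ξ * (wave x η * fourierHat φ η))‖ ≤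
      C * (jap ξ)⁻¹ * D * I := by
    rw [← integral_const_mul]
    refine norm_integral_le_of_norm_le (integrable_inv_jap_pow.const_mul _)
      (Filter.Eventually.of_forall fun η => ?_)
    have hjη := jap_pos η
    rw [show (wave x η * ψ (η + ξ)) * fourierHat φ η - ψ ξ * (wave x η * fourierHat φ η) =
      wave x η * ((ψ (η + ξ) - ψ ξ) * fourierHat φ η) by ring, norm_mul, norm_wave, one_mul, norm_mul]
    calc _ ≤ (C * (jap ξ)⁻¹ * jap η ^ 2) * (D * (jap η ^ (2 + (n + 1)))⁻¹) :=
          mul_le_mul (h ξ η) (hk η) (norm_nonneg _) (by positivity)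
      _ = _ := by
        rw [pow_add]
        field_simp
  calc _ ≤ ‖z‖ * B₀ * (C * (jap ξ)⁻¹ * D * I) := by
        gcongr
        exact hB₀ x
    _ = _ := by ring

theorem const_mem_slowScale {c : ℝ} (hc : 0 < c) : (fun _ => c) ∈ slowScale :=
  ⟨⟨c, hc, fun _ => le_rfl⟩, fun p _ => ⟨c ^ p, Real.rpow_pos_of_pos hc p, fun ε =>
    le_mul_of_one_le_right (Real.rpow_nonneg hc.le p) ((one_le_inv₀ ε.2.1).2 ε.2.2)⟩⟩

/-- At large frequencies `dir ξ` is close to the unit vector ξ/|ξ|, so a cut-off that is 1 near a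
unit vector gives a symbol that is 1 on the far part of a cone. -/
theorem norm_dir_sub_le {ξ : Rn n} (hξ : ξ ≠ 0) : ‖dir ξ - ‖ξ‖⁻¹ • ξ‖ ≤ ‖ξ‖⁻¹ := by
  have h0 : 0 < ‖ξ‖ := norm_pos_iff.2 hξ
  have hj := jap_pos ξ
  have h1 : (jap ξ)⁻¹ ≤ ‖ξ‖⁻¹ := inv_anti₀ h0 (norm_le_jap ξ)
  rw [dir, ← sub_smul, norm_smul, Real.norm_eq_abs, abs_sub_comm, abs_of_nonneg (sub_nonneg.2 h1),
    sub_mul, inv_mul_cancel₀ h0.ne']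
  refine le_trans ?_ h1
  rw [sub_le_iff_le_add, ← mul_one_add, ← div_eq_inv_mul, le_div_iff₀ hj, one_mul]
  exact jap_le_one_add_norm ξ

/-- The open cone over the ball with center `e` and radius `ρ`. -/
def coneAt (e : Rn n) (ρ : ℝ) : Set (Rn n) := {ξ | ξ ≠ 0 ∧ ‖ξ‖⁻¹ • ξ ∈ Metric.ball e ρ}

theorem isConicNhd_coneAt {ξ₀ : Rn n} (hξ₀ : ξ₀ ≠ 0) {ρ : ℝ} (hρ : 0 < ρ) :
    IsConicNhd (coneAt (‖ξ₀‖⁻¹ • ξ₀) ρ) ξ₀ := by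
  refine ⟨?_, ⟨hξ₀, Metric.mem_ball_self hρ⟩, fun h => h.1 rfl, fun t ht ξ hξ => ⟨?_, ?_⟩⟩
  · have hc : ContinuousOn (fun ξ : Rn n => ‖ξ‖⁻¹ • ξ) {ξ | ξ ≠ 0} :=
      (continuous_norm.continuousOn.inv₀ fun ξ hξ => norm_ne_zero_iff.2 hξ).smul continuousOn_id
    have hcone : coneAt (‖ξ₀‖⁻¹ • ξ₀) ρ =
        {ξ | ξ ≠ 0} ∩ (fun ξ : Rn n => ‖ξ‖⁻¹ • ξ) ⁻¹' Metric.ball (‖ξ₀‖⁻¹ • ξ₀) ρ := rfl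
    rw [hcone]
    exact hc.isOpen_inter_preimage isOpen_compl_singleton Metric.isOpen_ball
  · exact smul_ne_zero ht.ne' hξ.1
  · rw [norm_smul, Real.norm_of_nonneg ht.le, mul_inv, smul_smul, mul_right_comm,
      inv_mul_cancel₀ ht.ne', one_mul]
    exact hξ.2

/-- The cut-off g is 1 near ξ₀/|ξ₀| and supported in Γ; as Γ is conic, ψ = g ∘ `dir` is supported in
Γ too, where the transform of φu is under control. -/
theorem exists_elliptic_of_microlocallyRegular {Ω : Opens (Rn n)} {U : G Ω} {x₀ ξ₀ : Rn n}
    (h₀ : (x₀, ξ₀) ∈ cotangent Ω) (h : MicrolocallyRegular U x₀ ξ₀) :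
    ∃ A : Symbol Ω 0, ProperlySupported A ∧ (∃ V ∈ Ginf Ω, IsOpValue A U V) ∧ (x₀, ξ₀) ∈ Ell A := by
  obtain ⟨u, hu, φ, hφ, hφc, hφΩ, hφ1, Γ, hΓ, N, hN⟩ := h
  have hξ₀ : ξ₀ ≠ 0 := h₀.2
  set e := ‖ξ₀‖⁻¹ • ξ₀ with he
  have heΓ : e ∈ Γ := hΓ.2.2.2 _ (inv_pos.2 (norm_pos_iff.2 hξ₀)) _ hΓ.2.1
  obtain ⟨g, hg, hgc, hgΓ, O, hO, heO, hg1⟩ := exists_cutoff (isCompact_singleton (x := e)) hΓ.1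
    (singleton_subset_iff.2 heΓ)
  have hψ := frequencySymbol_comp_dir hg hgc
  set ψ : Rn n → ℂ := fun ξ => g (dir ξ) with hψdef
  have hψΓ : {ξ | ψ ξ ≠ 0} ⊆ Γ := fun ξ hξ => by
    have h1 : dir ξ ∈ Γ := hgΓ (subset_tsupport g hξ)
    have h2 := hΓ.2.2.2 _ (jap_pos ξ) _ h1
    rwa [dir, smul_smul, mul_inv_cancel₀ (jap_pos ξ).ne', one_smul] at h2
  obtain ⟨A, hA, hprop, hval⟩ := exists_coneOperator hu hφ hφc hφΩ hψ (N := N) fun L => by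
    obtain ⟨C, ε₀, hε₀, H⟩ := hN L
    refine ⟨C, ε₀, hε₀, fun ε hε ξ hξ => ?_⟩
    simpa only [Real.rpow_natCast] using H ε hε ξ (hψΓ hξ)
  refine ⟨A, hprop, hval, h₀, _, hA, ?_⟩
  obtain ⟨C, hC, hsymb⟩ := exists_norm_coneSymbol_sub_le hφ hφc hψ
  -- The symbol is φ²ψ up to an error of at most 1/4, so |φ²| > 3/4 leaves the lower bound 1/2 =
  -- 1/s.
  have hev : ∀ᶠ x in 𝓝 x₀, 3 / 4 < ‖φ x * φ x‖ := by
    have hc : Continuous fun x => ‖φ x * φ x‖ := (hφ.continuous.mul hφ.continuous).norm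
    refine hc.continuousAt.eventually (lt_mem_nhds ?_)
    beta_reduce
    rw [hφ1]
    norm_num
  obtain ⟨δ, hδ, hball⟩ := Metric.mem_nhds_iff.1 (Filter.inter_mem hev (Ω.isOpen.mem_nhds h₀.1))
  have hcl : closure (Metric.ball x₀ (δ / 2)) ⊆ Metric.closedBall x₀ (δ / 2) := Metric.closure_ball_subset_closedBall
  obtain ⟨ρ, hρ, hρO⟩ := Metric.mem_nhds_iff.1 (hO.mem_nhds (heO rfl))
  -- The radius 2/ρ brings `dir ξ` within ρ/2 of ξ/|ξ|, so that ψ = 1 there; the radius 4(C+1) makes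
  -- the error C⟨ξ⟩⁻¹ at most 1/4.
  refine ⟨Metric.ball x₀ (δ / 2), coneAt e (ρ / 2), Metric.isOpen_ball, Metric.mem_ball_self (half_pos hδ),
    (isCompact_closedBall _ _).of_isClosed_subset isClosed_closure hcl,
    (hcl.trans (Metric.closedBall_subset_ball (half_lt_self hδ))).trans fun x hx => (hball hx).2,
    isConicNhd_coneAt hξ₀ (half_pos hρ), fun _ => max (2 / ρ) (4 * (C + 1)),
    const_mem_slowScale (lt_max_of_lt_left (by positivity)), fun _ => 2, const_mem_slowScale two_pos,
    fun x hx ξ hξ _ hr => ?_⟩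
  rw [Real.rpow_zero, mul_one]
  have hξ0 : 0 < ‖ξ‖ := norm_pos_iff.2 hξ.1
  have hj := jap_pos ξ
  have hψ1 : ψ ξ = 1 := by
    refine hg1 _ (hρO ?_)
    have h1 := norm_dir_sub_le hξ.1
    have h2 : ‖ξ‖⁻¹ ≤ ρ / 2 := by
      rw [inv_le_comm₀ hξ0 (half_pos hρ), inv_div]
      exact (le_max_left _ _).trans hr
    have h3 : dist (‖ξ‖⁻¹ • ξ) e < ρ / 2 := hξ.2
    rw [Metric.mem_ball]
    refine (dist_triangle _ (‖ξ‖⁻¹ • ξ) _).trans_lt ?_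
    rw [dist_eq_norm]
    linarith
  have h1 := hsymb x ξ
  rw [hψ1, mul_one] at h1
  have h2 : C * (jap ξ)⁻¹ ≤ 1 / 4 := by
    rw [← div_eq_mul_inv, div_le_iff₀ hj]
    have := ((le_max_right _ _).trans hr).trans (norm_le_jap ξ)
    linarith
  have h3 : 3 / 4 < ‖φ x * φ x‖ := (hball (Metric.ball_subset_ball (half_le_self hδ.le) hx)).1
  have h4 := norm_sub_norm_le (φ x * φ x) (coneSymbol φ ψ (x, ξ))
  rw [norm_sub_rev] at h4
  linarith

/-- The zero operator, obtained from φ = 0. It guarantees that the intersection defining W_sc is not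
over an empty family. -/
theorem exists_properlySupported_regular {Ω : Opens (Rn n)} (U : G Ω) :
    ∃ A : Symbol Ω 0, ProperlySupported A ∧ ∃ V ∈ Ginf Ω, IsOpValue A U V := by
  obtain ⟨⟨u, hu⟩, hU⟩ := (negligible Ω).mkQ_surjective U
  obtain ⟨A, -, h1, h2⟩ := exists_coneOperator (N := 0) (φ := fun _ => 0) (ψ := fun ξ => (fun _ => 0) (dir ξ))
    (show IsRep u U from ⟨hu, hU⟩) contDiff_const HasCompactSupport.zero
    (by simp [tsupport]) (frequencySymbol_comp_dir contDiff_const HasCompactSupport.zero)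
    fun L => ⟨0, 1, one_pos, fun ε _ ξ hξ => absurd rfl hξ⟩
  exact ⟨A, h1, h2⟩

end EllipticOperators
end

end Colombeau

/-! ### Equality of the two wave front sets -/

theorem theorem2p6 {n : ℕ} (Ω : TopologicalSpace.Opens (EuclideanSpace ℝ (Fin n)))
    (u : Colombeau.G Ω) : Colombeau.Wsc u = Colombeau.WFg u := by
  ext p
  simp only [Colombeau.Wsc, Set.mem_iInter₂, Set.mem_ofPred_eq]
  constructor
  · intro h
    -- Some admissible operator is needed to conclude that p has its base point in Ω and a nonzero
    -- frequency.
    obtain ⟨A₀, hA₀⟩ := Colombeau.exists_properlySupported_regular u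
    have hp := (h A₀ hA₀).1
    refine ⟨hp, fun hreg => ?_⟩
    obtain ⟨A, hA, hV, hell⟩ := Colombeau.exists_elliptic_of_microlocallyRegular hp hreg
    exact (h A ⟨hA, hV⟩).2 hell
  · rintro ⟨hp, hreg⟩ A ⟨-, V, hV, hA⟩
    exact ⟨hp, fun hell => hreg (Colombeau.microlocallyRegular_of_mem_ell hA hV hell)⟩
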